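/- Let $q\in(0,1)$ and let $(\omega_{i,j})_{i,j\ge 1}$ be independent random variables with $\mathbb{P}(\omega_{i,j}=k)=(1-q^2)q^{2k}$ for $k=0,1,2,\ldots$. For integers $n,m\ge 1$ let $$G_{n,m}=\max_{\pi}\sum_{(i,j)\in\pi}\omega_{i,j},$$ where the maximum is over all up-right lattice paths $\pi$ from $(1,1)$ to $(n,m)$ (each step increases exactly one coordinate by $1$). For integers $0\le N\le M$ let $\mathsf{T}_{N,M}$ be the top-left $N\times N$ submatrix of a Haar distributed $M\times M$ unitary matrix. Let $G$ denote the Barnes $G$-function, $G(z+1)=\Gamma(z)G(z)$, $G(1)=1$. Then for all integers $n\ge m\ge 1$ and every integer $\ell\ge 0$, $$\mathbb{P}(G_{n,m}\le \ell)=c_{\ell,n,m}\,(1-q^2)^{nm}\,\mathbb{E}\big(|\det(\mathsf{T}_{\ell,\ell+n-m}-q)|^{2m}\big),$$ where $$c_{\ell,n,m}:=\prod_{j=1}^{m}\frac{(\ell+n-m+j-1)!\,(j-1)!}{(n-m+j-1)!\,(\ell+j-1)!}=\frac{G(\ell+1)\,G(m+1)\,G(\ell+n+1)\,G(n-m+1)}{G(\ell+m+1)\,G(\ell+n-m+1)\,G(n+1)}.$$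 For $\ell=0$ the determinant of the empty matrix is $1$. -/

import Mathlib

open MeasureTheory ProbabilityTheory

/-! ### Geometric last passage percolation -/

/-- One step of an up-right path: exactly one of the two coordinates increases by one. -/
def UpRightStep (a b : ℕ+ × ℕ+) : Prop :=
  b = (a.1 + 1, a.2) ∨ b = (a.1, a.2 + 1)

/-- The up-right paths from `(1, 1)` to `(n, m)`, as lists of visited sites. -/
def upRightPaths (n m : ℕ+) : Set (List (ℕ+ × ℕ+)) :=
  {π | π.IsChain UpRightStep ∧ π.head? = some (1, 1) ∧ π.getLast? = some (n, m)}

/-- The last passage time for the weights `w`: the maximum over all up-right paths from `(1, 1)`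
to `(n, m)` of the total weight collected on the path. (The supremum is a maximum, see
`isGreatest_lastPassageTime`.) -/
noncomputable def lastPassageTime (w : ℕ+ × ℕ+ → ℕ) (n m : ℕ+) : ℕ :=
  sSup ((fun π : List (ℕ+ × ℕ+) => (π.map w).sum) '' upRightPaths n m)

/-- `ω` is a geometric environment with parameter `q ^ 2` on the probability space `(Ω, P)`: the
weights are independent random variables with `P (ω s = k) = (1 - q ^ 2) * (q ^ 2) ^ k`. -/
structure IsGeometricEnvironment {Ω : Type*} [MeasurableSpace Ω] (P : Measure Ω) (q : ℝ)
    (ω : ℕ+ × ℕ+ → Ω → ℕ) : Prop where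
  measurable : ∀ s, Measurable (ω s)
  indep : iIndepFun ω P
  law : ∀ s k, P.real {x | ω s x = k} = (1 - q ^ 2) * q ^ (2 * k)

theorem UpRightStep.lt {a b : ℕ+ × ℕ+} (h : UpRightStep a b) : a < b := by
  rcases h with rfl | rfl
  · exact Prod.mk_lt_mk.2 (Or.inl ⟨PNat.lt_add_right _ _, le_rfl⟩)
  · exact Prod.mk_lt_mk.2 (Or.inr ⟨le_rfl, PNat.lt_add_right _ _⟩)

theorem sum_le_of_mem_upRightPaths (w : ℕ+ × ℕ+ → ℕ) {n m : ℕ+} {π : List (ℕ+ × ℕ+)}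
    (hπ : π ∈ upRightPaths n m) :
    (π.map w).sum ≤ ∑ s ∈ Finset.Icc ((1 : ℕ+), (1 : ℕ+)) (n, m), w s := by
  obtain ⟨hc, -, hl⟩ := hπ
  have hp : π.Pairwise (· < ·) := (hc.imp fun _ _ h => h.lt).pairwise
  have hnd : π.Nodup := hp.imp fun h => h.ne
  obtain ⟨l, rfl⟩ : ∃ l, π = l ++ [(n, m)] := by
    obtain ⟨l, hl⟩ := List.getLast?_eq_some_iff.1 hl
    exact ⟨l, hl⟩
  rw [← List.sum_toFinset _ hnd]
  refine Finset.sum_le_sum_of_subset fun s hs => ?_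
  have hs : s ∈ l ++ [(n, m)] := by simpa [or_comm] using hs
  refine Finset.mem_Icc.2 ⟨⟨one_le, one_le⟩, ?_⟩
  rcases List.mem_append.1 hs with h | h
  · exact ((List.pairwise_append.1 hp).2.2 s h _ (by simp)).le
  · rw [List.mem_singleton.1 h]

theorem upRightPaths_nonempty (n m : ℕ+) : (upRightPaths n m).Nonempty := by
  have key : ∀ {a b c : ℕ+ × ℕ+} {π : List (ℕ+ × ℕ+)}, π.IsChain UpRightStep →
      π.head? = some a → π.getLast? = some b → UpRightStep b c →
      (π ++ [c]).IsChain UpRightStep ∧ (π ++ [c]).head? = some a ∧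
        (π ++ [c]).getLast? = some c := by
    intro a b c π h1 h2 h3 h4
    refine ⟨List.isChain_append.2 ⟨h1, by simp, ?_⟩, by simp [h2], by simp⟩
    intro x hx y hy
    simp_all
  induction m using PNat.recOn with
  | one =>
    induction n using PNat.recOn with
    | one => exact ⟨[(1, 1)], by simp [upRightPaths]⟩
    | succ n ih =>
      obtain ⟨π, h1, h2, h3⟩ := ih
      exact ⟨_, key h1 h2 h3 (Or.inl rfl)⟩
  | succ m ih =>
    obtain ⟨π, h1, h2, h3⟩ := ih
    exact ⟨_, key h1 h2 h3 (Or.inr rfl)⟩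

/-- The last passage time is the maximum of the path sums. -/
theorem isGreatest_lastPassageTime (w : ℕ+ × ℕ+ → ℕ) (n m : ℕ+) :
    IsGreatest ((fun π : List (ℕ+ × ℕ+) => (π.map w).sum) '' upRightPaths n m)
      (lastPassageTime w n m) := by
  have hb : BddAbove ((fun π : List (ℕ+ × ℕ+) => (π.map w).sum) '' upRightPaths n m) := by
    refine ⟨∑ s ∈ Finset.Icc ((1 : ℕ+), (1 : ℕ+)) (n, m), w s, ?_⟩
    rintro _ ⟨π, hπ, rfl⟩
    exact sum_le_of_mem_upRightPaths w hπ
  exact ⟨Nat.sSup_mem ((upRightPaths_nonempty n m).image _) hb, fun _ hx => le_csSup hb hx⟩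

/-! ### The circular and the truncated unitary ensemble -/

/-- The Borel σ-algebra of the unitary group. -/
noncomputable instance unitaryGroup_measurableSpace (M : ℕ) :
    MeasurableSpace (Matrix.unitaryGroup (Fin M) ℂ) := borel _

instance unitaryGroup_borelSpace (M : ℕ) : BorelSpace (Matrix.unitaryGroup (Fin M) ℂ) := ⟨rfl⟩

instance unitaryGroup_compactSpace (M : ℕ) : CompactSpace (Matrix.unitaryGroup (Fin M) ℂ) := by
  refine isCompact_iff_compactSpace.1 ?_
  have hK : IsCompact (Set.univ.pi fun _ : Fin M => Set.univ.pi fun _ : Fin M =>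
      Metric.closedBall (0 : ℂ) 1) :=
    isCompact_univ_pi fun _ => isCompact_univ_pi fun _ => isCompact_closedBall _ _
  refine IsCompact.of_isClosed_subset (X := Matrix (Fin M) (Fin M) ℂ) hK ?_ ?_
  · have : ((Matrix.unitaryGroup (Fin M) ℂ : Set (Matrix (Fin M) (Fin M) ℂ))) =
        {A | A * star A = 1} := by
      ext A
      exact Matrix.mem_unitaryGroup_iff
    rw [this]
    exact isClosed_eq (by fun_prop) continuous_const
  · intro A hA i _ j _
    simpa using entry_norm_bound_of_unitary hA i j

/-- The circular unitary ensemble of size `M`: the Haar measure on the unitary group `U(M)`,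
normalized to have total mass `1`. -/
noncomputable def cue (M : ℕ) : Measure (Matrix.unitaryGroup (Fin M) ℂ) :=
  Measure.haarMeasure ⊤

instance cue_isProbabilityMeasure (M : ℕ) : IsProbabilityMeasure (cue M) :=
  ⟨by
    simpa [cue] using Measure.haarMeasure_self
      (K₀ := (⊤ : TopologicalSpace.PositiveCompacts (Matrix.unitaryGroup (Fin M) ℂ)))⟩

/-- The top-left `N × N` submatrix of an `M × M` unitary matrix, `N ≤ M`. For `U` distributed
according to `cue M` this is the truncated unitary random matrix `T_{N,M}`. -/
def topLeftBlock {N M : ℕ} (h : N ≤ M) (U : Matrix.unitaryGroup (Fin M) ℂ) :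
    Matrix (Fin N) (Fin N) ℂ :=
  (U : Matrix (Fin M) (Fin M) ℂ).submatrix (Fin.castLE h) (Fin.castLE h)

/-! ### The constant -/

/-- The Barnes `G`-function at natural numbers, given by `G(z + 1) = Γ(z) G(z)` and `G(1) = 1`
(and `G(0) = 0`). -/
noncomputable def barnesG : ℕ → ℝ
  | 0 => 0
  | 1 => 1
  | k + 2 => Real.Gamma (k + 1) * barnesG (k + 1)

/-- Any function on `ℂ` that is normalized by `G(1) = 1` and satisfies the functional equation away
from the poles of `Γ` agrees with `barnesG` at the positive integers. -/
theorem eq_barnesG_of_functional_equation (G : ℂ → ℂ) (h1 : G 1 = 1)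
    (h : ∀ z : ℂ, (∀ k : ℕ, z ≠ -k) → G (z + 1) = Complex.Gamma z * G z) (k : ℕ) :
    G ((k + 1 : ℕ) : ℂ) = (barnesG (k + 1) : ℂ) := by
  induction k with
  | zero => simpa [barnesG] using h1
  | succ k ih =>
    have := h ((k + 1 : ℕ) : ℂ) fun j hj => by
      have : ((k + 1 + j : ℕ) : ℂ) = 0 := by push_cast at hj ⊢; rw [hj]; ring
      exact absurd (Nat.cast_eq_zero.1 this) (by omega)
    rw [Nat.cast_succ (k + 1), this, ih, barnesG]
    push_cast [← Complex.Gamma_ofReal]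
    rfl

/-- The constant `c_{ℓ,n,m} = ∏_{j=1}^m (ℓ+n-m+j-1)! (j-1)! / ((n-m+j-1)! (ℓ+j-1)!)`, for
`m ≤ n`. -/
noncomputable def dualityConst (ℓ n m : ℕ) : ℝ :=
  ∏ j ∈ Finset.Icc 1 m,
    ((Nat.factorial (ℓ + (n - m) + (j - 1)) : ℝ) * (Nat.factorial (j - 1) : ℝ)) /
      ((Nat.factorial ((n - m) + (j - 1)) : ℝ) * (Nat.factorial (ℓ + (j - 1)) : ℝ))

/-!
With `t = q ^ 2`, both sides equal `(1 - t) ^ (n m)` times the Toeplitz determinant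
`Z = det [z^(ℓ + j - i)] (1 - z)^(-m) (1 - t z)^(-n)`, `0 ≤ i, j < m`.

For the percolation side, let `y_0 ≤ … ≤ y_{m-1}` be the last passage times to the `m` sites of row
`n`. As `n` grows they form a Markov chain, and by induction on `n` its law is
`(1 - t) ^ (n m) det [z^(y_j + j - i)] (1 - z)^(-(m - 1 - j)) (1 - t z)^(-n)` (`lppDet`,
`measureReal_lppArray_eq`). A step of the chain and the final summation over all `y` with
`y_{m-1} ≤ ℓ` are both instances of `sum_boundedChains_det`, which sums a determinant over weakly
increasing sequences one coordinate at a time: the inner sums telescope, and what remains at their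
lower ends is a multiple of the preceding column.

For the unitary side, let `T` be the truncated matrix, `X = -q T` and
`Ψ(x) = ∫ ∏_k det (1 + x_k X) conj (det (T - q)^m)`, a symmetric polynomial in `m` variables
(`cueMomentPoly`) whose value at `x_k = q⁻²` is a multiple of the desired moment. The invariance of
Haar measure yields an integration by parts formula for functions of `X`
(`integral_fderiv_topLeftBlock`). Applied to the entries of `(1 + x_k X)⁻¹ ∏_l det (1 + x_l X)` it
gives one loop equation for each `k` (`integral_loop_equation`), and the sum of these equations says
that `Δ Ψ`, with the Vandermonde determinant `Δ`, is an eigenvector of the sum over all variables of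
the hypergeometric operators `z (z - 1) ∂² + (M + m - 1 + (2 - ℓ) z) ∂`, where `M = ℓ + n - m`.
An antisymmetric polynomial of degree less than `ℓ + m` in each variable with this eigenvalue is
unique up to a scalar (`eq_zero_of_sumHypergeomOp_eq_smul`). Another one is the determinant of
`r_j(x_k)` for the sections `r_j(x) = [z^(ℓ + j)] (1 - z)^(-n) (1 - x z)⁻¹`, which is `Δ` times the
Toeplitz determinant of the symbol `(1 - z)^(-n) ∏_p (1 - x_p z)⁻¹` (`det_aeval_binomialSection`).
Hence `Ψ` is proportional to that Toeplitz determinant. The factor is found at `x = 0`, where `Ψ` is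
the mean value of an antiholomorphic function and the Toeplitz determinant is `dualityConst`
(`toeplitzDet_geomSeries_one_pow`); at `x_k = q⁻²` a rescaling of `z` turns it into `Z`.
-/

/-! ### Integration by parts over the unitary group -/

section haar

open scoped Matrix.Norms.Operator ComplexConjugate

/-- The derivative of `∫ Φ(exp(θ Y) U) dU` at `θ = 0` vanishes, because the integral does not depend
on `θ`: for skew-adjoint `Y` the matrix `exp(θ Y)` is unitary and Haar measure is invariant. -/
theorem integral_fderiv_skewAdjoint_mul {M : ℕ} {Φ : Matrix (Fin M) (Fin M) ℂ → ℂ}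
    (hΦ : ∀ U : Matrix.unitaryGroup (Fin M) ℂ, ContDiffAt ℝ 1 Φ U)
    {Y : Matrix (Fin M) (Fin M) ℂ} (hY : Y ∈ skewAdjoint (Matrix (Fin M) (Fin M) ℂ)) :
    ∫ U, fderiv ℝ Φ (U : Matrix (Fin M) (Fin M) ℂ) (Y * U) ∂(cue M) = 0 := by
  have hV : ∀ θ : ℝ, NormedSpace.exp (θ • Y) ∈ Matrix.unitaryGroup (Fin M) ℂ := by
    intro θ
    have h1 : star (NormedSpace.exp (θ • Y)) = NormedSpace.exp (-(θ • Y)) := by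
      rw [Matrix.star_eq_conjTranspose, ← Matrix.exp_conjTranspose, ← Matrix.star_eq_conjTranspose,
        star_smul, skewAdjoint.mem_iff.1 hY, smul_neg, star_trivial]
    rw [Matrix.mem_unitaryGroup_iff', h1, Matrix.exp_neg]
    exact Matrix.nonsing_inv_mul _ ((Matrix.isUnit_iff_isUnit_det _).1 (Matrix.isUnit_exp _))
  let V : ℝ → Matrix.unitaryGroup (Fin M) ℂ := fun θ => ⟨NormedSpace.exp (θ • Y), hV θ⟩
  have hVc : Continuous V := by
    refine Continuous.subtype_mk ?_ _
    exact NormedSpace.exp_continuous.comp (by fun_prop)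
  have hmem : ∀ θ (U : Matrix.unitaryGroup (Fin M) ℂ),
      ((V θ * U : Matrix.unitaryGroup (Fin M) ℂ) : Matrix (Fin M) (Fin M) ℂ) =
        NormedSpace.exp (θ • Y) * U := fun θ U => rfl
  -- the functions `U ↦ Φ U` and `U ↦ DΦ(U)` are continuous on the unitary group
  have hc0 : Continuous fun U : Matrix.unitaryGroup (Fin M) ℂ =>
      Φ (U : Matrix (Fin M) (Fin M) ℂ) :=
    continuous_iff_continuousAt.2 fun U =>
      (hΦ U).continuousAt.comp continuous_subtype_val.continuousAt
  have hc1 : Continuous fun U : Matrix.unitaryGroup (Fin M) ℂ =>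
      fderiv ℝ Φ (U : Matrix (Fin M) (Fin M) ℂ) :=
    continuous_iff_continuousAt.2 fun U =>
      (((hΦ U).fderiv_right (m := 0) (by norm_num)).continuousAt).comp
        continuous_subtype_val.continuousAt
  let F' : ℝ → Matrix.unitaryGroup (Fin M) ℂ → ℂ := fun θ U =>
    fderiv ℝ Φ ((V θ * U : Matrix.unitaryGroup (Fin M) ℂ) : Matrix (Fin M) (Fin M) ℂ)
      (Y * (V θ * U : Matrix.unitaryGroup (Fin M) ℂ))
  have hF'c : Continuous fun p : ℝ × Matrix.unitaryGroup (Fin M) ℂ => F' p.1 p.2 := by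
    have hm : Continuous fun p : ℝ × Matrix.unitaryGroup (Fin M) ℂ => V p.1 * p.2 :=
      (hVc.comp continuous_fst).mul continuous_snd
    exact (hc1.comp hm).clm_apply (continuous_const.mul (continuous_subtype_val.comp hm))
  obtain ⟨C, hC⟩ := ((isCompact_Icc (a := (-1 : ℝ)) (b := 1)).prod
    (isCompact_univ (X := Matrix.unitaryGroup (Fin M) ℂ))).exists_bound_of_continuousOn
      hF'c.continuousOn
  have hder := (hasDerivAt_integral_of_dominated_loc_of_deriv_le (μ := cue M) (x₀ := (0 : ℝ))
    (F := fun θ U => Φ ((V θ * U : Matrix.unitaryGroup (Fin M) ℂ) : Matrix (Fin M) (Fin M) ℂ))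
    (F' := F') (s := Set.Icc (-1) 1) (bound := fun _ => C)
    (Icc_mem_nhds (by norm_num) (by norm_num))
    (Filter.Eventually.of_forall fun θ =>
      (hc0.comp (continuous_const.mul continuous_id)).aestronglyMeasurable)
    ((hc0.comp (continuous_const.mul continuous_id)).integrable_of_hasCompactSupport
      (HasCompactSupport.of_compactSpace _))
    (hF'c.comp (Continuous.prodMk_right 0)).aestronglyMeasurable
    (Filter.Eventually.of_forall fun U θ hθ => hC (θ, U) ⟨hθ, trivial⟩)
    (integrable_const C)
    (Filter.Eventually.of_forall fun U θ hθ => by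
      have h1 : HasDerivAt (fun θ : ℝ => NormedSpace.exp (θ • Y) * (U : Matrix (Fin M) (Fin M) ℂ))
          (Y * NormedSpace.exp (θ • Y) * U) θ :=
        (hasDerivAt_exp_smul_const' Y θ).mul_const _
      have h2 := ((hΦ (V θ * U)).differentiableAt (by norm_num)).hasFDerivAt.comp_hasDerivAt θ h1
      simp only [F', hmem, ← mul_assoc]
      exact h2)).2
  have hconst : (fun θ => ∫ U, Φ ((V θ * U : Matrix.unitaryGroup (Fin M) ℂ) :
      Matrix (Fin M) (Fin M) ℂ) ∂(cue M)) =
        fun _ => ∫ U, Φ (U : Matrix (Fin M) (Fin M) ℂ) ∂(cue M) := by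
    funext θ
    have : (cue M).IsMulLeftInvariant := by unfold cue; infer_instance
    exact integral_mul_left_eq_self (fun U : Matrix.unitaryGroup (Fin M) ℂ =>
      Φ (U : Matrix (Fin M) (Fin M) ℂ)) (V θ)
  rw [hconst] at hder
  have h0 := hder.unique (hasDerivAt_const 0 _)
  have hV0 : V 0 = 1 := by ext1; simp [V]
  simpa [F', hV0] using h0

theorem continuous_unitaryGroup_of_contDiffAt {M : ℕ} {h : Matrix (Fin M) (Fin M) ℂ → ℂ}
    (hh : ∀ U : Matrix.unitaryGroup (Fin M) ℂ, ContDiffAt ℂ 1 h U) :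
    Continuous fun U : Matrix.unitaryGroup (Fin M) ℂ => h U :=
  continuous_iff_continuousAt.2 fun U =>
    (hh U).continuousAt.comp continuous_subtype_val.continuousAt

theorem continuous_unitaryGroup_fderiv {M : ℕ} {h : Matrix (Fin M) (Fin M) ℂ → ℂ}
    (hh : ∀ U : Matrix.unitaryGroup (Fin M) ℂ, ContDiffAt ℂ 1 h U) (E : Matrix (Fin M) (Fin M) ℂ) :
    Continuous fun U : Matrix.unitaryGroup (Fin M) ℂ => fderiv ℂ h U (E * U) := by
  refine Continuous.clm_apply (f := fun U : Matrix.unitaryGroup (Fin M) ℂ =>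
    fderiv ℂ h (U : Matrix (Fin M) (Fin M) ℂ)) ?_ (continuous_const.mul continuous_subtype_val)
  exact continuous_iff_continuousAt.2 fun U =>
    (((hh U).fderiv_right (m := 0) (by norm_num)).continuousAt).comp
      continuous_subtype_val.continuousAt

theorem integrable_cue_of_continuous {M : ℕ} {h : Matrix.unitaryGroup (Fin M) ℂ → ℂ}
    (hh : Continuous h) : Integrable h (cue M) :=
  hh.integrable_of_hasCompactSupport (HasCompactSupport.of_compactSpace _)

/-- For holomorphic `f` and `g`, the adjoint of the derivation in direction `E U` is the derivation
in direction `E* U`. This is the complexification of `integral_fderiv_skewAdjoint_mul`: on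
skew-adjoint directions the two terms cancel, and both sides are complex linear in `E`. -/
theorem integral_fderiv_mul_conj {M : ℕ} {f g : Matrix (Fin M) (Fin M) ℂ → ℂ}
    (hf : ∀ U : Matrix.unitaryGroup (Fin M) ℂ, ContDiffAt ℂ 1 f U)
    (hg : ∀ U : Matrix.unitaryGroup (Fin M) ℂ, ContDiffAt ℂ 1 g U)
    (E : Matrix (Fin M) (Fin M) ℂ) :
    ∫ U, fderiv ℂ f (U : Matrix (Fin M) (Fin M) ℂ) (E * U) * conj (g U) ∂(cue M) =
      ∫ U, f (U : Matrix (Fin M) (Fin M) ℂ) * conj (fderiv ℂ g U (star E * U)) ∂(cue M) := by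
  have hfR := fun U : Matrix.unitaryGroup (Fin M) ℂ => (hf U).restrict_scalars ℝ
  have hgR := fun U : Matrix.unitaryGroup (Fin M) ℂ => (hg U).restrict_scalars ℝ
  have cont := fun {h : Matrix (Fin M) (Fin M) ℂ → ℂ}
    (hh : ∀ U : Matrix.unitaryGroup (Fin M) ℂ, ContDiffAt ℂ 1 h U) =>
      And.intro (continuous_unitaryGroup_of_contDiffAt hh)
        (fun E => continuous_unitaryGroup_fderiv hh E)
  have int := @integrable_cue_of_continuous M
  have key : ∀ Y ∈ skewAdjoint (Matrix (Fin M) (Fin M) ℂ),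
      ∫ U, fderiv ℂ f (U : Matrix (Fin M) (Fin M) ℂ) (Y * U) * conj (g U) ∂(cue M) +
        ∫ U, f (U : Matrix (Fin M) (Fin M) ℂ) * conj (fderiv ℂ g U (Y * U)) ∂(cue M) = 0 := by
    intro Y hY
    have h := integral_fderiv_skewAdjoint_mul (Φ := fun X => f X * conj (g X))
      (fun U => (hfR U).mul (Complex.conjCLE.contDiff.contDiffAt.comp _ (hgR U))) hY
    rw [← integral_add, ← h]
    · refine integral_congr_ae (Filter.Eventually.of_forall fun U => ?_)
      have h1 := (((hf U).differentiableAt (by norm_num)).hasFDerivAt).restrictScalars ℝ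
      have h2 := (((hg U).differentiableAt (by norm_num)).hasFDerivAt).restrictScalars ℝ
      have h3 := (Complex.conjCLE.toContinuousLinearMap.hasFDerivAt).comp _ h2
      have h4 := (h1.mul h3).fderiv
      have h5 : fderiv ℝ (fun X => f X * conj (g X)) (U : Matrix (Fin M) (Fin M) ℂ) = _ := h4
      beta_reduce
      rw [h5]
      rw [add_comm, mul_comm (fderiv ℂ f _ _)]
      rfl
    · exact int (((cont hf).2 Y).mul (Complex.continuous_conj.comp (cont hg).1))
    · exact int ((cont hf).1.mul (Complex.continuous_conj.comp ((cont hg).2 Y)))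
  have lin : ∀ (c d : ℂ) (Y Z : Matrix (Fin M) (Fin M) ℂ),
      ∫ U, fderiv ℂ f (U : Matrix (Fin M) (Fin M) ℂ) ((c • Y + d • Z) * U) * conj (g U) ∂(cue M) =
        c * ∫ U, fderiv ℂ f (U : Matrix (Fin M) (Fin M) ℂ) (Y * U) * conj (g U) ∂(cue M) +
        d * ∫ U, fderiv ℂ f (U : Matrix (Fin M) (Fin M) ℂ) (Z * U) * conj (g U) ∂(cue M) := by
    intro c d Y Z
    rw [← integral_const_mul, ← integral_const_mul, ← integral_add]
    · refine integral_congr_ae (Filter.Eventually.of_forall fun U => ?_)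
      simp only [add_mul, Matrix.smul_mul, map_add, map_smul, smul_eq_mul]
      ring
    · exact (int (((cont hf).2 Y).mul (Complex.continuous_conj.comp (cont hg).1))).const_mul _
    · exact (int (((cont hf).2 Z).mul (Complex.continuous_conj.comp (cont hg).1))).const_mul _
  have lin' : ∀ (c d : ℂ) (Y Z : Matrix (Fin M) (Fin M) ℂ),
      ∫ U, f (U : Matrix (Fin M) (Fin M) ℂ) * conj (fderiv ℂ g U ((c • Y + d • Z) * U)) ∂(cue M) =
        conj c * ∫ U, f (U : Matrix (Fin M) (Fin M) ℂ) * conj (fderiv ℂ g U (Y * U)) ∂(cue M) +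
        conj d *
          ∫ U, f (U : Matrix (Fin M) (Fin M) ℂ) * conj (fderiv ℂ g U (Z * U)) ∂(cue M) := by
    intro c d Y Z
    rw [← integral_const_mul, ← integral_const_mul, ← integral_add]
    · refine integral_congr_ae (Filter.Eventually.of_forall fun U => ?_)
      simp only [add_mul, Matrix.smul_mul, map_add, map_smul, smul_eq_mul, map_mul]
      ring
    · exact (int ((cont hf).1.mul (Complex.continuous_conj.comp ((cont hg).2 Y)))).const_mul _
    · exact (int ((cont hf).1.mul (Complex.continuous_conj.comp ((cont hg).2 Z)))).const_mul _
  -- `E` and `E*` are complex combinations of two skew-adjoint matrices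
  have hY : E - star E ∈ skewAdjoint (Matrix (Fin M) (Fin M) ℂ) := by
    rw [skewAdjoint.mem_iff]; simp
  have hZ : Complex.I • (E + star E) ∈ skewAdjoint (Matrix (Fin M) (Fin M) ℂ) := by
    rw [skewAdjoint.mem_iff]; simp [add_comm]
  have hE : E = (1 / 2 : ℂ) • (E - star E) + (-Complex.I / 2) • (Complex.I • (E + star E)) := by
    rw [smul_smul, show -Complex.I / 2 * Complex.I = 1 / 2 by
      rw [div_mul_eq_mul_div, neg_mul, Complex.I_mul_I, neg_neg], smul_sub, smul_add,
      sub_add_add_cancel, ← add_smul]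
    norm_num
  have hE' : star E = (-1 / 2 : ℂ) • (E - star E) +
      (-Complex.I / 2) • (Complex.I • (E + star E)) := by
    rw [smul_smul, show -Complex.I / 2 * Complex.I = 1 / 2 by
      rw [div_mul_eq_mul_div, neg_mul, Complex.I_mul_I, neg_neg], smul_sub, smul_add, neg_div,
      neg_smul, neg_smul, sub_neg_eq_add]
    rw [show ∀ a b : Matrix (Fin M) (Fin M) ℂ, -a + b + (a + b) = b + b by intro a b; abel,
      ← add_smul]
    norm_num
  have e1 := lin (1 / 2) (-Complex.I / 2) (E - star E) (Complex.I • (E + star E))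
  have e2 := lin' (-1 / 2) (-Complex.I / 2) (E - star E) (Complex.I • (E + star E))
  rw [← hE] at e1
  rw [← hE'] at e2
  rw [e1, e2]
  have k1 := key _ hY
  have k2 := key _ hZ
  simp only [map_div₀, map_neg, Complex.conj_I, map_one, map_ofNat, neg_neg]
  linear_combination (1 / 2 : ℂ) * k1 + (-Complex.I / 2) * k2

theorem fderiv_mul_apply {E : Type*} [NormedAddCommGroup E] [NormedSpace ℂ E] {f g : E → ℂ} {x : E}
    (hf : DifferentiableAt ℂ f x) (hg : DifferentiableAt ℂ g x) (v : E) :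
    fderiv ℂ (fun y => f y * g y) x v = g x * fderiv ℂ f x v + f x * fderiv ℂ g x v := by
  rw [fderiv_fun_mul hf hg]
  simp [add_comm]

theorem fderiv_mul_isBoundedLinearMap_apply {E : Type*} [NormedAddCommGroup E] [NormedSpace ℂ E]
    {f l : E → ℂ} {x : E} (hf : DifferentiableAt ℂ f x) (hl : IsBoundedLinearMap ℂ l) (v : E) :
    fderiv ℂ (fun y => f y * l y) x v = l x * fderiv ℂ f x v + f x * l v := by
  rw [fderiv_mul_apply hf hl.differentiableAt, hl.fderiv]
  rfl

theorem isBoundedLinearMap_of_isLinearMap {E F : Type*} [NormedAddCommGroup E] [NormedSpace ℂ E]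
    [FiniteDimensional ℂ E] [NormedAddCommGroup F] [NormedSpace ℂ F] {l : E → F}
    (hl : IsLinearMap ℂ l) : IsBoundedLinearMap ℂ l :=
  (LinearMap.toContinuousLinearMap hl.mk').isBoundedLinearMap

/-- The adjoint of the derivation in a constant direction `e`. On the unitary group `e = (e U*) U`,
and `conj ((e U*)_{iA}) = (U e*)_{Ai}` is holomorphic, so that `integral_fderiv_mul_conj` applies to
the functions `f(U) (U e*)_{Ai}` and the directions `E_{Ai} U`; summing over `A` and `i` gives the
trace term. -/
theorem integral_mul_conj_fderiv_const {M : ℕ} {f g : Matrix (Fin M) (Fin M) ℂ → ℂ}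
    (hf : ∀ U : Matrix.unitaryGroup (Fin M) ℂ, ContDiffAt ℂ 1 f U)
    (hg : ∀ U : Matrix.unitaryGroup (Fin M) ℂ, ContDiffAt ℂ 1 g U)
    (e : Matrix (Fin M) (Fin M) ℂ) :
    ∫ U, f (U : Matrix (Fin M) (Fin M) ℂ) * conj (fderiv ℂ g U e) ∂(cue M) =
      ∫ U, (fderiv ℂ f (U : Matrix (Fin M) (Fin M) ℂ) (U * star e * U) +
        M * (U * star e : Matrix (Fin M) (Fin M) ℂ).trace * f U) * conj (g U) ∂(cue M) := by
  have hl : ∀ A i, IsBoundedLinearMap ℂ fun X : Matrix (Fin M) (Fin M) ℂ => (X * star e) A i :=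
    fun A i => isBoundedLinearMap_of_isLinearMap ⟨fun X Y => by simp [add_mul], fun c X => by simp⟩
  have hfc : ∀ A i, ∀ U : Matrix.unitaryGroup (Fin M) ℂ,
      ContDiffAt ℂ 1 (fun X : Matrix (Fin M) (Fin M) ℂ => f X * (X * star e) A i) U :=
    fun A i U => (hf U).mul (hl A i).contDiff.contDiffAt
  have hA := fun A i => integral_fderiv_mul_conj (hfc A i) hg (Matrix.single A i 1)
  have hsum := Finset.sum_congr (rfl : (Finset.univ : Finset (Fin M × Fin M)) = _)
    (fun (p : Fin M × Fin M) _ => hA p.1 p.2)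
  rw [← integral_finsetSum, ← integral_finsetSum] at hsum
  rotate_left
  · intro p _
    exact integrable_cue_of_continuous ((continuous_unitaryGroup_of_contDiffAt (hfc _ _)).mul
      (Complex.continuous_conj.comp (continuous_unitaryGroup_fderiv hg _)))
  · intro p _
    exact integrable_cue_of_continuous ((continuous_unitaryGroup_fderiv (hfc _ _) _).mul
      (Complex.continuous_conj.comp (continuous_unitaryGroup_of_contDiffAt hg)))
  refine Eq.trans ?_ (hsum.symm.trans ?_)
  · refine integral_congr_ae (Filter.Eventually.of_forall fun U => ?_)
    beta_reduce
    have hU : star (U : Matrix (Fin M) (Fin M) ℂ) * U = 1 := Matrix.mem_unitaryGroup_iff'.1 U.2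
    have he : e = ∑ p : Fin M × Fin M, (e * star (U : Matrix (Fin M) (Fin M) ℂ)) p.2 p.1 •
        (Matrix.single p.2 p.1 1 * (U : Matrix (Fin M) (Fin M) ℂ)) := by
      conv_lhs => rw [← mul_one e, ← hU, ← mul_assoc,
        Matrix.matrix_eq_sum_single (e * star (U : Matrix (Fin M) (Fin M) ℂ))]
      rw [Finset.sum_mul, Fintype.sum_prod_type, Finset.sum_comm]
      refine Finset.sum_congr rfl fun i _ => ?_
      rw [Finset.sum_mul]
      refine Finset.sum_congr rfl fun A _ => ?_
      rw [← Matrix.smul_mul, Matrix.smul_single, smul_eq_mul, mul_one]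
    conv_lhs => rw [he]
    rw [map_sum, map_sum, Finset.mul_sum]
    refine Finset.sum_congr rfl fun p _ => ?_
    have h1 : conj ((e * star (U : Matrix (Fin M) (Fin M) ℂ)) p.2 p.1) =
        ((U : Matrix (Fin M) (Fin M) ℂ) * star e) p.1 p.2 := by
      rw [← star_star (U : Matrix (Fin M) (Fin M) ℂ), ← star_mul, star_star]
      rfl
    have h2 : star (Matrix.single p.1 p.2 (1 : ℂ)) = Matrix.single p.2 p.1 1 := by
      rw [Matrix.star_eq_conjTranspose, Matrix.conjTranspose_single, star_one]
    rw [map_smul, smul_eq_mul, map_mul, h1, h2]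
    ring
  · refine integral_congr_ae (Filter.Eventually.of_forall fun U => ?_)
    beta_reduce
    rw [← Finset.sum_mul]
    congr 1
    have h1 : ∀ p : Fin M × Fin M, fderiv ℂ
        (fun X : Matrix (Fin M) (Fin M) ℂ => f X * (X * star e) p.1 p.2) U
          (Matrix.single p.1 p.2 1 * (U : Matrix (Fin M) (Fin M) ℂ)) =
        fderiv ℂ f U (((U : Matrix (Fin M) (Fin M) ℂ) * star e) p.1 p.2 •
          (Matrix.single p.1 p.2 1 * (U : Matrix (Fin M) (Fin M) ℂ))) +
        f U * ((U : Matrix (Fin M) (Fin M) ℂ) * star e) p.2 p.2 := by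
      intro p
      have h' := fderiv_mul_isBoundedLinearMap_apply ((hf U).differentiableAt (by norm_num))
        (hl p.1 p.2) (Matrix.single p.1 p.2 1 * (U : Matrix (Fin M) (Fin M) ℂ))
      have h3 : (Matrix.single p.1 p.2 1 * (U : Matrix (Fin M) (Fin M) ℂ) * star e :
          Matrix (Fin M) (Fin M) ℂ) p.1 p.2 =
          ((U : Matrix (Fin M) (Fin M) ℂ) * star e) p.2 p.2 := by
        rw [mul_assoc, Matrix.single_mul_apply_same, one_mul]
      refine h'.trans ?_
      rw [h3, map_smul, smul_eq_mul]
      rfl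
    simp_rw [h1]
    rw [Finset.sum_add_distrib, ← map_sum]
    congr 1
    · congr 1
      conv_rhs => rw [Matrix.matrix_eq_sum_single ((U : Matrix (Fin M) (Fin M) ℂ) * star e)]
      rw [Finset.sum_mul, Fintype.sum_prod_type]
      refine Finset.sum_congr rfl fun i _ => ?_
      rw [Finset.sum_mul]
      refine Finset.sum_congr rfl fun A _ => ?_
      rw [← Matrix.smul_mul, Matrix.smul_single, smul_eq_mul, mul_one]
    · rw [Fintype.sum_prod_type]
      simp only [Finset.sum_const, Finset.card_univ, Fintype.card_fin, nsmul_eq_mul, Matrix.trace,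
        Matrix.diag_apply, ← Finset.mul_sum]
      ring

/-! ### Derivatives of products and determinants -/

theorem fderiv_finset_prod_apply {E ι : Type*} [NormedAddCommGroup E] [NormedSpace ℂ E]
    {s : Finset ι} {a : ι → E → ℂ} {x : E} (ha : ∀ l ∈ s, DifferentiableAt ℂ (a l) x)
    (h0 : ∀ l ∈ s, a l x ≠ 0) (v : E) :
    fderiv ℂ (fun y => ∏ l ∈ s, a l y) x v =
      (∏ l ∈ s, a l x) * ∑ l ∈ s, fderiv ℂ (a l) x v / a l x := by
  classical
  induction s using Finset.induction_on with
  | empty => simp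
  | insert l s hl ih =>
    have hd : DifferentiableAt ℂ (fun y => ∏ l ∈ s, a l y) x :=
      (HasFDerivAt.finsetProd fun l hl =>
        (ha l (Finset.mem_insert_of_mem hl)).hasFDerivAt).differentiableAt
    simp only [Finset.prod_insert hl, Finset.sum_insert hl]
    rw [fderiv_mul_apply (ha l (Finset.mem_insert_self _ _)) hd,
      ih (fun l hl => ha l (Finset.mem_insert_of_mem hl))
        (fun l hl => h0 l (Finset.mem_insert_of_mem hl))]
    have := h0 l (Finset.mem_insert_self _ _)
    field_simp

theorem contDiff_matrix_det {ℓ : ℕ} {r : WithTop ℕ∞} :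
    ContDiff ℂ r (Matrix.det : Matrix (Fin ℓ) (Fin ℓ) ℂ → ℂ) := by
  have : (Matrix.det : Matrix (Fin ℓ) (Fin ℓ) ℂ → ℂ) =
      fun X => ∑ σ : Equiv.Perm (Fin ℓ), ((Equiv.Perm.sign σ : ℤ) : ℂ) * ∏ i, X (σ i) i := by
    funext X
    rw [Matrix.det_apply']
  rw [this]
  refine ContDiff.sum fun σ _ => contDiff_const.mul (contDiff_prod fun i _ => ?_)
  exact (isBoundedLinearMap_of_isLinearMap ⟨fun X Y => rfl, fun c X => rfl⟩ :
    IsBoundedLinearMap ℂ fun X : Matrix (Fin ℓ) (Fin ℓ) ℂ => X (σ i) i).contDiff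

theorem fderiv_eq_of_hasDerivAt_line {E : Type*} [NormedAddCommGroup E] [NormedSpace ℂ E]
    {f : E → ℂ} {x v : E} {c : ℂ} (hf : DifferentiableAt ℂ f x)
    (h : HasDerivAt (fun s : ℂ => f (x + s • v)) c 0) : fderiv ℂ f x v = c := by
  have h1 := (hf.hasFDerivAt.hasLineDerivAt v)
  exact h1.unique h

/-- Jacobi's formula along `e * Y`; `Y` need not be invertible. -/
theorem fderiv_det_mul {ℓ : ℕ} (e Y : Matrix (Fin ℓ) (Fin ℓ) ℂ) :
    fderiv ℂ (Matrix.det : Matrix (Fin ℓ) (Fin ℓ) ℂ → ℂ) Y (e * Y) = e.trace * Y.det := by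
  refine fderiv_eq_of_hasDerivAt_line
    ((contDiff_matrix_det (r := 1)).differentiable (by norm_num) Y) ?_
  have h : (fun s : ℂ => (Y + s • (e * Y)).det) = fun s => (1 + e.trace * s +
      ((1 + (Polynomial.X : Polynomial ℂ) • e.map Polynomial.C).det.divX.divX).eval s * s ^ 2) *
        Y.det := by
    funext s
    rw [← Matrix.det_one_add_smul, ← Matrix.det_mul, add_mul, one_mul, Matrix.smul_mul]
  rw [h]
  have h1 : HasDerivAt (fun s : ℂ => e.trace * s) e.trace 0 := by
    simpa using (hasDerivAt_id (0 : ℂ)).const_mul e.trace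
  have h2 := ((Polynomial.hasDerivAt
    ((1 + (Polynomial.X : Polynomial ℂ) • e.map Polynomial.C).det.divX.divX) (0 : ℂ)).mul
      (hasDerivAt_pow 2 (0 : ℂ)))
  have h3 := (((hasDerivAt_const (0 : ℂ) (1 : ℂ)).add h1).add h2).mul_const Y.det
  refine h3.congr_deriv ?_
  simp

theorem fderiv_comp_affine_apply {E F : Type*} [NormedAddCommGroup E] [NormedSpace ℂ E]
    [NormedAddCommGroup F] [NormedSpace ℂ F] {f : F → ℂ} {l : E → F}
    (hl : IsBoundedLinearMap ℂ l) (b : F) {x : E}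
    (hf : DifferentiableAt ℂ f (l x + b)) (v : E) :
    fderiv ℂ (fun y => f (l y + b)) x v = fderiv ℂ f (l x + b) (l v) := by
  have h := (hf.hasFDerivAt.comp x (hl.hasFDerivAt.add_const b)).fderiv
  have h' : fderiv ℂ (fun y => f (l y + b)) x = _ := h
  rw [h']
  rfl

theorem fderiv_pow_apply {E : Type*} [NormedAddCommGroup E] [NormedSpace ℂ E]
    {f : E → ℂ} {x : E} (hf : DifferentiableAt ℂ f x) (k : ℕ) {v : E} {c : ℂ}
    (h : fderiv ℂ f x v = c * f x) :
    fderiv ℂ (fun y => f y ^ k) x v = k * c * f x ^ k := by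
  rw [fderiv_fun_pow k hf]
  rcases k with _ | k
  · simp
  · simp [h, pow_succ]
    ring

/-! ### Integration by parts for the truncated matrix -/

theorem isBoundedLinearMap_submatrix {ℓ M : ℕ} (c : ℂ) (r : Fin ℓ → Fin M) :
    IsBoundedLinearMap ℂ fun X : Matrix (Fin M) (Fin M) ℂ => c • X.submatrix r r :=
  isBoundedLinearMap_of_isLinearMap
    ⟨fun X Y => by rw [Matrix.submatrix_add, Pi.add_apply, Pi.add_apply, smul_add],
      fun a X => by rw [Matrix.submatrix_smul, Pi.smul_apply, Pi.smul_apply, smul_comm]⟩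

/-- The matrix of the inclusion `ℂ^ℓ → ℂ^M` as the first `ℓ` coordinates. -/
def cornerInclusion {ℓ M : ℕ} (h : ℓ ≤ M) : Matrix (Fin M) (Fin ℓ) ℂ :=
  (1 : Matrix (Fin M) (Fin M) ℂ).submatrix id (Fin.castLE h)

theorem submatrix_castLE_eq {ℓ M : ℕ} (h : ℓ ≤ M) (X : Matrix (Fin M) (Fin M) ℂ) :
    X.submatrix (Fin.castLE h) (Fin.castLE h) =
      (cornerInclusion h).transpose * X * cornerInclusion h := by
  ext i j
  simp [cornerInclusion, Matrix.mul_apply, Matrix.one_apply]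

theorem cornerInclusion_transpose_mul {ℓ M : ℕ} (h : ℓ ≤ M) :
    (cornerInclusion h).transpose * cornerInclusion h = 1 := by
  ext i j
  simp [cornerInclusion, Matrix.mul_apply, Matrix.one_apply]

theorem star_cornerInclusion_mul {ℓ M : ℕ} (h : ℓ ≤ M) (e : Matrix (Fin ℓ) (Fin ℓ) ℂ) :
    star (cornerInclusion h * e * (cornerInclusion h).transpose) =
      cornerInclusion h * star e * (cornerInclusion h).transpose := by
  have h1 : (cornerInclusion h).conjTranspose = (cornerInclusion h).transpose := by
    ext i j
    simp [cornerInclusion, Matrix.one_apply, apply_ite]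
  have h2 : (cornerInclusion h).transpose.conjTranspose = cornerInclusion h := by
    rw [← h1, Matrix.conjTranspose_conjTranspose]
  rw [Matrix.star_eq_conjTranspose, Matrix.conjTranspose_mul, Matrix.conjTranspose_mul, h1, h2,
    Matrix.star_eq_conjTranspose, Matrix.mul_assoc]

/-- Integration by parts for functions of `X = -q T`, where `T` is the truncated matrix, against the
conjugate of `det (T - q)^m`. It combines the two derivations of `integral_fderiv_mul_conj` and
`integral_mul_conj_fderiv_const` in such a way that `det (T - q)^m` is differentiated in a direction
`e* (T - q)`, hence reproduced up to the factor `m tr e*`. -/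
theorem integral_fderiv_topLeftBlock {ℓ M : ℕ} (h : ℓ ≤ M) (q : ℝ) (m : ℕ)
    {k : Matrix (Fin ℓ) (Fin ℓ) ℂ → ℂ}
    (hk : ∀ U : Matrix.unitaryGroup (Fin M) ℂ, ContDiffAt ℂ 1 k (-(q : ℂ) • topLeftBlock h U))
    (e : Matrix (Fin ℓ) (Fin ℓ) ℂ) :
    Integrable (fun U => (fderiv ℂ k (-(q : ℂ) • topLeftBlock h U)
          ((1 + (-(q : ℂ) • topLeftBlock h U)) * e * (-(q : ℂ) • topLeftBlock h U)) +
        M * ((-(q : ℂ) • topLeftBlock h U) * e).trace * k (-(q : ℂ) • topLeftBlock h U) -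
        m * e.trace * k (-(q : ℂ) • topLeftBlock h U)) *
      conj ((topLeftBlock h U - (q : ℂ) • 1).det ^ m)) (cue M) ∧
    ∫ U, (fderiv ℂ k (-(q : ℂ) • topLeftBlock h U)
          ((1 + (-(q : ℂ) • topLeftBlock h U)) * e * (-(q : ℂ) • topLeftBlock h U)) +
        M * ((-(q : ℂ) • topLeftBlock h U) * e).trace * k (-(q : ℂ) • topLeftBlock h U) -
        m * e.trace * k (-(q : ℂ) • topLeftBlock h U)) *
      conj ((topLeftBlock h U - (q : ℂ) • 1).det ^ m) ∂(cue M) = 0 := by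
  set r : Fin ℓ → Fin M := Fin.castLE h with hr
  set J := cornerInclusion h with hJ
  have hJJ : J.transpose * J = 1 := cornerInclusion_transpose_mul h
  have hl := isBoundedLinearMap_submatrix (-(q : ℂ)) r
  have hl1 := isBoundedLinearMap_submatrix 1 r
  simp only [one_smul] at hl1
  set f : Matrix (Fin M) (Fin M) ℂ → ℂ := fun X => k (-(q : ℂ) • X.submatrix r r + 0) with hf
  set g : Matrix (Fin M) (Fin M) ℂ → ℂ := fun X =>
    (X.submatrix r r + -((q : ℂ) • 1 : Matrix (Fin ℓ) (Fin ℓ) ℂ)).det ^ m with hg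
  have hk0 : ∀ U : Matrix.unitaryGroup (Fin M) ℂ, ContDiffAt ℂ 1 k
      (-(q : ℂ) • (U : Matrix (Fin M) (Fin M) ℂ).submatrix r r + 0) := by
    intro U
    rw [add_zero]
    exact hk U
  have hfc : ∀ U : Matrix.unitaryGroup (Fin M) ℂ, ContDiffAt ℂ 1 f U := fun U =>
    ContDiffAt.comp (U : Matrix (Fin M) (Fin M) ℂ) (g := k)
      (f := fun X => -(q : ℂ) • X.submatrix r r + 0) (hk0 U)
      (hl.contDiff.add contDiff_const).contDiffAt
  have hgc : ∀ U : Matrix.unitaryGroup (Fin M) ℂ, ContDiffAt ℂ 1 g U := fun U =>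
    ((contDiff_matrix_det.comp (hl1.contDiff.add contDiff_const)).pow m).contDiffAt
  have hfd : ∀ (U : Matrix.unitaryGroup (Fin M) ℂ) (H : Matrix (Fin M) (Fin M) ℂ),
      fderiv ℂ f U H = fderiv ℂ k (-(q : ℂ) • topLeftBlock h U) (-(q : ℂ) • H.submatrix r r) := by
    intro U H
    have h1 := fderiv_comp_affine_apply hl 0 ((hk0 U).differentiableAt (by norm_num)) H
    rw [add_zero] at h1
    exact h1
  have hgd : ∀ (U : Matrix.unitaryGroup (Fin M) ℂ) (H : Matrix (Fin M) (Fin M) ℂ)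
      (a : Matrix (Fin ℓ) (Fin ℓ) ℂ),
      H.submatrix r r = a * (topLeftBlock h U - (q : ℂ) • 1) →
      fderiv ℂ g U H = m * a.trace * (topLeftBlock h U - (q : ℂ) • 1).det ^ m := by
    intro U H a ha
    refine (fderiv_pow_apply (f := fun X : Matrix (Fin M) (Fin M) ℂ =>
      (X.submatrix r r + -((q : ℂ) • 1 : Matrix (Fin ℓ) (Fin ℓ) ℂ)).det) (c := a.trace)
      ((contDiff_matrix_det (r := 1).comp (hl1.contDiff.add contDiff_const)).differentiable
        (by norm_num) _) m ?_).trans ?_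
    · refine (fderiv_comp_affine_apply hl1 _
        ((contDiff_matrix_det (r := 1)).differentiable (by norm_num) _) H).trans ?_
      rw [ha, sub_eq_add_neg]
      exact fderiv_det_mul a _
    · rw [← sub_eq_add_neg]
      rfl
  have hT : ∀ U : Matrix.unitaryGroup (Fin M) ℂ, topLeftBlock h U =
      J.transpose * (U : Matrix (Fin M) (Fin M) ℂ) * J :=
    fun U => submatrix_castLE_eq h _
  have hsub : ∀ X : Matrix (Fin M) (Fin M) ℂ, X.submatrix r r = J.transpose * X * J :=
    fun X => submatrix_castLE_eq h X
  have hA := integral_fderiv_mul_conj hfc hgc (J * e * J.transpose)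
  have hB := integral_mul_conj_fderiv_const hfc hgc (-(q : ℂ) • star (J * e * J.transpose))
  have hint : ∀ {φ : Matrix.unitaryGroup (Fin M) ℂ → ℂ}, Continuous φ → Integrable φ (cue M) :=
    fun h => integrable_cue_of_continuous h
  have hgU : ∀ U : Matrix.unitaryGroup (Fin M) ℂ,
      g U = (topLeftBlock h U - (q : ℂ) • 1).det ^ m := fun U => by
    rw [sub_eq_add_neg]; rfl
  have hfU : ∀ U : Matrix.unitaryGroup (Fin M) ℂ, f U = k (-(q : ℂ) • topLeftBlock h U) :=
    fun U => by simp only [hf, add_zero]; rfl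
  have hstar : star (J * e * J.transpose) = J * star e * J.transpose :=
    star_cornerInclusion_mul h e
  have hcf := continuous_unitaryGroup_of_contDiffAt hfc
  have hcg := continuous_unitaryGroup_of_contDiffAt hgc
  have hconj : Continuous fun U : Matrix.unitaryGroup (Fin M) ℂ => conj (g U) :=
    Complex.continuous_conj.comp hcg
  have hval : Continuous fun U : Matrix.unitaryGroup (Fin M) ℂ =>
      (U : Matrix (Fin M) (Fin M) ℂ) := continuous_subtype_val
  have hcfd : ∀ {H : Matrix.unitaryGroup (Fin M) ℂ → Matrix (Fin M) (Fin M) ℂ}, Continuous H →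
      Continuous fun U : Matrix.unitaryGroup (Fin M) ℂ => fderiv ℂ f U (H U) := by
    intro H hH
    have := continuous_iff_continuousAt.2 fun U : Matrix.unitaryGroup (Fin M) ℂ =>
      (((hfc U).fderiv_right (m := 0) (by norm_num)).continuousAt).comp
        hval.continuousAt
    exact this.clm_apply hH
  have hcgd : ∀ {H : Matrix.unitaryGroup (Fin M) ℂ → Matrix (Fin M) (Fin M) ℂ}, Continuous H →
      Continuous fun U : Matrix.unitaryGroup (Fin M) ℂ => fderiv ℂ g U (H U) := by
    intro H hH
    have := continuous_iff_continuousAt.2 fun U : Matrix.unitaryGroup (Fin M) ℂ =>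
      (((hgc U).fderiv_right (m := 0) (by norm_num)).continuousAt).comp
        hval.continuousAt
    exact this.clm_apply hH
  -- the two directions add up to `e* (T - q)`, in which the derivative of `det` is a trace
  have hsum : ∫ U, f (U : Matrix (Fin M) (Fin M) ℂ) *
        conj (fderiv ℂ g U (star (J * e * J.transpose) * U)) ∂(cue M) +
      ∫ U, f (U : Matrix (Fin M) (Fin M) ℂ) *
        conj (fderiv ℂ g U (-(q : ℂ) • star (J * e * J.transpose))) ∂(cue M) =
      ∫ U, m * e.trace * f U * conj (g U) ∂(cue M) := by
    rw [← integral_add]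
    · refine integral_congr_ae (Filter.Eventually.of_forall fun U => ?_)
      beta_reduce
      rw [← mul_add, ← map_add, ← map_add, hgd U _ (star e), hgU]
      · rw [map_mul, map_mul, Matrix.star_eq_conjTranspose, Matrix.trace_conjTranspose]
        simp
        ring
      · rw [hsub, hT, hstar]
        have hJJ' : ∀ Y : Matrix (Fin ℓ) (Fin ℓ) ℂ, J.transpose * (J * Y) = Y := fun Y => by
          rw [← Matrix.mul_assoc, hJJ, Matrix.one_mul]
        simp only [Matrix.mul_add, Matrix.add_mul, Matrix.mul_smul, Matrix.smul_mul, mul_one,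
          Matrix.mul_assoc, hJJ, neg_smul, hJJ', Matrix.mul_neg, Matrix.neg_mul, sub_eq_add_neg]
    · exact hint (hcf.mul (Complex.continuous_conj.comp (hcgd (continuous_const.mul hval))))
    · exact hint (hcf.mul (Complex.continuous_conj.comp (hcgd continuous_const)))
  have hI1 : Integrable (fun U : Matrix.unitaryGroup (Fin M) ℂ =>
      fderiv ℂ f U (J * e * J.transpose * (U : Matrix (Fin M) (Fin M) ℂ)) * conj (g U)) (cue M) :=
    hint ((hcfd (continuous_const.mul hval) :
    Continuous fun U : Matrix.unitaryGroup (Fin M) ℂ =>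
      fderiv ℂ f U (J * e * J.transpose * (U : Matrix (Fin M) (Fin M) ℂ))).mul hconj)
  have hI2 : Integrable (fun U : Matrix.unitaryGroup (Fin M) ℂ =>
      (fderiv ℂ f U ((U : Matrix (Fin M) (Fin M) ℂ) *
          star (-(q : ℂ) • star (J * e * J.transpose)) * (U : Matrix (Fin M) (Fin M) ℂ)) +
        M * ((U : Matrix (Fin M) (Fin M) ℂ) *
          star (-(q : ℂ) • star (J * e * J.transpose))).trace * f U) * conj (g U)) (cue M) :=
    hint (((hcfd ((hval.mul continuous_const).mul hval) :
    Continuous fun U : Matrix.unitaryGroup (Fin M) ℂ =>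
      fderiv ℂ f U ((U : Matrix (Fin M) (Fin M) ℂ) * star (-(q : ℂ) • star (J * e * J.transpose)) *
        (U : Matrix (Fin M) (Fin M) ℂ))).add ((((hval.mul (continuous_const (y := star
          (-(q : ℂ) • star (J * e * J.transpose))))).matrix_trace).const_mul (M : ℂ)).mul
            hcf)).mul hconj)
  have hI3 : Integrable (fun U : Matrix.unitaryGroup (Fin M) ℂ =>
      m * e.trace * f U * conj (g U)) (cue M) :=
    hint ((hcf.const_mul (m * e.trace)).mul hconj)
  rw [← hA, hB, ← integral_add hI1 hI2] at hsum
  have key : ∀ U : Matrix.unitaryGroup (Fin M) ℂ, (fderiv ℂ k (-(q : ℂ) • topLeftBlock h U)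
            ((1 + (-(q : ℂ) • topLeftBlock h U)) * e * (-(q : ℂ) • topLeftBlock h U)) +
          M * ((-(q : ℂ) • topLeftBlock h U) * e).trace * k (-(q : ℂ) • topLeftBlock h U) -
          m * e.trace * k (-(q : ℂ) • topLeftBlock h U)) *
        conj ((topLeftBlock h U - (q : ℂ) • 1).det ^ m) =
      fderiv ℂ f U (J * e * J.transpose * (U : Matrix (Fin M) (Fin M) ℂ)) * conj (g U) +
      (fderiv ℂ f U ((U : Matrix (Fin M) (Fin M) ℂ) *
          star (-(q : ℂ) • star (J * e * J.transpose)) * (U : Matrix (Fin M) (Fin M) ℂ)) +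
        M * ((U : Matrix (Fin M) (Fin M) ℂ) *
          star (-(q : ℂ) • star (J * e * J.transpose))).trace * f U) * conj (g U) -
      m * e.trace * f U * conj (g U) := by
    intro U
    have e1 : star (-(q : ℂ) • star (J * e * J.transpose)) = -(q : ℂ) • (J * e * J.transpose) := by
      rw [star_smul, star_star]; simp
    have e2 : ((1 + (-(q : ℂ) • topLeftBlock h U)) * e * (-(q : ℂ) • topLeftBlock h U)) =
        -(q : ℂ) • (J * e * J.transpose * (U : Matrix (Fin M) (Fin M) ℂ)).submatrix r r +
        -(q : ℂ) • ((U : Matrix (Fin M) (Fin M) ℂ) * (-(q : ℂ) • (J * e * J.transpose)) *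
          (U : Matrix (Fin M) (Fin M) ℂ)).submatrix r r := by
      rw [hsub, hsub, hT]
      simp only [add_mul, Matrix.mul_smul, Matrix.smul_mul, one_mul, Matrix.mul_assoc]
      rw [← Matrix.mul_assoc J.transpose J, hJJ, Matrix.one_mul]
    have e3 : ((-(q : ℂ) • topLeftBlock h U) * e).trace =
        ((U : Matrix (Fin M) (Fin M) ℂ) * (-(q : ℂ) • (J * e * J.transpose))).trace := by
      rw [hT, Matrix.smul_mul, Matrix.mul_smul, Matrix.trace_smul, Matrix.trace_smul,
        Matrix.mul_assoc, Matrix.mul_assoc, Matrix.trace_mul_comm, Matrix.mul_assoc,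
        Matrix.mul_assoc]
    rw [e1, hfd, hfd, hfU, hgU, e2, map_add, e3]
    ring
  simp only [key]
  exact ⟨(hI1.add hI2).sub hI3, (integral_sub (hI1.add hI2) hI3).trans (sub_eq_zero.2 hsum)⟩

/-! ### Resolvents and the loop equation -/

section resolvent

variable {ℓ : ℕ} {X : Matrix (Fin ℓ) (Fin ℓ) ℂ} {x : ℂ}

theorem isBoundedLinearMap_smul_matrix (x : ℂ) :
    IsBoundedLinearMap ℂ fun X : Matrix (Fin ℓ) (Fin ℓ) ℂ => x • X :=
  isBoundedLinearMap_of_isLinearMap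
    ⟨fun X Y => by rw [smul_add], fun a X => by rw [smul_comm]⟩

theorem contDiff_det_one_add_smul (x : ℂ) :
    ContDiff ℂ 1 fun X : Matrix (Fin ℓ) (Fin ℓ) ℂ => (1 + x • X).det :=
  contDiff_matrix_det.comp (contDiff_const.add (isBoundedLinearMap_smul_matrix x).contDiff)

theorem resolvent_eq_one_sub (hX : (1 + x • X).det ≠ 0) :
    (1 + x • X)⁻¹ = 1 - x • (X * (1 + x • X)⁻¹) := by
  have h := Matrix.mul_nonsing_inv _ (isUnit_iff_ne_zero.2 hX)
  rw [add_mul, one_mul, Matrix.smul_mul] at h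
  exact eq_sub_of_add_eq h

theorem resolvent_mul_comm (hX : (1 + x • X).det ≠ 0) :
    (1 + x • X)⁻¹ * X = X * (1 + x • X)⁻¹ := by
  have h1 := Matrix.mul_nonsing_inv _ (isUnit_iff_ne_zero.2 hX)
  have h2 := Matrix.nonsing_inv_mul _ (isUnit_iff_ne_zero.2 hX)
  have h3 : X * (1 + x • X) = (1 + x • X) * X := by
    simp [mul_add, add_mul]
  calc (1 + x • X)⁻¹ * X = (1 + x • X)⁻¹ * (X * (1 + x • X)) * (1 + x • X)⁻¹ := by
        rw [mul_assoc, mul_assoc, h1, mul_one]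
    _ = X * (1 + x • X)⁻¹ := by rw [h3, ← mul_assoc, h2, one_mul]

theorem fderiv_det_one_add_smul (hX : (1 + x • X).det ≠ 0) (H : Matrix (Fin ℓ) (Fin ℓ) ℂ) :
    fderiv ℂ (fun X : Matrix (Fin ℓ) (Fin ℓ) ℂ => (1 + x • X).det) X H =
      x * ((1 + x • X)⁻¹ * H).trace * (1 + x • X).det := by
  have h := fderiv_comp_affine_apply (isBoundedLinearMap_smul_matrix (ℓ := ℓ) x) 1 (x := X)
    (f := Matrix.det) ((contDiff_matrix_det (r := 1)).differentiable (by norm_num) _) H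
  simp only [add_comm _ (1 : Matrix (Fin ℓ) (Fin ℓ) ℂ)] at h
  have hH : x • H = (x • (H * (1 + x • X)⁻¹)) * (1 + x • X) := by
    rw [Matrix.smul_mul, mul_assoc, Matrix.nonsing_inv_mul _ (isUnit_iff_ne_zero.2 hX), mul_one]
  rw [hH] at h
  refine h.trans ((fderiv_det_mul _ _).trans ?_)
  rw [Matrix.trace_smul, Matrix.trace_mul_comm, smul_eq_mul]

theorem contDiffAt_resolvent_apply (hX : (1 + x • X).det ≠ 0) (i j : Fin ℓ) :
    ContDiffAt ℂ 1 (fun X : Matrix (Fin ℓ) (Fin ℓ) ℂ => (1 + x • X)⁻¹ i j) X := by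
  have hu : IsUnit (1 + x • X) := (Matrix.isUnit_iff_isUnit_det _).2 (isUnit_iff_ne_zero.2 hX)
  have h1 := (contDiffAt_ringInverse ℂ (n := 1) hu.unit).comp X
    (contDiff_const.add (isBoundedLinearMap_smul_matrix (ℓ := ℓ) x).contDiff).contDiffAt
  have h2 := (isBoundedLinearMap_of_isLinearMap ⟨fun X Y => rfl, fun c X => rfl⟩ :
    IsBoundedLinearMap ℂ fun X : Matrix (Fin ℓ) (Fin ℓ) ℂ => X i j).contDiff (n := 1)
  have h3 := h2.contDiffAt.comp X h1
  simp only [Matrix.nonsing_inv_eq_ringInverse]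
  exact h3

theorem fderiv_ringInverse_comp_apply {A : Type*} [NormedRing A] [HasSummableGeomSeries A]
    [NormedAlgebra ℂ A] {l : A → ℂ} (hl : IsBoundedLinearMap ℂ l) {s : A → A}
    (hs : IsBoundedLinearMap ℂ s) {a : A} (ha : IsUnit (1 + s a)) (v : A) :
    fderiv ℂ (fun y => l (Ring.inverse (1 + s y))) a v =
      -l (Ring.inverse (1 + s a) * s v * Ring.inverse (1 + s a)) := by
  obtain ⟨u, hu⟩ := ha
  obtain ⟨L, rfl⟩ : ∃ L : A →L[ℂ] ℂ, L = l := ⟨IsBoundedLinearMap.toContinuousLinearMap l hl, rfl⟩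
  obtain ⟨S, rfl⟩ : ∃ S : A →L[ℂ] A, S = s := ⟨IsBoundedLinearMap.toContinuousLinearMap s hs, rfl⟩
  have h0 : HasFDerivAt Ring.inverse _ (1 + S a) := hu ▸ hasFDerivAt_ringInverse (𝕜 := ℂ) u
  have h2 := (L.hasFDerivAt.comp a (h0.comp a (S.hasFDerivAt.const_add (1 : A)))).fderiv
  have h3 : fderiv ℂ (fun y => L (Ring.inverse (1 + S y))) a = _ := h2
  rw [h3, ← hu, Ring.inverse_unit]
  simp

theorem fderiv_resolvent_apply (hX : (1 + x • X).det ≠ 0) (i j : Fin ℓ)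
    (H : Matrix (Fin ℓ) (Fin ℓ) ℂ) :
    fderiv ℂ (fun X : Matrix (Fin ℓ) (Fin ℓ) ℂ => (1 + x • X)⁻¹ i j) X H =
      -(x * ((1 + x • X)⁻¹ * H * (1 + x • X)⁻¹) i j) := by
  have hu : IsUnit (1 + x • X) := (Matrix.isUnit_iff_isUnit_det _).2 (isUnit_iff_ne_zero.2 hX)
  have h2 := (isBoundedLinearMap_of_isLinearMap ⟨fun X Y => rfl, fun c X => rfl⟩ :
    IsBoundedLinearMap ℂ fun X : Matrix (Fin ℓ) (Fin ℓ) ℂ => X i j)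
  have h := fderiv_ringInverse_comp_apply h2 (isBoundedLinearMap_smul_matrix x) hu H
  simp only [← Matrix.nonsing_inv_eq_ringInverse] at h
  refine h.trans ?_
  rw [Matrix.mul_smul, Matrix.smul_mul]
  rfl

end resolvent

/-- `X (1 + x X)⁻¹`, whose trace is the logarithmic derivative of `det (1 + x X)` in `x`; it is junk
where `1 + x X` is singular. -/
noncomputable def detResolvent {ℓ : ℕ} (X : Matrix (Fin ℓ) (Fin ℓ) ℂ) (x : ℂ) :
    Matrix (Fin ℓ) (Fin ℓ) ℂ :=
  X * (1 + x • X)⁻¹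

theorem Matrix.sum_single_mul_apply {ℓ : ℕ} (A B : Matrix (Fin ℓ) (Fin ℓ) ℂ) :
    ∑ i, ∑ j, (A * Matrix.single i j 1 * B : Matrix (Fin ℓ) (Fin ℓ) ℂ) i j =
      A.trace * B.trace := by
  simp only [Matrix.trace, Matrix.diag_apply, Finset.sum_mul_sum]
  refine Finset.sum_congr rfl fun i _ => Finset.sum_congr rfl fun j _ => ?_
  rw [Matrix.mul_apply, Finset.sum_eq_single j]
  · simp
  · intro b _ hb
    rw [Matrix.mul_single_apply_of_ne _ _ _ _ _ hb, zero_mul]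
  · simp

theorem Matrix.sum_mul_trace_single {ℓ : ℕ} (A B : Matrix (Fin ℓ) (Fin ℓ) ℂ) :
    ∑ i, ∑ j, A i j * (B * Matrix.single i j 1).trace = (A * B).trace := by
  have h : ∀ i j, (B * Matrix.single i j 1).trace = B j i := fun i j => by
    rw [Matrix.trace_mul_single, MulOpposite.op_one]
    exact one_smul _ _
  simp only [h]
  rfl

/-- The derivative of `∏_l det (1 + x_l X)` times an entry of the resolvent of `X`, in the direction
`(1 + X) s X` that occurs in `integral_fderiv_topLeftBlock`. -/
theorem fderiv_prod_det_mul_resolvent {ℓ m : ℕ} (x : Fin m → ℂ) (k : Fin m)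
    {X : Matrix (Fin ℓ) (Fin ℓ) ℂ} (hX : ∀ l, (1 + x l • X).det ≠ 0)
    (s : Matrix (Fin ℓ) (Fin ℓ) ℂ) (i j : Fin ℓ) :
    fderiv ℂ (fun X : Matrix (Fin ℓ) (Fin ℓ) ℂ =>
        (∏ l, (1 + x l • X).det) * (1 + x k • X)⁻¹ i j) X ((1 + X) * s * X) =
      (∏ l, (1 + x l • X).det) *
        (∑ l, x l * ((1 + x k • X)⁻¹ i j * ((detResolvent X (x l) * (1 + X)) * s).trace) -
        x k * (((1 + x k • X)⁻¹ * (1 + X)) * s * (X * (1 + x k • X)⁻¹) :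
          Matrix (Fin ℓ) (Fin ℓ) ℂ) i j) := by
  have hd : DifferentiableAt ℂ (fun X : Matrix (Fin ℓ) (Fin ℓ) ℂ => ∏ l, (1 + x l • X).det) X :=
    (contDiff_prod fun l _ => contDiff_det_one_add_smul (x l)).differentiable (by norm_num) X
  have h1 := fderiv_finset_prod_apply (s := Finset.univ)
    (a := fun (l : Fin m) (X : Matrix (Fin ℓ) (Fin ℓ) ℂ) => (1 + x l • X).det) (x := X)
    (fun l _ => (contDiff_det_one_add_smul (x l)).differentiable (by norm_num) X)
    (fun l _ => hX l) ((1 + X) * s * X)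
  have h2 : ∀ l, fderiv ℂ (fun X : Matrix (Fin ℓ) (Fin ℓ) ℂ => (1 + x l • X).det) X
      ((1 + X) * s * X) / (1 + x l • X).det =
        x l * ((detResolvent X (x l) * (1 + X)) * s).trace := by
    intro l
    rw [fderiv_det_one_add_smul (hX l), mul_div_cancel_right₀ _ (hX l), ← mul_assoc,
      Matrix.trace_mul_comm, detResolvent]
    rw [mul_assoc, mul_assoc]
  replace h1 := h1.trans (congrArg ((∏ l, (1 + x l • X).det) * ·)
    (Finset.sum_congr rfl fun l _ => h2 l))
  have h3 : (1 + x k • X)⁻¹ * ((1 + X) * s * X) * (1 + x k • X)⁻¹ =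
      ((1 + x k • X)⁻¹ * (1 + X)) * s * (X * (1 + x k • X)⁻¹) := by
    simp only [mul_assoc]
  have h4 := fderiv_resolvent_apply (hX k) i j ((1 + X) * s * X)
  rw [h3] at h4
  refine (fderiv_mul_apply hd
    ((contDiffAt_resolvent_apply (hX k) i j).differentiableAt (by norm_num)) _).trans ?_
  have key : ∀ (r f c : ℂ) (a b : Fin m → ℂ),
      r * (f * ∑ l, a l * b l) + f * -c = f * (∑ l, a l * (r * b l) - c) := by
    intro r f c a b
    simp only [mul_left_comm _ r, ← Finset.mul_sum]
    ring
  exact (congrArg₂ (fun a b => (1 + x k • X)⁻¹ i j * a + (∏ l, (1 + x l • X).det) * b) h1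
    h4).trans (key _ _ _ _ _)

theorem trace_resolvent_identities {ℓ : ℕ} {X : Matrix (Fin ℓ) (Fin ℓ) ℂ} {x y : ℂ}
    (hx : (1 + x • X).det ≠ 0) :
    ((1 + x • X)⁻¹ * (detResolvent X y * (1 + X))).trace =
        (detResolvent X y).trace + (1 - x) * (detResolvent X y * detResolvent X x).trace ∧
      ((1 + x • X)⁻¹ * (1 + X)).trace = ℓ + (1 - x) * (detResolvent X x).trace ∧
      ((1 + x • X)⁻¹).trace = ℓ - x * (detResolvent X x).trace ∧
      ((1 + x • X)⁻¹ * X).trace = (detResolvent X x).trace := by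
  have hRX : (1 + x • X)⁻¹ * X = detResolvent X x := resolvent_mul_comm hx
  have hR1 : (1 + x • X)⁻¹ = 1 - x • detResolvent X x := resolvent_eq_one_sub hx
  have h1XR : (1 + X) * (1 + x • X)⁻¹ = 1 + (1 - x) • detResolvent X x := by
    rw [add_mul, one_mul, sub_smul, one_smul]
    change _ + detResolvent X x = _
    rw [hR1]
    abel
  refine ⟨?_, ?_, ?_, ?_⟩
  · rw [Matrix.trace_mul_comm, mul_assoc, h1XR, mul_add, mul_one, Matrix.mul_smul,
      Matrix.trace_add, Matrix.trace_smul, smul_eq_mul]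
  · rw [Matrix.trace_mul_comm, h1XR, Matrix.trace_add, Matrix.trace_one, Matrix.trace_smul,
      smul_eq_mul, Fintype.card_fin]
  · rw [hR1, Matrix.trace_sub, Matrix.trace_one, Matrix.trace_smul, smul_eq_mul, Fintype.card_fin]
  · rw [hRX]

/-- The integrand of `integral_fderiv_topLeftBlock` for the `(i, j)` entry of the resolvent and the
direction `e = E_{ij}`, summed over `i` and `j`: only traces of the matrices `X (1 + x X)⁻¹` are
left. -/
theorem sum_fderiv_prod_det_mul_resolvent {ℓ m : ℕ} (x : Fin m → ℂ) (k : Fin m) (M : ℂ)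
    {X : Matrix (Fin ℓ) (Fin ℓ) ℂ} (hX : ∀ l, (1 + x l • X).det ≠ 0) :
    ∑ i, ∑ j, (fderiv ℂ (fun X : Matrix (Fin ℓ) (Fin ℓ) ℂ =>
          (∏ l, (1 + x l • X).det) * (1 + x k • X)⁻¹ i j) X
            ((1 + X) * Matrix.single i j 1 * X) +
        M * (X * Matrix.single i j 1).trace *
          ((∏ l, (1 + x l • X).det) * (1 + x k • X)⁻¹ i j) -
        m * (Matrix.single i j (1 : ℂ)).trace *
          ((∏ l, (1 + x l • X).det) * (1 + x k • X)⁻¹ i j)) =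
      (∏ l, (1 + x l • X).det) *
        (-(x k * (detResolvent X (x k)).trace * (ℓ + (1 - x k) * (detResolvent X (x k)).trace)) +
          ∑ l, x l * ((detResolvent X (x l)).trace +
            (1 - x k) * (detResolvent X (x l) * detResolvent X (x k)).trace) +
          M * (detResolvent X (x k)).trace - m * ℓ + m * x k * (detResolvent X (x k)).trace) := by
  have hder := fun i j => fderiv_prod_det_mul_resolvent x k hX (Matrix.single i j 1) i j
  have s1 := fun l => Matrix.sum_mul_trace_single (1 + x k • X)⁻¹ (detResolvent X (x l) * (1 + X))
  have s2 := Matrix.sum_single_mul_apply ((1 + x k • X)⁻¹ * (1 + X)) (X * (1 + x k • X)⁻¹)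
  have s3 := Matrix.sum_mul_trace_single (1 + x k • X)⁻¹ X
  have s4 := Matrix.sum_mul_trace_single (1 + x k • X)⁻¹ 1
  obtain ⟨-, h2, h3, h4⟩ := trace_resolvent_identities (y := 0) (hX k)
  have h5 : (X * (1 + x k • X)⁻¹).trace = (detResolvent X (x k)).trace := rfl
  rw [h2, h5] at s2
  rw [h4] at s3
  rw [mul_one, h3] at s4
  simp only [one_mul] at s4
  simp only [fun l => (trace_resolvent_identities (y := x l) (hX k)).1] at s1
  have key : ∀ (f : ℂ) (d r a b : Fin ℓ → Fin ℓ → ℂ) (s : Fin m → Fin ℓ → Fin ℓ → ℂ)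
      (c : Fin ℓ → Fin ℓ → ℂ) (S : Fin m → ℂ) (A B C : ℂ),
      (∀ i j, d i j = f * (∑ l, x l * (r i j * s l i j) - x k * c i j)) →
      (∀ l, ∑ i, ∑ j, r i j * s l i j = S l) → ∑ i, ∑ j, c i j = C →
      ∑ i, ∑ j, r i j * a i j = A → ∑ i, ∑ j, r i j * b i j = B →
      ∑ i, ∑ j, (d i j + M * a i j * (f * r i j) - m * b i j * (f * r i j)) =
        f * (∑ l, x l * S l - x k * C + M * A - m * B) := by
    intro f d r a b s c S A B C hd hS hC hA hB
    have hs : ∑ l, x l * S l = ∑ i, ∑ j, ∑ l, x l * (r i j * s l i j) := by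
      simp only [← hS, Finset.mul_sum]
      exact Finset.sum_comm.trans (Finset.sum_congr rfl fun i _ => Finset.sum_comm)
    rw [hs, ← hC, ← hA, ← hB]
    simp only [Finset.mul_sum (Finset.univ : Finset (Fin ℓ)), ← Finset.sum_sub_distrib,
      ← Finset.sum_add_distrib]
    refine Finset.sum_congr rfl fun i _ => Finset.sum_congr rfl fun j _ => ?_
    rw [hd]
    ring
  refine (key _ _ _ _ _ _ _ _ _ _ _ hder s1 s2 s3 s4).trans ?_
  ring

theorem contDiffAt_prod_det_mul_resolvent {ℓ m : ℕ} (x : Fin m → ℂ) (k : Fin m)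
    {X : Matrix (Fin ℓ) (Fin ℓ) ℂ} (hX : (1 + x k • X).det ≠ 0) (i j : Fin ℓ) :
    ContDiffAt ℂ 1 (fun X : Matrix (Fin ℓ) (Fin ℓ) ℂ =>
        (∏ l, (1 + x l • X).det) * (1 + x k • X)⁻¹ i j) X :=
  (contDiff_prod fun l _ => contDiff_det_one_add_smul (x l)).contDiffAt.mul
    (contDiffAt_resolvent_apply hX i j)

/-- The loop equation of the truncated unitary ensemble. In terms of the function `F(x) = ∏_l det (1
+ x_l X)` its traces are partial derivatives: `tr (X (1 + x_k X)⁻¹) = ∂_k log F` and `tr (X (1 + x_k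
X)⁻¹)² = -∂_k² log F`. -/
theorem integral_loop_equation {ℓ M : ℕ} (h : ℓ ≤ M) (q : ℝ) {m : ℕ} (x : Fin m → ℂ)
    (hx : ∀ (U : Matrix.unitaryGroup (Fin M) ℂ) l,
      (1 + x l • (-(q : ℂ) • topLeftBlock h U)).det ≠ 0) (k : Fin m) :
    Integrable (fun U => (∏ l, (1 + x l • (-(q : ℂ) • topLeftBlock h U)).det) *
        (-(x k * (detResolvent (-(q : ℂ) • topLeftBlock h U) (x k)).trace *
              (ℓ + (1 - x k) * (detResolvent (-(q : ℂ) • topLeftBlock h U) (x k)).trace)) +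
          ∑ l, x l * ((detResolvent (-(q : ℂ) • topLeftBlock h U) (x l)).trace +
            (1 - x k) * (detResolvent (-(q : ℂ) • topLeftBlock h U) (x l) *
              detResolvent (-(q : ℂ) • topLeftBlock h U) (x k)).trace) +
          M * (detResolvent (-(q : ℂ) • topLeftBlock h U) (x k)).trace - m * ℓ +
          m * x k * (detResolvent (-(q : ℂ) • topLeftBlock h U) (x k)).trace) *
      conj ((topLeftBlock h U - (q : ℂ) • 1).det ^ m)) (cue M) ∧
    ∫ U, (∏ l, (1 + x l • (-(q : ℂ) • topLeftBlock h U)).det) *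
        (-(x k * (detResolvent (-(q : ℂ) • topLeftBlock h U) (x k)).trace *
              (ℓ + (1 - x k) * (detResolvent (-(q : ℂ) • topLeftBlock h U) (x k)).trace)) +
          ∑ l, x l * ((detResolvent (-(q : ℂ) • topLeftBlock h U) (x l)).trace +
            (1 - x k) * (detResolvent (-(q : ℂ) • topLeftBlock h U) (x l) *
              detResolvent (-(q : ℂ) • topLeftBlock h U) (x k)).trace) +
          M * (detResolvent (-(q : ℂ) • topLeftBlock h U) (x k)).trace - m * ℓ +
          m * x k * (detResolvent (-(q : ℂ) • topLeftBlock h U) (x k)).trace) *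
      conj ((topLeftBlock h U - (q : ℂ) • 1).det ^ m) ∂(cue M) = 0 := by
  have key := fun i j => integral_fderiv_topLeftBlock h q m
    (k := fun X : Matrix (Fin ℓ) (Fin ℓ) ℂ => (∏ l, (1 + x l • X).det) * (1 + x k • X)⁻¹ i j)
    (fun U => contDiffAt_prod_det_mul_resolvent x k (hx U k) i j) (Matrix.single i j 1)
  have hs := fun U => sum_fderiv_prod_det_mul_resolvent x k M (hx U)
  simp only [← hs, Finset.sum_mul]
  refine ⟨integrable_finsetSum _ fun i _ => integrable_finsetSum _ fun j _ => (key i j).1, ?_⟩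
  rw [integral_finsetSum _ fun i _ => integrable_finsetSum _ fun j _ => (key i j).1]
  refine Finset.sum_eq_zero fun i _ => ?_
  rw [integral_finsetSum _ fun j _ => (key i j).1]
  exact Finset.sum_eq_zero fun j _ => (key i j).2

end haar

/-! ### Truncated unitary matrices are contractions -/

section contraction

open scoped Matrix.Norms.L2Operator

theorem l2_opNorm_le_one_of_conjTranspose_mul_self {k l : ℕ} {A : Matrix (Fin k) (Fin l) ℂ}
    (h : A.conjTranspose * A = 1) : ‖A‖ ≤ 1 := by
  have h1 := Matrix.l2_opNorm_conjTranspose_mul_self A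
  have h2 := Matrix.l2_opNorm_conjTranspose_mul_self (1 : Matrix (Fin l) (Fin l) ℂ)
  rw [Matrix.conjTranspose_one, mul_one] at h2
  rw [h] at h1
  by_contra! h3
  have h4 : 1 < ‖(1 : Matrix (Fin l) (Fin l) ℂ)‖ := by
    rw [h1]
    exact one_lt_mul_of_lt_of_le h3 h3.le
  nlinarith

/-- A truncated unitary matrix is a contraction for the Euclidean operator norm. -/
theorem det_one_add_smul_topLeftBlock_ne_zero {ℓ M : ℕ} (h : ℓ ≤ M)
    (U : Matrix.unitaryGroup (Fin M) ℂ) {c : ℂ} (hc : ‖c‖ < 1) :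
    (1 + c • topLeftBlock h U).det ≠ 0 := by
  have hJ : (cornerInclusion h).conjTranspose = (cornerInclusion h).transpose := by
    ext i j
    simp [cornerInclusion, Matrix.one_apply, apply_ite]
  have hJ1 : ‖cornerInclusion h‖ ≤ 1 := l2_opNorm_le_one_of_conjTranspose_mul_self (by
    rw [hJ, cornerInclusion_transpose_mul])
  have hU1 : ‖(U : Matrix (Fin M) (Fin M) ℂ)‖ ≤ 1 :=
    l2_opNorm_le_one_of_conjTranspose_mul_self (Matrix.mem_unitaryGroup_iff'.1 U.2)
  have hT : ‖topLeftBlock h U‖ ≤ 1 := by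
    rw [topLeftBlock, submatrix_castLE_eq, ← hJ]
    refine (Matrix.l2_opNorm_mul _ _).trans (mul_le_one₀ ((Matrix.l2_opNorm_mul _ _).trans
      (mul_le_one₀ ?_ (norm_nonneg _) hU1)) (norm_nonneg _) hJ1)
    rwa [Matrix.l2_opNorm_conjTranspose]
  have h1 : ‖-(c • topLeftBlock h U)‖ < 1 := by
    rw [norm_neg, norm_smul]
    exact (mul_le_of_le_one_right (norm_nonneg _) hT).trans_lt hc
  have h2 := isUnit_one_sub_of_norm_lt_one h1
  rw [sub_neg_eq_add] at h2
  exact ((Matrix.isUnit_iff_isUnit_det _).1 h2).ne_zero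

end contraction

/-! ### Sums of hypergeometric operators -/

section moment

open scoped ComplexConjugate

/-- The hypergeometric differential operator `z (z - 1) ∂² + (a + b z) ∂`. -/
noncomputable def hypergeomOp (a b : ℂ) : Polynomial ℂ →ₗ[ℂ] Polynomial ℂ where
  toFun p := Polynomial.X * (Polynomial.X - 1) * Polynomial.derivative (Polynomial.derivative p) +
    (Polynomial.C a + Polynomial.C b * Polynomial.X) * Polynomial.derivative p
  map_add' p r := by simp only [map_add]; ring
  map_smul' c p := by simp

theorem hypergeomOp_apply (a b : ℂ) (p : Polynomial ℂ) : hypergeomOp a b p =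
    Polynomial.X * (Polynomial.X - 1) * Polynomial.derivative (Polynomial.derivative p) +
    (Polynomial.C a + Polynomial.C b * Polynomial.X) * Polynomial.derivative p := rfl

/-- The sum over all variables of the hypergeometric operator acting in that variable. -/
noncomputable def sumHypergeomOp (m : ℕ) (a b : ℂ) :
    MvPolynomial (Fin m) ℂ →ₗ[ℂ] MvPolynomial (Fin m) ℂ :=
  ∑ k, { toFun := fun p => MvPolynomial.X k * (MvPolynomial.X k - 1) *
            MvPolynomial.pderiv k (MvPolynomial.pderiv k p) +
          (MvPolynomial.C a + MvPolynomial.C b * MvPolynomial.X k) * MvPolynomial.pderiv k p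
         map_add' := fun p r => by simp only [map_add]; ring
         map_smul' := fun c p => by simp }

theorem sumHypergeomOp_apply {m : ℕ} (a b : ℂ) (p : MvPolynomial (Fin m) ℂ) :
    sumHypergeomOp m a b p = ∑ k, (MvPolynomial.X k * (MvPolynomial.X k - 1) *
            MvPolynomial.pderiv k (MvPolynomial.pderiv k p) +
          (MvPolynomial.C a + MvPolynomial.C b * MvPolynomial.X k) * MvPolynomial.pderiv k p) := by
  simp [sumHypergeomOp]

theorem MvPolynomial.pderiv_aeval_X {σ : Type*} [DecidableEq σ] (k l : σ) (p : Polynomial ℂ) :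
    MvPolynomial.pderiv k (Polynomial.aeval (MvPolynomial.X l : MvPolynomial σ ℂ) p) =
      if k = l then Polynomial.aeval (MvPolynomial.X l) (Polynomial.derivative p) else 0 := by
  rw [Derivation.map_aeval, MvPolynomial.pderiv_X]
  split_ifs with h
  · subst h
    simp
  · simp [Ne.symm h]

theorem MvPolynomial.pderiv_prod_aeval_X {σ : Type*} [DecidableEq σ] (s : Finset σ) (k : σ)
    (r : σ → Polynomial ℂ) (hk : k ∉ s) :
    MvPolynomial.pderiv k (∏ l ∈ s, Polynomial.aeval (MvPolynomial.X l : MvPolynomial σ ℂ) (r l)) =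
      0 := by
  induction s using Finset.induction_on with
  | empty => simp
  | insert a s ha ih =>
    rw [Finset.mem_insert, not_or] at hk
    rw [Finset.prod_insert ha, Derivation.leibniz, ih hk.2, MvPolynomial.pderiv_aeval_X,
      if_neg hk.1]
    simp

theorem sumHypergeomOp_prod_aeval {m : ℕ} (a b : ℂ) (r : Fin m → Polynomial ℂ) :
    sumHypergeomOp m a b (∏ l, Polynomial.aeval (MvPolynomial.X l) (r l)) =
      ∑ k, ∏ l, Polynomial.aeval (MvPolynomial.X l)
        (Function.update r k (hypergeomOp a b (r k)) l) := by
  rw [sumHypergeomOp_apply]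
  refine Finset.sum_congr rfl fun k _ => ?_
  have h0 := MvPolynomial.pderiv_prod_aeval_X (Finset.univ.erase k) k r (Finset.notMem_erase k _)
  have hu : ∏ l ∈ Finset.univ.erase k, Polynomial.aeval (MvPolynomial.X l : MvPolynomial _ ℂ)
      (Function.update r k (hypergeomOp a b (r k)) l) =
      ∏ l ∈ Finset.univ.erase k, Polynomial.aeval (MvPolynomial.X l) (r l) :=
    Finset.prod_congr rfl fun l hl => by rw [Function.update_of_ne (Finset.ne_of_mem_erase hl)]
  rw [← Finset.mul_prod_erase _ _ (Finset.mem_univ k),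
    ← Finset.mul_prod_erase _ (fun l => Polynomial.aeval (MvPolynomial.X l : MvPolynomial _ ℂ)
        (Function.update r k (hypergeomOp a b (r k)) l)) (Finset.mem_univ k), hu,
    Function.update_self]
  simp only [Derivation.leibniz, h0, MvPolynomial.pderiv_aeval_X, if_true, zero_add,
    smul_eq_mul, hypergeomOp_apply, map_add, map_mul, map_sub, Polynomial.aeval_X,
    Polynomial.aeval_C, map_one, mul_zero, MvPolynomial.algebraMap_eq]
  ring

/-- Applied to the determinant of `r_j(x_k)`, the operator acts on one column at a time. -/
theorem sumHypergeomOp_det {m : ℕ} (a b : ℂ) (r : Fin m → Polynomial ℂ) :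
    sumHypergeomOp m a b
        (Matrix.of fun k j : Fin m => Polynomial.aeval (MvPolynomial.X k : MvPolynomial (Fin m) ℂ)
          (r j)).det =
      ∑ j, ((Matrix.of fun k j : Fin m =>
        Polynomial.aeval (MvPolynomial.X k : MvPolynomial (Fin m) ℂ) (r j)).updateCol j
          fun k => Polynomial.aeval (MvPolynomial.X k) (hypergeomOp a b (r j))).det := by
  simp only [← Matrix.det_transpose (Matrix.of _), ← Matrix.det_transpose (Matrix.updateCol _ _ _)]
  simp only [Matrix.det_apply, map_sum]
  rw [Finset.sum_comm]
  refine Finset.sum_congr rfl fun σ _ => ?_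
  rw [Units.smul_def, map_zsmul, ← Units.smul_def, ← Finset.smul_sum]
  congr 1
  simp only [Matrix.transpose_apply, Matrix.of_apply]
  rw [sumHypergeomOp_prod_aeval a b fun l => r (σ l)]
  refine Eq.trans ?_ (Equiv.sum_comp σ _)
  refine Finset.sum_congr rfl fun k _ => Finset.prod_congr rfl fun l _ => ?_
  rw [Matrix.updateCol_apply]
  by_cases h : l = k
  · subst h
    simp
  · rw [Function.update_of_ne h, if_neg fun h' => h (σ.injective h')]
    rfl

/-- If the one-variable operator is triangular on the `r_j`, with eigenvalues `ε_j`, then the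
determinant of `r_j(x_k)` is an eigenvector: in column `j` the multiple of the preceding column
drops out. -/
theorem sumHypergeomOp_det_eq_smul {m : ℕ} (a b : ℂ) (r : ℕ → Polynomial ℂ) (ε δ : ℕ → ℂ)
    (hδ : δ 0 = 0) (hr : ∀ j, hypergeomOp a b (r j) = ε j • r j + δ j • r (j - 1)) :
    sumHypergeomOp m a b
        (Matrix.of fun k j : Fin m => Polynomial.aeval (MvPolynomial.X k : MvPolynomial (Fin m) ℂ)
          (r j)).det =
      (∑ j : Fin m, ε j) • (Matrix.of fun k j : Fin m =>
        Polynomial.aeval (MvPolynomial.X k : MvPolynomial (Fin m) ℂ) (r j)).det := by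
  rw [sumHypergeomOp_det a b fun j : Fin m => r j, Finset.sum_smul]
  refine Finset.sum_congr rfl fun j _ => ?_
  set A := (Matrix.of fun k j : Fin m =>
        Polynomial.aeval (MvPolynomial.X k : MvPolynomial (Fin m) ℂ) (r j)) with hA
  have h1 : (fun k : Fin m => Polynomial.aeval (MvPolynomial.X k : MvPolynomial (Fin m) ℂ)
      (hypergeomOp a b (r j))) =
      (MvPolynomial.C (ε j) : MvPolynomial (Fin m) ℂ) • (fun k : Fin m => A k j) +
        (MvPolynomial.C (δ j) : MvPolynomial (Fin m) ℂ) • (fun k : Fin m =>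
          Polynomial.aeval (MvPolynomial.X k : MvPolynomial (Fin m) ℂ) (r ((j : ℕ) - 1))) := by
    ext1 k
    simp [hr, hA, MvPolynomial.smul_eq_C_mul]
  rw [h1, Matrix.det_updateCol_add, Matrix.det_updateCol_smul, Matrix.det_updateCol_smul,
    Matrix.updateCol_eq_self, MvPolynomial.smul_eq_C_mul]
  rcases Nat.eq_zero_or_pos j with h0 | h0
  · rw [h0, hδ]
    simp
  · have hne : (⟨j - 1, by omega⟩ : Fin m) ≠ j := fun h => by
      have := congrArg Fin.val h
      simp at this
      omega
    have hz : (A.updateCol j fun k => Polynomial.aeval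
        (MvPolynomial.X k : MvPolynomial (Fin m) ℂ) (r ((j : ℕ) - 1))).det = 0 := by
      refine Matrix.det_zero_of_column_eq hne fun k => ?_
      rw [Matrix.updateCol_ne hne, Matrix.updateCol_self]
      rfl
    rw [hz, mul_zero, add_zero]

/-! ### Conjugation by the Vandermonde determinant -/

theorem Derivation.map_prod_of_ne_zero {R ι : Type*} [CommRing R] [Algebra ℂ R]
    (D : Derivation ℂ R R) (φ : R →+* ℂ) (s : Finset ι) (f : ι → R)
    (hf : ∀ i ∈ s, φ (f i) ≠ 0) :
    φ (D (∏ i ∈ s, f i)) = φ (∏ i ∈ s, f i) * ∑ i ∈ s, φ (D (f i)) / φ (f i) := by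
  classical
  induction s using Finset.induction_on with
  | empty => simp
  | insert a s ha ih =>
    have h1 := hf a (Finset.mem_insert_self a s)
    rw [Finset.prod_insert ha, Finset.sum_insert ha, Derivation.leibniz, map_add, smul_eq_mul,
      smul_eq_mul, map_mul, map_mul, map_mul, ih fun i hi => hf i (Finset.mem_insert_of_mem hi)]
    field_simp
    ring

theorem eval_pderiv_det_vandermonde {m : ℕ} {x : Fin m → ℂ} (hx : Function.Injective x)
    (k : Fin m) :
    MvPolynomial.eval x (MvPolynomial.pderiv k
        (Matrix.vandermonde (MvPolynomial.X : Fin m → MvPolynomial (Fin m) ℂ)).det) =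
      MvPolynomial.eval x
        (Matrix.vandermonde (MvPolynomial.X : Fin m → MvPolynomial (Fin m) ℂ)).det *
          ∑ l ∈ Finset.univ.erase k, 1 / (x k - x l) := by
  rw [Matrix.det_vandermonde, Finset.prod_sigma', Derivation.map_prod_of_ne_zero]
  · congr 1
    rw [← Finset.sum_sigma' _ _ fun i j => MvPolynomial.eval x (MvPolynomial.pderiv k
      (MvPolynomial.X j - MvPolynomial.X i)) / MvPolynomial.eval x
        (MvPolynomial.X j - MvPolynomial.X i)]
    have h1 : ∀ i j : Fin m, MvPolynomial.eval x (MvPolynomial.pderiv k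
        (MvPolynomial.X j - MvPolynomial.X i)) / MvPolynomial.eval x
          (MvPolynomial.X j - MvPolynomial.X i) =
        (if k = j then 1 / (x k - x i) else 0) + (if k = i then 1 / (x k - x j) else 0) := by
      intro i j
      simp only [map_sub, MvPolynomial.pderiv_X, MvPolynomial.eval_X, Pi.single_apply]
      rcases eq_or_ne k j with rfl | hj <;> rcases eq_or_ne k i with rfl | hi
      · simp
      · simp [hi, hi.symm]
      · rw [← neg_sub (x j) (x k)]
        simp [hj, hj.symm, neg_div, inv_neg, -neg_sub]
      · simp [hj, hj.symm, hi, hi.symm]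
    simp only [h1, Finset.sum_add_distrib]
    rw [Finset.sum_comm' (t' := Finset.univ) (s' := fun j => Finset.Iio j) (by simp)]
    simp only [Finset.sum_ite_irrel, Finset.sum_const_zero]
    rw [Finset.sum_ite_eq, Finset.sum_ite_eq, if_pos (Finset.mem_univ k),
      if_pos (Finset.mem_univ k), ← Finset.sum_union]
    · refine Finset.sum_congr ?_ fun _ _ => rfl
      ext l
      simp
    · rw [Finset.disjoint_left]
      intro l h1 h2
      exact lt_asymm (Finset.mem_Iio.1 h1) (Finset.mem_Ioi.1 h2)
  · rintro ⟨i, j⟩ hij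
    have : i < j := by simpa using hij
    simp only [map_sub, MvPolynomial.eval_X]
    exact sub_ne_zero.2 fun h => this.ne' (hx h)

theorem Finset.sum_sum_erase_eq_of_symm {ι : Type*} [Fintype ι] [DecidableEq ι] {a b : ι → ι → ℂ}
    (h : ∀ k l, k ≠ l → a k l + a l k = b k l + b l k) :
    ∑ k, ∑ l ∈ Finset.univ.erase k, a k l = ∑ k, ∑ l ∈ Finset.univ.erase k, b k l := by
  have hs : ∀ c : ι → ι → ℂ, ∑ k, ∑ l ∈ Finset.univ.erase k, c k l =
      ∑ k, ∑ l ∈ Finset.univ.erase k, c l k := fun c =>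
    Finset.sum_comm' (by simp [eq_comm])
  have h2 : ∑ k, ∑ l ∈ Finset.univ.erase k, (a k l + a l k) =
      ∑ k, ∑ l ∈ Finset.univ.erase k, (b k l + b l k) :=
    Finset.sum_congr rfl fun k _ => Finset.sum_congr rfl fun l hl =>
      h k l (Finset.ne_of_mem_erase hl).symm
  simp only [Finset.sum_add_distrib] at h2
  rw [← hs a, ← hs b] at h2
  linear_combination h2 / 2

/-- The sum of hypergeometric operators, conjugated by the Vandermonde determinant and applied to a
polynomial `F`, in terms of the logarithmic derivatives `p_k` of `F` and of the matrix `T` of their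
divided differences with the opposite sign. Up to an eigenvalue term this is `F` times the sum over
`k` of the left-hand factors in `integral_loop_equation`. -/
theorem eval_sumHypergeomOp_det_vandermonde_mul {m : ℕ} {x : Fin m → ℂ}
    (hx : Function.Injective x) (ℓ M κ : ℂ)
    (hΔ : sumHypergeomOp m (M + m - 1) (2 - ℓ)
      (Matrix.vandermonde (MvPolynomial.X : Fin m → MvPolynomial (Fin m) ℂ)).det =
      κ • (Matrix.vandermonde (MvPolynomial.X : Fin m → MvPolynomial (Fin m) ℂ)).det)
    (F : MvPolynomial (Fin m) ℂ) (p : Fin m → ℂ) (T : Fin m → Fin m → ℂ)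
    (h1 : ∀ k, MvPolynomial.eval x (MvPolynomial.pderiv k F) = MvPolynomial.eval x F * p k)
    (h2 : ∀ k, MvPolynomial.eval x (MvPolynomial.pderiv k (MvPolynomial.pderiv k F)) =
      MvPolynomial.eval x F * (p k ^ 2 - T k k))
    (hT : ∀ k l, p k - p l = (x l - x k) * T k l) :
    MvPolynomial.eval x (sumHypergeomOp m (M + m - 1) (2 - ℓ)
      ((Matrix.vandermonde (MvPolynomial.X : Fin m → MvPolynomial (Fin m) ℂ)).det * F)) =
      MvPolynomial.eval x
        (Matrix.vandermonde (MvPolynomial.X : Fin m → MvPolynomial (Fin m) ℂ)).det *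
        (MvPolynomial.eval x F * ∑ k, (-(x k * p k * (ℓ + (1 - x k) * p k)) +
          ∑ l, x l * (p l + (1 - x k) * T l k) + M * p k - m * ℓ + m * x k * p k) +
        (κ + m ^ 2 * ℓ) * MvPolynomial.eval x F) := by
  set Δ := (Matrix.vandermonde (MvPolynomial.X : Fin m → MvPolynomial (Fin m) ℂ)).det with hΔd
  have h3 : ∀ k, MvPolynomial.eval x (MvPolynomial.pderiv k Δ) =
      MvPolynomial.eval x Δ * ∑ l ∈ Finset.univ.erase k, 1 / (x k - x l) :=
    eval_pderiv_det_vandermonde hx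
  set d := MvPolynomial.eval x Δ with hd
  set f := MvPolynomial.eval x F with hf
  have e0 := congrArg (MvPolynomial.eval x) hΔ
  rw [sumHypergeomOp_apply] at e0 ⊢
  simp only [map_sum, map_add, map_mul, Derivation.leibniz, smul_eq_mul, MvPolynomial.eval_X,
    MvPolynomial.eval_C, map_sub, map_one, MvPolynomial.smul_eval, ← hd, ← hf, h1, h2, h3] at e0 ⊢
  -- the mixed terms, symmetrized over pairs of variables
  have hsym : ∑ k, ∑ l ∈ Finset.univ.erase k, 2 * (x k * (x k - 1) * p k * (1 / (x k - x l))) =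
      ∑ k, ∑ l ∈ Finset.univ.erase k, (x l * (1 - x k) * T l k + (2 * x k - 1) * p k) := by
    refine Finset.sum_sum_erase_eq_of_symm fun k l hkl => ?_
    have hne : x k - x l ≠ 0 := sub_ne_zero.2 fun h => hkl (hx h)
    have hne' : x l - x k ≠ 0 := sub_ne_zero.2 fun h => hkl (hx h).symm
    have t1 : T k l = (p k - p l) / (x l - x k) := by
      rw [hT k l]
      field_simp
    have t2 : T l k = (p k - p l) / (x l - x k) := by
      rw [← neg_sub (p l), hT l k]
      field_simp
      ring
    rw [t1, t2, ← neg_sub (x l) (x k)]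
    field_simp
    ring
  have hk : ∀ k, ∑ l, x l * (p l + (1 - x k) * T l k) =
      ∑ l, x l * p l + (x k * (1 - x k) * T k k +
        ∑ l ∈ Finset.univ.erase k, x l * (1 - x k) * T l k) := by
    intro k
    rw [Finset.add_sum_erase _ (fun l => x l * (1 - x k) * T l k) (Finset.mem_univ k),
      ← Finset.sum_add_distrib]
    exact Finset.sum_congr rfl fun l _ => by ring
  have hc : ∀ k : Fin m, (((Finset.univ.erase k).card : ℕ) : ℂ) = m - 1 := by
    intro k
    rw [Finset.card_erase_of_mem (Finset.mem_univ k), Finset.card_univ, Fintype.card_fin,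
      Nat.cast_sub (Fin.pos k), Nat.cast_one]
  simp only [Finset.sum_add_distrib, Finset.sum_const, nsmul_eq_mul, hc, ← Finset.mul_sum] at hsym
  simp only [hk]
  have hP : ∑ k : Fin m, ∑ l, x l * p l = ∑ k, m * (x k * p k) := by
    rw [Finset.sum_const, Finset.card_univ, Fintype.card_fin, nsmul_eq_mul, Finset.mul_sum]
  have hℓ : (m : ℂ) ^ 2 * ℓ = ∑ k : Fin m, m * ℓ := by
    rw [Finset.sum_const, Finset.card_univ, Fintype.card_fin, nsmul_eq_mul]
    ring
  have hr : ∑ k, (x k * (x k - 1) * (p k ^ 2 - T k k) + (M + m - 1 + (2 - ℓ) * x k) * p k) +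
      (m - 1) * ∑ k, (2 * x k - 1) * p k =
      ∑ k, (-(x k * p k * (ℓ + (1 - x k) * p k)) + x k * (1 - x k) * T k k + M * p k - m * ℓ +
        m * x k * p k) + ∑ k : Fin m, ∑ l, x l * p l + m ^ 2 * ℓ := by
    rw [hP, hℓ, Finset.mul_sum, ← Finset.sum_add_distrib, ← Finset.sum_add_distrib,
      ← Finset.sum_add_distrib]
    exact Finset.sum_congr rfl fun k _ => by ring
  have hL : ∀ S D : Fin m → ℂ,
      ∑ k, (x k * (x k - 1) * (d * (f * (p k ^ 2 - T k k)) + f * p k * (d * S k) +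
          (f * D k + d * S k * (f * p k))) +
        (M + m - 1 + (2 - ℓ) * x k) * (d * (f * p k) + f * (d * S k))) =
      f * ∑ k, (x k * (x k - 1) * D k + (M + m - 1 + (2 - ℓ) * x k) * (d * S k)) +
        d * f * (2 * ∑ k, x k * (x k - 1) * p k * S k) +
        d * f * ∑ k, (x k * (x k - 1) * (p k ^ 2 - T k k) +
          (M + m - 1 + (2 - ℓ) * x k) * p k) := by
    intro S D
    simp only [Finset.mul_sum, ← Finset.sum_add_distrib]
    exact Finset.sum_congr rfl fun k _ => by ring
  have hR : ∀ (P : ℂ) (W : Fin m → ℂ),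
      ∑ k, (-(x k * p k * (ℓ + (1 - x k) * p k)) + (P + (x k * (1 - x k) * T k k + W k)) +
        M * p k - m * ℓ + m * x k * p k) =
      ∑ k, (-(x k * p k * (ℓ + (1 - x k) * p k)) + x k * (1 - x k) * T k k + M * p k - m * ℓ +
        m * x k * p k) + ∑ k : Fin m, P + ∑ k, W k := by
    intro P W
    rw [← Finset.sum_add_distrib, ← Finset.sum_add_distrib]
    exact Finset.sum_congr rfl fun k _ => by ring
  rw [hL, e0, hsym, hR]
  linear_combination d * f * hr

/-! ### Reversed characteristic polynomials -/

/-- The reversed characteristic polynomial `det (1 + z Y)` in the variable `z`. -/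
noncomputable def detOneAddPoly {ℓ : ℕ} (Y : Matrix (Fin ℓ) (Fin ℓ) ℂ) : Polynomial ℂ :=
  (1 + (Polynomial.X : Polynomial ℂ) • Y.map Polynomial.C).det

theorem eval_detOneAddPoly {ℓ : ℕ} (Y : Matrix (Fin ℓ) (Fin ℓ) ℂ) (z : ℂ) :
    (detOneAddPoly Y).eval z = (1 + z • Y).det := by
  rw [detOneAddPoly, ← Polynomial.coe_evalRingHom, RingHom.map_det]
  congr 1
  ext i j
  simp [Matrix.one_apply, apply_ite (Polynomial.eval z), mul_comm z]

theorem natDegree_detOneAddPoly_le {ℓ : ℕ} (Y : Matrix (Fin ℓ) (Fin ℓ) ℂ) :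
    (detOneAddPoly Y).natDegree ≤ ℓ := by
  have h := Polynomial.natDegree_det_X_add_C_le Y 1
  rw [Matrix.map_one _ Polynomial.C_0 Polynomial.C_1, add_comm, Fintype.card_fin] at h
  exact h

theorem eval_zero_derivative_detOneAddPoly {ℓ : ℕ} (Y : Matrix (Fin ℓ) (Fin ℓ) ℂ) :
    (Polynomial.derivative (detOneAddPoly Y)).eval 0 = Y.trace :=
  Matrix.derivative_det_one_add_X_smul Y

/-- The second derivative at the origin, from `det (1 + z Y) det (1 - z Y) = det (1 - z² Y²)`. -/
theorem eval_zero_derivative_derivative_detOneAddPoly {ℓ : ℕ} (Y : Matrix (Fin ℓ) (Fin ℓ) ℂ) :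
    (Polynomial.derivative (Polynomial.derivative (detOneAddPoly Y))).eval 0 =
      Y.trace ^ 2 - (Y * Y).trace := by
  have h : detOneAddPoly Y * (detOneAddPoly Y).comp (-Polynomial.X) =
      (detOneAddPoly (Y * Y)).comp (-Polynomial.X ^ 2) := by
    refine Polynomial.funext fun z => ?_
    simp only [Polynomial.eval_mul, Polynomial.eval_comp, Polynomial.eval_neg, Polynomial.eval_X,
      Polynomial.eval_pow, eval_detOneAddPoly, ← Matrix.det_mul]
    congr 1
    simp only [mul_add, add_mul, one_mul, mul_one, Matrix.smul_mul, Matrix.mul_smul, smul_smul,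
      neg_smul, mul_neg, pow_two]
    abel
  have h2 := congrArg (fun p => (Polynomial.derivative (Polynomial.derivative p)).eval 0) h
  have h0 := eval_zero_derivative_detOneAddPoly Y
  have h1 := eval_zero_derivative_detOneAddPoly (Y * Y)
  have h3 : (detOneAddPoly Y).eval 0 = 1 := by simp [eval_detOneAddPoly]
  simp [Polynomial.derivative_comp, h0, h1, h3, Polynomial.eval_comp] at h2
  linear_combination h2 / 2

/-- The first two derivatives at `z`, moved to the origin by the factorization `1 + (z + w) Y = (1 +
w Y (1 + z Y)⁻¹) (1 + z Y)`. -/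
theorem eval_derivative_detOneAddPoly {ℓ : ℕ} {Y : Matrix (Fin ℓ) (Fin ℓ) ℂ} {z : ℂ}
    (hz : (1 + z • Y).det ≠ 0) :
    (Polynomial.derivative (detOneAddPoly Y)).eval z =
        (1 + z • Y).det * (detResolvent Y z).trace ∧
      (Polynomial.derivative (Polynomial.derivative (detOneAddPoly Y))).eval z =
        (1 + z • Y).det *
          ((detResolvent Y z).trace ^ 2 - (detResolvent Y z * detResolvent Y z).trace) := by
  have h : (detOneAddPoly Y).comp (Polynomial.C z + Polynomial.X) =
      Polynomial.C (1 + z • Y).det * detOneAddPoly (detResolvent Y z) := by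
    refine Polynomial.funext fun w => ?_
    simp only [Polynomial.eval_mul, Polynomial.eval_comp, Polynomial.eval_add, Polynomial.eval_C,
      Polynomial.eval_X, eval_detOneAddPoly]
    rw [mul_comm, ← Matrix.det_mul]
    congr 1
    rw [add_mul, one_mul, detResolvent, Matrix.smul_mul, Matrix.mul_assoc,
      Matrix.nonsing_inv_mul _ (isUnit_iff_ne_zero.2 hz), Matrix.mul_one, add_smul, add_assoc]
  constructor
  · have h2 := congrArg (fun p => (Polynomial.derivative p).eval 0) h
    simpa [Polynomial.derivative_comp, Polynomial.eval_comp,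
      eval_zero_derivative_detOneAddPoly] using h2
  · have h2 := congrArg (fun p => (Polynomial.derivative (Polynomial.derivative p)).eval 0) h
    simpa [Polynomial.derivative_comp, Polynomial.eval_comp,
      eval_zero_derivative_derivative_detOneAddPoly] using h2

/-- The resolvent identity, under the trace. -/
theorem trace_detResolvent_sub {ℓ : ℕ} {Y : Matrix (Fin ℓ) (Fin ℓ) ℂ} {z w : ℂ}
    (hz : (1 + z • Y).det ≠ 0) (hw : (1 + w • Y).det ≠ 0) :
    (detResolvent Y z).trace - (detResolvent Y w).trace =
      (w - z) * (detResolvent Y z * detResolvent Y w).trace := by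
  have h1 : detResolvent Y z = Y - z • (detResolvent Y z * Y) := by
    have h := resolvent_eq_one_sub hz
    have h' := resolvent_mul_comm hz
    rw [detResolvent, ← h']
    conv_lhs => rw [h, sub_mul, one_mul, Matrix.smul_mul, ← h']
  have h2 : detResolvent Y w = Y - w • (Y * detResolvent Y w) := by
    conv_lhs => rw [detResolvent, resolvent_eq_one_sub hw, mul_sub, mul_one, Matrix.mul_smul]
    rfl
  have e1 : detResolvent Y z * detResolvent Y w =
      detResolvent Y z * Y - w • (detResolvent Y z * Y * detResolvent Y w) := by
    conv_lhs => rw [h2, mul_sub, Matrix.mul_smul, ← mul_assoc]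
  have e2 : detResolvent Y z * detResolvent Y w =
      Y * detResolvent Y w - z • (detResolvent Y z * Y * detResolvent Y w) := by
    conv_lhs => rw [h1, sub_mul, Matrix.smul_mul]
  have t1 := congrArg Matrix.trace e1
  have t2 := congrArg Matrix.trace e2
  have t3 := congrArg Matrix.trace h1
  have t4 := congrArg Matrix.trace h2
  simp only [Matrix.trace_sub, Matrix.trace_smul, smul_eq_mul] at t1 t2 t3 t4
  linear_combination t3 - t4 + z * t1 - w * t2

/-! ### Coefficients and integrals of polynomials -/

theorem MvPolynomial.prod_monomial {σ ι : Type*} (t : Finset ι) (e : ι → σ →₀ ℕ) (c : ι → ℂ) :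
    ∏ i ∈ t, MvPolynomial.monomial (e i) (c i) =
      MvPolynomial.monomial (∑ i ∈ t, e i) (∏ i ∈ t, c i) := by
  classical
  induction t using Finset.induction_on with
  | empty => simp
  | insert a t ha ih =>
    rw [Finset.prod_insert ha, Finset.prod_insert ha, Finset.sum_insert ha, ih,
      MvPolynomial.monomial_mul]

theorem MvPolynomial.coeff_prod_aeval_X {m : ℕ} (r : Fin m → Polynomial ℂ) (s : Fin m →₀ ℕ) :
    MvPolynomial.coeff s (∏ k, Polynomial.aeval (MvPolynomial.X k : MvPolynomial (Fin m) ℂ) (r k)) =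
      ∏ k, (r k).coeff (s k) := by
  have h1 : ∀ k, Polynomial.aeval (MvPolynomial.X k : MvPolynomial (Fin m) ℂ) (r k) =
      ∑ i ∈ (r k).support, MvPolynomial.monomial (Finsupp.single k i) ((r k).coeff i) := by
    intro k
    rw [Polynomial.aeval_def, Polynomial.eval₂_eq_sum, Polynomial.sum_def]
    refine Finset.sum_congr rfl fun i _ => ?_
    rw [MvPolynomial.X_pow_eq_monomial, MvPolynomial.algebraMap_eq, MvPolynomial.C_mul_monomial,
      mul_one]
  have h2 : ∀ f : Fin m → ℕ, ∑ k, Finsupp.single k (f k) = s ↔ f = s := by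
    intro f
    rw [← Finsupp.equivFunOnFinite_symm_eq_sum]
    exact ⟨fun h => by rw [← h]; rfl, fun h => by ext k; simp [h]⟩
  simp only [h1, Finset.prod_univ_sum, MvPolynomial.prod_monomial, MvPolynomial.coeff_sum,
    MvPolynomial.coeff_monomial, h2]
  rw [Finset.sum_ite_eq']
  split_ifs with h
  · rfl
  · rw [Fintype.mem_piFinset, not_forall] at h
    obtain ⟨k, hk⟩ := h
    exact (Finset.prod_eq_zero (Finset.mem_univ k) (Polynomial.notMem_support_iff.1 hk)).symm

section coeffIntegral

variable {Ω σ : Type*} [MeasurableSpace Ω]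

/-- The integral of a polynomial-valued function, coefficient by coefficient. The finite set `S` has
to contain the support of all values of `F`. -/
noncomputable def coeffIntegral (μ : Measure Ω) (S : Finset (σ →₀ ℕ))
    (F : Ω → MvPolynomial σ ℂ) : MvPolynomial σ ℂ :=
  ∑ s ∈ S, MvPolynomial.monomial s (∫ ω, MvPolynomial.coeff s (F ω) ∂μ)

/-- Linear functionals commute with the integral of polynomials; only finitely many coefficients are
involved, so that integrability of each of them is enough. -/
theorem map_coeffIntegral {μ : Measure Ω} {S : Finset (σ →₀ ℕ)} {F : Ω → MvPolynomial σ ℂ}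
    (hS : ∀ ω, (F ω).support ⊆ S)
    (hF : ∀ s, Integrable (fun ω => MvPolynomial.coeff s (F ω)) μ)
    (L : MvPolynomial σ ℂ →ₗ[ℂ] ℂ) : L (coeffIntegral μ S F) = ∫ ω, L (F ω) ∂μ := by
  have h1 : ∀ (s : σ →₀ ℕ) (c : ℂ), L (MvPolynomial.monomial s c) =
      c * L (MvPolynomial.monomial s 1) := by
    intro s c
    rw [← smul_eq_mul, ← map_smul, MvPolynomial.smul_monomial, smul_eq_mul, mul_one]
  have h2 : ∀ ω, L (F ω) =
      ∑ s ∈ S, MvPolynomial.coeff s (F ω) * L (MvPolynomial.monomial s 1) := by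
    intro ω
    conv_lhs => rw [(F ω).as_sum, map_sum]
    rw [Finset.sum_subset (hS ω)]
    · exact Finset.sum_congr rfl fun s _ => h1 s _
    · intro s _ hs
      rw [MvPolynomial.notMem_support_iff.1 hs, MvPolynomial.monomial_zero, map_zero]
  simp only [h2]
  rw [integral_finsetSum _ fun s _ => (hF s).mul_const _, coeffIntegral, map_sum]
  refine Finset.sum_congr rfl fun s _ => ?_
  rw [h1, integral_mul_const]

theorem support_coeffIntegral_subset (μ : Measure Ω) (S : Finset (σ →₀ ℕ))
    (F : Ω → MvPolynomial σ ℂ) : (coeffIntegral μ S F).support ⊆ S := by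
  classical
  intro s hs
  by_contra h
  refine MvPolynomial.mem_support_iff.1 hs ?_
  rw [coeffIntegral, MvPolynomial.coeff_sum]
  refine Finset.sum_eq_zero fun t ht => ?_
  rw [MvPolynomial.coeff_monomial, if_neg]
  rintro rfl
  exact h ht

end coeffIntegral

theorem continuous_coeff_det {Ω : Type*} [TopologicalSpace Ω] {ℓ : ℕ}
    {A : Ω → Matrix (Fin ℓ) (Fin ℓ) (Polynomial ℂ)}
    (hA : ∀ i j n, Continuous fun ω => (A ω i j).coeff n) (n : ℕ) :
    Continuous fun ω => (A ω).det.coeff n := by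
  simp only [Matrix.det_apply', Polynomial.finsetSum_coeff]
  refine continuous_finsetSum _ fun σ _ => ?_
  have h : ∀ (s : Finset (Fin ℓ)) n, Continuous fun ω => (∏ i ∈ s, A ω (σ i) i).coeff n := by
    intro s
    induction s using Finset.induction_on with
    | empty => exact fun n => by simpa using continuous_const
    | insert a s ha ih =>
      intro n
      simp only [Finset.prod_insert ha, Polynomial.coeff_mul]
      exact continuous_finsetSum _ fun i _ => (hA _ _ _).mul (ih _)
  simp only [Polynomial.coeff_intCast_mul]
  exact continuous_const.mul (h _ n)

/-- The product of the reversed characteristic polynomials of `Y` in the variables `x_k`. -/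
noncomputable def detProdPoly (m : ℕ) {ℓ : ℕ} (Y : Matrix (Fin ℓ) (Fin ℓ) ℂ) :
    MvPolynomial (Fin m) ℂ :=
  ∏ k, Polynomial.aeval (MvPolynomial.X k) (detOneAddPoly Y)

theorem MvPolynomial.eval_aeval_X {σ : Type*} (x : σ → ℂ) (k : σ) (p : Polynomial ℂ) :
    MvPolynomial.eval x (Polynomial.aeval (MvPolynomial.X k : MvPolynomial σ ℂ) p) =
      p.eval (x k) := by
  rw [Polynomial.aeval_def, Polynomial.hom_eval₂, MvPolynomial.eval_X, MvPolynomial.algebraMap_eq,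
    Polynomial.eval, Polynomial.eval₂_eq_sum, Polynomial.eval₂_eq_sum]
  simp

section detProdPoly

variable {m ℓ : ℕ} (Y : Matrix (Fin ℓ) (Fin ℓ) ℂ) {x : Fin m → ℂ}

theorem eval_detProdPoly : MvPolynomial.eval x (detProdPoly m Y) = ∏ k, (1 + x k • Y).det := by
  rw [detProdPoly, map_prod]
  simp only [MvPolynomial.eval_aeval_X, eval_detOneAddPoly]

theorem eval_pderiv_detProdPoly (hx : ∀ k, (1 + x k • Y).det ≠ 0) (k : Fin m) :
    MvPolynomial.eval x (MvPolynomial.pderiv k (detProdPoly m Y)) =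
        MvPolynomial.eval x (detProdPoly m Y) * (detResolvent Y (x k)).trace ∧
      MvPolynomial.eval x (MvPolynomial.pderiv k (MvPolynomial.pderiv k (detProdPoly m Y))) =
        MvPolynomial.eval x (detProdPoly m Y) * ((detResolvent Y (x k)).trace ^ 2 -
          (detResolvent Y (x k) * detResolvent Y (x k)).trace) := by
  have h0 := MvPolynomial.pderiv_prod_aeval_X (Finset.univ.erase k) k
    (fun _ => detOneAddPoly Y) (Finset.notMem_erase k _)
  have h1 := eval_derivative_detOneAddPoly (hx k)
  rw [detProdPoly, ← Finset.mul_prod_erase _ _ (Finset.mem_univ k)]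
  simp only [Derivation.leibniz, h0, MvPolynomial.pderiv_aeval_X, if_true, zero_add,
    smul_eq_mul, mul_zero, map_mul, map_add, map_zero, MvPolynomial.eval_aeval_X, h1.1, h1.2,
    eval_detOneAddPoly]
  constructor <;> ring

theorem support_detProdPoly_subset : (detProdPoly m Y).support ⊆
    Finset.Iic (Finsupp.equivFunOnFinite.symm fun _ => ℓ) := by
  intro s hs
  rw [Finset.mem_Iic]
  intro k
  by_contra! h
  refine MvPolynomial.mem_support_iff.1 hs ?_
  rw [detProdPoly, MvPolynomial.coeff_prod_aeval_X]
  exact Finset.prod_eq_zero (Finset.mem_univ k) (Polynomial.coeff_eq_zero_of_natDegree_lt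
    ((natDegree_detOneAddPoly_le Y).trans_lt h))

theorem continuous_coeff_detProdPoly (s : Fin m →₀ ℕ) :
    Continuous fun Y : Matrix (Fin ℓ) (Fin ℓ) ℂ => MvPolynomial.coeff s (detProdPoly m Y) := by
  simp only [detProdPoly, MvPolynomial.coeff_prod_aeval_X]
  refine continuous_finsetProd _ fun k _ => continuous_coeff_det (fun i j n => ?_) _
  have h : ∀ Y : Matrix (Fin ℓ) (Fin ℓ) ℂ, ((1 + (Polynomial.X : Polynomial ℂ) •
      Y.map Polynomial.C) i j).coeff n =
      ((1 : Matrix (Fin ℓ) (Fin ℓ) (Polynomial ℂ)) i j).coeff n +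
        (Polynomial.X : Polynomial ℂ).coeff n * Y i j := fun Y => by
    rw [← Polynomial.coeff_mul_C, ← Polynomial.coeff_add]
    rfl
  simp only [h]
  fun_prop

end detProdPoly

/-! ### The differential equation of the moment polynomial -/

theorem hypergeomOp_X_pow (a b : ℂ) (j : ℕ) : hypergeomOp a b (Polynomial.X ^ j) =
    (j * (j - 1 + b) : ℂ) • Polynomial.X ^ j +
      (j * (a - (j - 1)) : ℂ) • Polynomial.X ^ (j - 1) := by
  rw [hypergeomOp_apply]
  rcases j with _ | _ | j
  · simp
  · simp [Polynomial.smul_eq_C_mul]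
    ring
  · simp only [Polynomial.derivative_X_pow, Polynomial.derivative_mul,
      Polynomial.derivative_natCast,
      Polynomial.derivative_one, Polynomial.smul_eq_C_mul, Nat.add_sub_cancel, map_mul, map_add,
      map_sub, map_natCast, map_one, Nat.cast_add, Nat.cast_one]
    ring

theorem vandermonde_X_eq (m : ℕ) :
    Matrix.vandermonde (MvPolynomial.X : Fin m → MvPolynomial (Fin m) ℂ) =
      Matrix.of fun k j : Fin m => Polynomial.aeval
        (MvPolynomial.X k : MvPolynomial (Fin m) ℂ) ((Polynomial.X : Polynomial ℂ) ^ (j : ℕ)) := by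
  ext1 k j
  simp [Matrix.vandermonde]

theorem sumHypergeomOp_det_vandermonde (m : ℕ) (a b : ℂ) :
    sumHypergeomOp m a b
        (Matrix.vandermonde (MvPolynomial.X : Fin m → MvPolynomial (Fin m) ℂ)).det =
      (∑ j : Fin m, ((j : ℕ) * ((j : ℕ) - 1 + b) : ℂ)) •
        (Matrix.vandermonde (MvPolynomial.X : Fin m → MvPolynomial (Fin m) ℂ)).det := by
  have h := sumHypergeomOp_det_eq_smul (m := m) a b (fun j => Polynomial.X ^ j)
    (fun j => j * (j - 1 + b)) (fun j => j * (a - (j - 1))) (by simp)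
    fun j => hypergeomOp_X_pow a b j
  simp only [← vandermonde_X_eq] at h
  exact h

/-- The polynomial `∫ ∏_k det (1 - q x_k T) conj (det (T - q)^m) dU` in `x_0, …, x_{m-1}`, where `T`
is the top-left `ℓ × ℓ` block of `U`. At `x_k = q⁻²` it is a multiple of `∫ |det (T - q)|^{2m}`. -/
noncomputable def cueMomentPoly {ℓ M : ℕ} (h : ℓ ≤ M) (q : ℝ) (m : ℕ) :
    MvPolynomial (Fin m) ℂ :=
  coeffIntegral (cue M) (Finset.Iic (Finsupp.equivFunOnFinite.symm fun _ => ℓ)) fun U =>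
    conj ((topLeftBlock h U - (q : ℂ) • 1).det ^ m) •
      detProdPoly m (-(q : ℂ) • topLeftBlock h U)

section

variable {ℓ M : ℕ} (h : ℓ ≤ M) (q : ℝ) (m : ℕ)

theorem continuous_topLeftBlock : Continuous (topLeftBlock h) :=
  (continuous_subtype_val (p := fun A => A ∈ Matrix.unitaryGroup (Fin M) ℂ)).matrix_submatrix _ _

theorem map_cueMomentPoly (L : MvPolynomial (Fin m) ℂ →ₗ[ℂ] ℂ) :
    L (cueMomentPoly h q m) = ∫ U, L (detProdPoly m (-(q : ℂ) • topLeftBlock h U)) *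
      conj ((topLeftBlock h U - (q : ℂ) • 1).det ^ m) ∂(cue M) := by
  refine (map_coeffIntegral (fun U => ?_) (fun s => ?_) L).trans ?_
  · exact Finset.Subset.trans MvPolynomial.support_smul (support_detProdPoly_subset _)
  · refine integrable_cue_of_continuous ?_
    simp only [MvPolynomial.coeff_smul, smul_eq_mul]
    have h1 := continuous_topLeftBlock h
    have h2 : Continuous fun U => -(q : ℂ) • topLeftBlock h U := h1.const_smul (-(q : ℂ))
    refine Continuous.mul ?_ ((continuous_coeff_detProdPoly s).comp h2)
    exact Complex.continuous_conj.comp ((h1.sub continuous_const).matrix_det.pow m)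
  · simp only [map_smul, smul_eq_mul, mul_comm]

theorem eval_cueMomentPoly (x : Fin m → ℂ) :
    MvPolynomial.eval x (cueMomentPoly h q m) =
      ∫ U, (∏ k, (1 + x k • (-(q : ℂ) • topLeftBlock h U)).det) *
        conj ((topLeftBlock h U - (q : ℂ) • 1).det ^ m) ∂(cue M) := by
  have h1 := map_cueMomentPoly h q m (MvPolynomial.aeval x).toLinearMap
  simp only [AlgHom.toLinearMap_apply, MvPolynomial.aeval_eq_eval, eval_detProdPoly] at h1
  exact h1

/-- Polynomials in `m` variables that agree on a product of infinite sets are equal. Disjointness of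
these sets keeps the coordinates distinct, as the derivative of the Vandermonde determinant needs.
-/
theorem exists_disjoint_infinite_subsets_unitDisc :
    ∃ s : Fin m → Set ℂ, (∀ k, (s k).Infinite) ∧ (∀ k, ∀ z ∈ s k, ‖z‖ ≤ 1) ∧
      ∀ k l, k ≠ l → Disjoint (s k) (s l) := by
  have hm : ∀ k : Fin m, (0 : ℝ) < m := fun k => Nat.cast_pos.2 (Fin.pos k)
  refine ⟨fun k => Complex.ofReal '' Set.Ioo ((k : ℕ) / (m : ℝ)) (((k : ℕ) + 1) / (m : ℝ)),
    fun k => ?_, fun k => ?_, fun k l hkl => ?_⟩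
  · refine Set.Infinite.image Complex.ofReal_injective.injOn (Set.Ioo_infinite ?_)
    have := hm k
    gcongr
    linarith
  · rintro _ ⟨r, ⟨h1, h2⟩, rfl⟩
    have h3 : 0 < r := lt_of_le_of_lt (by positivity) h1
    have h4 : (((k : ℕ) : ℝ) + 1) / m ≤ 1 := by
      rw [div_le_one (hm k)]
      exact_mod_cast k.2
    rw [Complex.norm_real, Real.norm_of_nonneg h3.le]
    exact (h2.trans_le h4).le
  · rw [Set.disjoint_image_iff Complex.ofReal_injective, Set.disjoint_left]
    rintro r ⟨h1, h2⟩ ⟨h3, h4⟩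
    rw [div_lt_iff₀ (hm k)] at h1 h3
    rw [lt_div_iff₀ (hm k)] at h2 h4
    have h5 : ((k : ℕ) : ℝ) < (l : ℕ) + 1 := h1.trans h4
    have h6 : ((l : ℕ) : ℝ) < (k : ℕ) + 1 := h3.trans h2
    norm_cast at h5 h6
    exact hkl (Fin.ext (by omega))

/-- The loop equations, summed over `k`: the moment polynomial times the Vandermonde determinant is
an eigenvector. The equations are used at points of the unit disc, where `1 - q x_k T` is invertible
because `T` is a contraction and `q < 1`. -/
theorem sumHypergeomOp_det_vandermonde_mul_cueMomentPoly (hq0 : 0 < q) (hq1 : q < 1) :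
    sumHypergeomOp m (M + m - 1) (2 - ℓ)
      ((Matrix.vandermonde (MvPolynomial.X : Fin m → MvPolynomial (Fin m) ℂ)).det *
        cueMomentPoly h q m) =
      ((∑ j : Fin m, ((j : ℕ) * ((j : ℕ) - 1 + (2 - ℓ)) : ℂ)) + m ^ 2 * ℓ) •
        ((Matrix.vandermonde (MvPolynomial.X : Fin m → MvPolynomial (Fin m) ℂ)).det *
          cueMomentPoly h q m) := by
  obtain ⟨s, hs, hs1, hsd⟩ := exists_disjoint_infinite_subsets_unitDisc m
  set Δ := (Matrix.vandermonde (MvPolynomial.X : Fin m → MvPolynomial (Fin m) ℂ)).det with hΔ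
  set κ := ∑ j : Fin m, ((j : ℕ) * ((j : ℕ) - 1 + (2 - ℓ)) : ℂ) with hκ
  refine MvPolynomial.funext_set s hs fun x hx => ?_
  have hxs : ∀ k, x k ∈ s k := fun k => hx k (Set.mem_univ k)
  have hinj : Function.Injective x := by
    intro k l hkl
    by_contra hne
    exact Set.disjoint_left.1 (hsd k l hne) (hxs k) (hkl ▸ hxs l)
  have hdet : ∀ (U : Matrix.unitaryGroup (Fin M) ℂ) l,
      (1 + x l • (-(q : ℂ) • topLeftBlock h U)).det ≠ 0 := by
    intro U l
    rw [smul_smul]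
    refine det_one_add_smul_topLeftBlock_ne_zero h U ?_
    rw [norm_mul, norm_neg, Complex.norm_real, Real.norm_of_nonneg hq0.le]
    nlinarith [hs1 l _ (hxs l), norm_nonneg (x l)]
  have h1 := map_cueMomentPoly h q m ((MvPolynomial.aeval x).toLinearMap ∘ₗ
    (sumHypergeomOp m (M + m - 1) (2 - ℓ) ∘ₗ LinearMap.mulLeft ℂ Δ -
      (κ + m ^ 2 * ℓ) • LinearMap.mulLeft ℂ Δ))
  have h2 := fun k => integral_loop_equation h q x hdet k
  have h3 := fun U => eval_sumHypergeomOp_det_vandermonde_mul hinj ℓ M κ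
    (sumHypergeomOp_det_vandermonde m _ _) (detProdPoly m (-(q : ℂ) • topLeftBlock h U))
    (fun k => (detResolvent (-(q : ℂ) • topLeftBlock h U) (x k)).trace)
    (fun k l => (detResolvent (-(q : ℂ) • topLeftBlock h U) (x k) *
      detResolvent (-(q : ℂ) • topLeftBlock h U) (x l)).trace)
    (fun k => (eval_pderiv_detProdPoly _ (hdet U) k).1)
    (fun k => (eval_pderiv_detProdPoly _ (hdet U) k).2)
    (fun k l => trace_detResolvent_sub (hdet U k) (hdet U l))
  simp only [LinearMap.comp_apply, AlgHom.toLinearMap_apply, MvPolynomial.aeval_eq_eval,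
    LinearMap.mulLeft_apply, LinearMap.smul_apply, LinearMap.sub_apply, map_sub,
    MvPolynomial.smul_eval, map_mul] at h1
  rw [← sub_eq_zero, MvPolynomial.smul_eval, map_mul (MvPolynomial.eval x)]
  refine h1.trans ?_
  simp only [← hΔ] at h3
  simp only [h3, eval_detProdPoly]
  calc _ = ∫ U, MvPolynomial.eval x Δ * ∑ k, _ ∂(cue M) := by
        refine integral_congr_ae (Filter.Eventually.of_forall fun U => ?_)
        beta_reduce
        rw [mul_add, ← mul_assoc (MvPolynomial.eval x Δ) (κ + m ^ 2 * ℓ),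
          mul_comm (MvPolynomial.eval x Δ) (κ + m ^ 2 * ℓ), mul_assoc (κ + m ^ 2 * ℓ),
          add_sub_cancel_right, mul_assoc, Finset.mul_sum, Finset.sum_mul]
    _ = 0 := by
        rw [integral_const_mul, integral_finsetSum _ fun k _ => (h2 k).1,
          Finset.sum_eq_zero fun k _ => (h2 k).2, mul_zero]

end

/-! ### Uniqueness of the antisymmetric eigenpolynomial -/

theorem coeff_hypergeomOp (a b : ℂ) (p : Polynomial ℂ) (h : ℕ) :
    (hypergeomOp a b p).coeff h =
      h * (h - 1 + b) * p.coeff h + (h + 1) * (a - h) * p.coeff (h + 1) := by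
  induction p using Polynomial.induction_on' with
  | add p r hp hr =>
    simp only [map_add, Polynomial.coeff_add, hp, hr]
    ring
  | monomial j c =>
    rw [← mul_one c, ← smul_eq_mul, ← Polynomial.smul_monomial, map_smul,
      Polynomial.monomial_one_right_eq_X_pow, hypergeomOp_X_pow]
    simp only [Polynomial.coeff_smul, Polynomial.coeff_add, Polynomial.coeff_X_pow, smul_eq_mul]
    rcases j with _ | j
    · rcases h with _ | h <;> simp
    · rw [Nat.add_sub_cancel]
      by_cases h1 : h = j
      · subst h1
        simp [mul_comm c]
      · by_cases h2 : h = j + 1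
        · subst h2
          simp
          ring
        · simp [h1, h2]

/-- The degree `L` section `∑ h, [z^(L - h)] (1 - z)^(-(d + 1)) x^h` of the generating series
`(1 - z)^(-(d + 1)) / (1 - x z)`. -/
noncomputable def binomialSection (d L : ℕ) : Polynomial ℂ :=
  ∑ h ∈ Finset.range (L + 1), Polynomial.monomial h ((d + (L - h)).choose d : ℂ)

theorem coeff_binomialSection (d L h : ℕ) : (binomialSection d L).coeff h =
    if h ≤ L then ((d + (L - h)).choose d : ℂ) else 0 := by
  simp [binomialSection, Polynomial.coeff_monomial]

/-- The hypergeometric operator is triangular on the sections of `(1 - z)^(-(d + 1)) / (1 - x z)`.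
-/
theorem hypergeomOp_binomialSection (d ℓ j : ℕ) :
    hypergeomOp (ℓ + d) (2 - ℓ) (binomialSection d (ℓ + j)) =
      ((ℓ + j) * (j + 1) : ℂ) • binomialSection d (ℓ + j) +
        (-(j * (d + 1 + ℓ + j)) : ℂ) • binomialSection d (ℓ + (j - 1)) := by
  ext h
  rw [coeff_hypergeomOp]
  simp only [Polynomial.coeff_add, Polynomial.coeff_smul, smul_eq_mul, coeff_binomialSection]
  rcases lt_trichotomy h (ℓ + j) with hlt | rfl | hgt
  · obtain ⟨N, hN⟩ : ∃ N, ℓ + j = h + N + 1 := ⟨ℓ + j - h - 1, by omega⟩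
    have e1 : ℓ + j - h = N + 1 := by omega
    have e2 : ℓ + j - (h + 1) = N := by omega
    have hc : ((d + (N + 1)).choose d : ℂ) * (N + 1) = (d + N).choose d * (d + N + 1) := by
      have := Nat.choose_mul_succ_eq (d + N) d
      rw [show d + N + 1 - d = N + 1 by omega] at this
      exact_mod_cast this.symm
    have hN' : (ℓ : ℂ) = h + N + 1 - j := by
      rw [eq_sub_iff_add_eq]
      exact_mod_cast hN
    rw [if_pos hlt.le, if_pos (by omega), e1, e2]
    rcases j with _ | j
    · rw [hN'] at *
      push_cast
      simp only [zero_mul, neg_zero, add_zero]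
      linear_combination -((h : ℂ) + 1) * hc
    · rw [if_pos (by omega), show ℓ + (j + 1 - 1) - h = N by omega, hN']
      push_cast
      linear_combination -((h : ℂ) + 1 + (j + 1)) * hc
  · rw [if_pos le_rfl, if_neg (by omega)]
    rcases j with _ | j
    · simp
      ring
    · rw [if_neg (by omega)]
      push_cast
      ring
  · rw [if_neg (by omega), if_neg (by omega), if_neg (by omega)]
    ring

theorem coeff_det_aeval_X {m : ℕ} (r : Fin m → Polynomial ℂ) (s : Fin m →₀ ℕ) :
    MvPolynomial.coeff s (Matrix.of fun k j : Fin m =>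
        Polynomial.aeval (MvPolynomial.X k : MvPolynomial (Fin m) ℂ) (r j)).det =
      (Matrix.of fun k j : Fin m => (r j).coeff (s k)).det := by
  rw [← Matrix.det_transpose, ← Matrix.det_transpose (Matrix.of fun k j : Fin m => _)]
  simp only [Matrix.det_apply, MvPolynomial.coeff_sum, Matrix.transpose_apply, Matrix.of_apply,
    Units.smul_def, zsmul_eq_mul]
  refine Finset.sum_congr rfl fun σ _ => ?_
  rw [← MvPolynomial.coeff_prod_aeval_X fun k => r (σ k),
    ← map_intCast (MvPolynomial.C : ℂ →+* MvPolynomial (Fin m) ℂ), MvPolynomial.coeff_C_mul]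

/-- On monomials of maximal total degree the operator is diagonal, as its remaining part lowers the
degree. -/
theorem coeff_sumHypergeomOp_of_totalDegree {m : ℕ} (a b : ℂ) {p : MvPolynomial (Fin m) ℂ}
    {s : Fin m →₀ ℕ} (hs : ∀ t ∈ p.support, t.degree ≤ s.degree) :
    MvPolynomial.coeff s (sumHypergeomOp m a b p) =
      (∑ k, (s k * (s k - 1 + b) : ℂ)) * MvPolynomial.coeff s p := by
  have h1 : ∀ (t : Fin m →₀ ℕ) (c : ℂ), t.degree ≤ s.degree →
      MvPolynomial.coeff s (sumHypergeomOp m a b (MvPolynomial.monomial t c)) =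
      (∑ k, (s k * (s k - 1 + b) : ℂ)) * MvPolynomial.coeff s (MvPolynomial.monomial t c) := by
    intro t c ht
    have hmon : MvPolynomial.monomial t c =
        c • ∏ k, Polynomial.aeval (MvPolynomial.X k : MvPolynomial (Fin m) ℂ)
          ((Polynomial.X : Polynomial ℂ) ^ t k) := by
      rw [MvPolynomial.monomial_eq, Finsupp.prod_fintype _ _ fun _ => pow_zero _,
        MvPolynomial.smul_eq_C_mul]
      simp
    rw [hmon, map_smul, MvPolynomial.coeff_smul, MvPolynomial.coeff_smul,
      sumHypergeomOp_prod_aeval, MvPolynomial.coeff_sum, mul_smul_comm]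
    congr 1
    simp only [MvPolynomial.coeff_prod_aeval_X]
    rw [Finset.sum_mul]
    refine Finset.sum_congr rfl fun k _ => ?_
    by_cases hts : ∀ l, l ≠ k → s l = t l
    · rw [← Finset.mul_prod_erase _ _ (Finset.mem_univ k), Function.update_self,
        ← Finset.mul_prod_erase _ (fun l => ((Polynomial.X : Polynomial ℂ) ^ t l).coeff (s l))
          (Finset.mem_univ k), coeff_hypergeomOp]
      have hk : t k ≤ s k := by
        have e1 := Finset.add_sum_erase Finset.univ (fun l => s l) (Finset.mem_univ k)
        have e2 := Finset.add_sum_erase Finset.univ (fun l => t l) (Finset.mem_univ k)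
        have e3 : ∑ l ∈ Finset.univ.erase k, s l = ∑ l ∈ Finset.univ.erase k, t l :=
          Finset.sum_congr rfl fun l hl => hts l (Finset.ne_of_mem_erase hl)
        rw [Finsupp.degree_eq_sum, Finsupp.degree_eq_sum] at ht
        omega
      rw [Polynomial.coeff_X_pow _ (s k + 1), if_neg (by omega), mul_zero, add_zero, mul_assoc]
      congr 2
      refine Finset.prod_congr rfl fun l hl => ?_
      rw [Function.update_of_ne (Finset.ne_of_mem_erase hl)]
    · push Not at hts
      obtain ⟨l, hlk, hl⟩ := hts
      rw [Finset.prod_eq_zero (Finset.mem_univ l), Finset.prod_eq_zero (Finset.mem_univ l),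
        mul_zero]
      · rw [Polynomial.coeff_X_pow, if_neg hl]
      · rw [Function.update_of_ne hlk, Polynomial.coeff_X_pow, if_neg hl]
  rw [p.as_sum, map_sum, MvPolynomial.coeff_sum, MvPolynomial.coeff_sum, Finset.mul_sum]
  exact Finset.sum_congr rfl fun t ht => h1 t _ (hs t ht)

/-- A set of `m` exponents below `ℓ + m` whose total eigenvalue is as large as that of
`{ℓ, …, ℓ + m - 1}` equals that set: the summand `h (h + 1 - ℓ)` is positive for
`0 < h`, `ℓ ≤ h` and nonpositive below `ℓ`. -/
theorem Finset.eq_Ico_of_sum_eq {ℓ m : ℕ} {T : Finset ℕ} (hT : T.card = m)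
    (hlt : ∀ h ∈ T, h < ℓ + m)
    (hsum : ∑ h ∈ T, (h * (h + 1 - ℓ) : ℤ) = ∑ h ∈ Finset.Ico ℓ (ℓ + m), (h * (h + 1 - ℓ) : ℤ)) :
    T = Finset.Ico ℓ (ℓ + m) := by
  by_contra hne
  have hcard : (Finset.Ico ℓ (ℓ + m)).card = T.card := by simp [hT]
  have h1 : ¬T ⊆ Finset.Ico ℓ (ℓ + m) := fun h => hne (Finset.eq_of_subset_of_card_le h hcard.le)
  have h2 : ¬Finset.Ico ℓ (ℓ + m) ⊆ T := fun h =>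
    hne (Finset.eq_of_subset_of_card_le h hcard.ge).symm
  obtain ⟨g, hgT, hg⟩ := Finset.not_subset.1 h1
  obtain ⟨h0, hh0, hh0T⟩ := Finset.not_subset.1 h2
  have hgℓ : g < ℓ := by
    by_contra! h
    exact hg (Finset.mem_Ico.2 ⟨h, hlt g hgT⟩)
  have e1 : ∑ h ∈ T, (h * (h + 1 - ℓ) : ℤ) ≤
      ∑ h ∈ T ∩ Finset.Ico ℓ (ℓ + m), (h * (h + 1 - ℓ) : ℤ) := by
    rw [← Finset.sum_sdiff (Finset.inter_subset_left (s₁ := T) (s₂ := Finset.Ico ℓ (ℓ + m)))]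
    refine add_le_of_nonpos_left (Finset.sum_nonpos fun h hh => ?_)
    have : h < ℓ := by
      simp only [Finset.mem_sdiff, Finset.mem_inter, Finset.mem_Ico] at hh
      have := hlt h hh.1
      by_contra! h'
      exact hh.2 ⟨hh.1, h', this⟩
    exact mul_nonpos_of_nonneg_of_nonpos (by positivity) (by omega)
  have e2 : ∑ h ∈ T ∩ Finset.Ico ℓ (ℓ + m), (h * (h + 1 - ℓ) : ℤ) <
      ∑ h ∈ Finset.Ico ℓ (ℓ + m), (h * (h + 1 - ℓ) : ℤ) := by
    refine Finset.sum_lt_sum_of_subset Finset.inter_subset_right hh0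
      (fun h => hh0T (Finset.mem_inter.1 h).1) ?_ fun h hh _ => ?_
    · have := (Finset.mem_Ico.1 hh0).1
      exact mul_pos (by omega) (by omega)
    · have := (Finset.mem_Ico.1 hh).1
      exact mul_nonneg (by omega) (by omega)
  exact absurd hsum (e1.trans_lt e2).ne

/-- An antisymmetric polynomial of degree less than `ℓ + m` in each variable, with the eigenvalue of
the exponents `ℓ, …, ℓ + m - 1`, is determined by the coefficient of that monomial. The exponents of
a monomial of maximal total degree are distinct by antisymmetry and have the same eigenvalue, so by
`Finset.eq_Ico_of_sum_eq` they are a permutation of `ℓ, …, ℓ + m - 1`. -/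
theorem eq_zero_of_sumHypergeomOp_eq_smul {ℓ m : ℕ} {a : ℂ} {p : MvPolynomial (Fin m) ℂ}
    (hanti : ∀ σ : Equiv.Perm (Fin m), MvPolynomial.rename σ p = ((σ.sign : ℤ) : ℂ) • p)
    (hdeg : ∀ s ∈ p.support, ∀ k, s k < ℓ + m)
    (heig : sumHypergeomOp m a (2 - ℓ) p = (∑ j : Fin m, ((ℓ + (j : ℕ)) * ((j : ℕ) + 1) : ℂ)) • p)
    (h0 : MvPolynomial.coeff (Finsupp.equivFunOnFinite.symm fun j : Fin m => ℓ + (j : ℕ)) p = 0) :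
    p = 0 := by
  by_contra hp
  obtain ⟨s, hs, hmax⟩ := Finset.exists_max_image p.support (fun s => s.degree)
    (MvPolynomial.support_nonempty.2 hp)
  have hcs := MvPolynomial.mem_support_iff.1 hs
  have hperm : ∀ (σ : Equiv.Perm (Fin m)) (t : Fin m →₀ ℕ),
      MvPolynomial.coeff t p = ((σ.sign : ℤ) : ℂ) * MvPolynomial.coeff (t.mapDomain σ) p := by
    intro σ t
    have := congrArg (MvPolynomial.coeff (t.mapDomain σ)) (hanti σ)
    rwa [MvPolynomial.coeff_rename_mapDomain _ σ.injective, MvPolynomial.coeff_smul,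
      smul_eq_mul] at this
  -- a repeated exponent would be fixed by a transposition
  have hinj : Function.Injective s := by
    intro i j hij
    by_contra hne
    have h1 := hperm (Equiv.swap i j) s
    have h2 : s.mapDomain (Equiv.swap i j) = s := by
      ext k
      rw [Finsupp.mapDomain_equiv_apply, Equiv.symm_swap, Equiv.swap_apply_def]
      split_ifs with h1 h2
      · rw [h1, hij]
      · rw [h2, hij]
      · rfl
    rw [h2, Equiv.Perm.sign_swap hne] at h1
    push_cast at h1
    exact hcs (by linear_combination h1 / 2)
  have heq := congrArg (MvPolynomial.coeff s) heig
  rw [coeff_sumHypergeomOp_of_totalDegree _ _ hmax, MvPolynomial.coeff_smul, smul_eq_mul,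
    mul_left_inj' hcs] at heq
  have hT : Finset.univ.image s = Finset.Ico ℓ (ℓ + m) := by
    refine Finset.eq_Ico_of_sum_eq (by simp [Finset.card_image_of_injective _ hinj]) ?_ ?_
    · intro h hh
      obtain ⟨k, -, rfl⟩ := Finset.mem_image.1 hh
      exact hdeg s hs k
    · rw [Finset.sum_image fun _ _ _ _ h => hinj h, Finset.sum_Ico_eq_sum_range,
        Nat.add_sub_cancel_left, ← Fin.sum_univ_eq_sum_range fun j => (((ℓ + j : ℕ) : ℤ) *
          (((ℓ + j : ℕ) : ℤ) + 1 - ℓ))]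
      have : ((∑ k, (s k * (s k + 1 - ℓ) : ℤ) : ℤ) : ℂ) =
          ((∑ j : Fin m, (((ℓ + j : ℕ) : ℤ) * (((ℓ + j : ℕ) : ℤ) + 1 - ℓ)) : ℤ) : ℂ) := by
        push_cast
        refine Eq.trans (Finset.sum_congr rfl fun k _ => ?_) (heq.trans
          (Finset.sum_congr rfl fun k _ => ?_)) <;> ring
      exact_mod_cast this
  have hmem : ∀ k, ℓ ≤ s k := fun k => by
    have : s k ∈ Finset.univ.image s := Finset.mem_image_of_mem _ (Finset.mem_univ k)
    rw [hT] at this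
    exact (Finset.mem_Ico.1 this).1
  have hbij : Function.Bijective fun k => (⟨s k - ℓ, by
      have := hdeg s hs k; have := hmem k; omega⟩ : Fin m) := by
    refine Finite.injective_iff_bijective.1 fun i j hij => hinj ?_
    have := congrArg Fin.val hij
    have := hmem i
    have := hmem j
    simp only at *
    omega
  refine hcs ?_
  rw [hperm (Equiv.ofBijective _ hbij) s]
  have h3 : s.mapDomain (Equiv.ofBijective _ hbij) =
      Finsupp.equivFunOnFinite.symm fun j : Fin m => ℓ + (j : ℕ) := by
    ext k
    obtain ⟨i, rfl⟩ := (Equiv.ofBijective _ hbij).surjective k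
    rw [Finsupp.mapDomain_apply (Equiv.injective _)]
    have := hmem i
    simp
    omega
  rw [h3, h0, mul_zero]

/-- The eigenvalue of the Vandermonde determinant and the constant from the loop equations add up to
the eigenvalue of the exponents `ℓ, …, ℓ + m - 1`. -/
theorem sum_eigenvalue_eq (ℓ m : ℕ) :
    (∑ j : Fin m, ((j : ℕ) * ((j : ℕ) - 1 + (2 - ℓ)) : ℂ)) + m ^ 2 * ℓ =
      ∑ j : Fin m, ((ℓ + (j : ℕ)) * ((j : ℕ) + 1) : ℂ) := by
  induction m with
  | zero => simp
  | succ m ih =>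
    rw [Fin.sum_univ_castSucc, Fin.sum_univ_castSucc]
    simp only [Fin.val_castSucc, Fin.val_last]
    push_cast
    linear_combination ih

theorem rename_det_aeval_X {m : ℕ} (r : Fin m → Polynomial ℂ) (σ : Equiv.Perm (Fin m)) :
    MvPolynomial.rename σ (Matrix.of fun k j : Fin m =>
        Polynomial.aeval (MvPolynomial.X k : MvPolynomial (Fin m) ℂ) (r j)).det =
      ((σ.sign : ℤ) : ℂ) • (Matrix.of fun k j : Fin m =>
        Polynomial.aeval (MvPolynomial.X k : MvPolynomial (Fin m) ℂ) (r j)).det := by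
  rw [AlgHom.map_det]
  have h : (MvPolynomial.rename σ).mapMatrix (Matrix.of fun k j : Fin m =>
        Polynomial.aeval (MvPolynomial.X k : MvPolynomial (Fin m) ℂ) (r j)) =
      (Matrix.of fun k j : Fin m =>
        Polynomial.aeval (MvPolynomial.X k : MvPolynomial (Fin m) ℂ) (r j)).submatrix σ id := by
    ext1 k j
    simp only [AlgHom.mapMatrix_apply, Matrix.map_apply, Matrix.of_apply, Matrix.submatrix_apply,
      id]
    rw [← Polynomial.aeval_algHom_apply, MvPolynomial.rename_X]
  rw [h, Matrix.det_permute, MvPolynomial.smul_eq_C_mul, map_intCast]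

theorem rename_cueMomentPoly {ℓ M : ℕ} (h : ℓ ≤ M) (q : ℝ) (m : ℕ) (σ : Equiv.Perm (Fin m)) :
    MvPolynomial.rename σ (cueMomentPoly h q m) = cueMomentPoly h q m := by
  refine MvPolynomial.funext fun x => ?_
  rw [MvPolynomial.eval_rename, eval_cueMomentPoly, eval_cueMomentPoly]
  simp only [Function.comp_apply]
  refine integral_congr_ae (Filter.Eventually.of_forall fun U => ?_)
  beta_reduce
  rw [Equiv.prod_comp σ fun k => (1 + x k • (-(q : ℂ) • topLeftBlock h U)).det]

/-- Both sides are antisymmetric eigenvectors with the same eigenvalue, so they are proportional. -/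
theorem det_vandermonde_mul_cueMomentPoly {ℓ d m : ℕ} {M : ℕ} (h : ℓ ≤ M) (hM : M + m = ℓ + d + 1)
    (q : ℝ) (hq0 : 0 < q) (hq1 : q < 1) :
    ∃ α : ℂ, (Matrix.vandermonde (MvPolynomial.X : Fin m → MvPolynomial (Fin m) ℂ)).det *
        cueMomentPoly h q m =
      α • (Matrix.of fun k j : Fin m => Polynomial.aeval
        (MvPolynomial.X k : MvPolynomial (Fin m) ℂ) (binomialSection d (ℓ + j))).det := by
  have hM' : (ℓ + d : ℂ) = M + m - 1 := by
    rw [eq_sub_iff_add_eq]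
    exact_mod_cast hM.symm
  have hB := sumHypergeomOp_det_eq_smul (m := m) (ℓ + d) (2 - ℓ)
    (fun j => binomialSection d (ℓ + j)) (fun j => (ℓ + j) * (j + 1))
    (fun j => -(j * (d + 1 + ℓ + j))) (by simp) fun j => hypergeomOp_binomialSection d ℓ j
  have hA := sumHypergeomOp_det_vandermonde_mul_cueMomentPoly h q m hq0 hq1
  rw [sum_eigenvalue_eq, ← hM'] at hA
  have hAs : ∀ σ : Equiv.Perm (Fin m), MvPolynomial.rename σ
      ((Matrix.vandermonde (MvPolynomial.X : Fin m → MvPolynomial (Fin m) ℂ)).det *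
        cueMomentPoly h q m) = ((σ.sign : ℤ) : ℂ) •
      ((Matrix.vandermonde (MvPolynomial.X : Fin m → MvPolynomial (Fin m) ℂ)).det *
        cueMomentPoly h q m) := by
    intro σ
    rw [map_mul, rename_cueMomentPoly, vandermonde_X_eq, rename_det_aeval_X, smul_mul_assoc]
  have hBs := rename_det_aeval_X (m := m) fun j => binomialSection d (ℓ + j)
  set A := (Matrix.vandermonde (MvPolynomial.X : Fin m → MvPolynomial (Fin m) ℂ)).det *
        cueMomentPoly h q m with hAd
  set B := (Matrix.of fun k j : Fin m => Polynomial.aeval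
        (MvPolynomial.X k : MvPolynomial (Fin m) ℂ) (binomialSection d (ℓ + j))).det with hBd
  set δ : Fin m →₀ ℕ := Finsupp.equivFunOnFinite.symm fun j : Fin m => ℓ + (j : ℕ) with hδ
  -- the coefficient of this monomial normalizes `B`
  have hBδ : MvPolynomial.coeff δ B = 1 := by
    rw [hBd, coeff_det_aeval_X, Matrix.det_of_isUpperTriangular]
    · simp [hδ, coeff_binomialSection]
    · intro k j hjk
      simp [hδ, coeff_binomialSection, not_le.2 (show j < k from hjk)]
  have hBdeg : ∀ s ∈ B.support, ∀ k, s k < ℓ + m := by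
    intro s hs k
    by_contra! hk
    refine MvPolynomial.mem_support_iff.1 hs ?_
    rw [hBd, coeff_det_aeval_X]
    refine Matrix.det_eq_zero_of_row_eq_zero k fun j => ?_
    rw [Matrix.of_apply, coeff_binomialSection, if_neg (by omega)]
  have hAdeg : ∀ s ∈ A.support, ∀ k, s k < ℓ + m := by
    intro s hs k
    refine (MvPolynomial.monomial_le_degreeOf k hs).trans_lt
      ((MvPolynomial.degreeOf_mul_le _ _ _).trans_lt ?_)
    have h1 : MvPolynomial.degreeOf k (Matrix.vandermonde
        (MvPolynomial.X : Fin m → MvPolynomial (Fin m) ℂ)).det < m := by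
      rw [MvPolynomial.degreeOf_lt_iff (Fin.pos k), vandermonde_X_eq]
      intro t ht
      by_contra! hk
      refine MvPolynomial.mem_support_iff.1 ht ?_
      rw [coeff_det_aeval_X]
      refine Matrix.det_eq_zero_of_row_eq_zero k fun j => ?_
      rw [Matrix.of_apply, Polynomial.coeff_X_pow, if_neg (by omega)]
    have h2 : MvPolynomial.degreeOf k (cueMomentPoly h q m) ≤ ℓ := by
      rw [MvPolynomial.degreeOf_le_iff]
      intro t ht
      exact Finset.mem_Iic.1 (support_coeffIntegral_subset _ _ _ ht) k
    omega
  refine ⟨MvPolynomial.coeff δ A, sub_eq_zero.1 ?_⟩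
  refine eq_zero_of_sumHypergeomOp_eq_smul (ℓ := ℓ) (a := ℓ + d) (fun σ => ?_) ?_ ?_ ?_
  · rw [map_sub, map_smul, hAs, hBs, smul_sub, smul_comm]
  · intro s hs k
    rcases Finset.mem_union.1 (MvPolynomial.support_sub _ _ _ hs) with h1 | h1
    · exact hAdeg s h1 k
    · exact hBdeg s (MvPolynomial.support_smul h1) k
  · rw [map_sub, map_smul, hA, hB, smul_sub, smul_comm]
  · rw [MvPolynomial.coeff_sub, MvPolynomial.coeff_smul, hBδ, smul_eq_mul, mul_one, sub_self]

/-! ### Toeplitz determinants of geometric series -/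

/-- The geometric series `1 / (1 - x z)`. -/
noncomputable def geomSeries {K : Type*} [CommRing K] (x : K) : PowerSeries K :=
  PowerSeries.mk fun n => x ^ n

section

variable {K : Type*} [CommRing K]

theorem coeff_geomSeries (x : K) (n : ℕ) : PowerSeries.coeff n (geomSeries x) = x ^ n :=
  PowerSeries.coeff_mk _ _

theorem rescale_geomSeries (t x : K) :
    PowerSeries.rescale t (geomSeries x) = geomSeries (t * x) := by
  ext n
  rw [PowerSeries.coeff_rescale, coeff_geomSeries, coeff_geomSeries, mul_pow]

theorem map_geomSeries {K' : Type*} [CommRing K'] (f : K →+* K') (x : K) :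
    PowerSeries.map f (geomSeries x) = geomSeries (f x) := by
  ext n
  rw [PowerSeries.coeff_map, coeff_geomSeries, coeff_geomSeries, map_pow]

theorem geomSeries_zero : geomSeries (0 : K) = 1 := by
  ext n
  rw [coeff_geomSeries, PowerSeries.coeff_one, zero_pow_eq]

theorem one_sub_mul_geomSeries (x : K) :
    (1 - PowerSeries.C x * PowerSeries.X) * geomSeries x = 1 := by
  have h := congrArg (PowerSeries.rescale x) (PowerSeries.mk_one_mul_one_sub_eq_one K)
  have h1 : geomSeries (1 : K) = PowerSeries.mk 1 := by
    ext n
    simp [coeff_geomSeries]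
  rw [← h1, map_mul, rescale_geomSeries, mul_one, map_sub, map_one, PowerSeries.rescale_X] at h
  rw [mul_comm, h]

theorem coeff_geomSeries_one_pow (d n : ℕ) :
    PowerSeries.coeff n (geomSeries (1 : K) ^ (d + 1)) = ((d + n).choose d : K) := by
  have h1 : geomSeries (1 : K) = PowerSeries.mk 1 := by
    ext n
    simp [coeff_geomSeries]
  rw [h1, PowerSeries.mk_one_pow_eq_mk_choose_add, PowerSeries.coeff_mk]

/-- The Toeplitz determinant `det [z^(L + j - i)] F`, `0 ≤ i, j < m`, with the convention that
coefficients of negative order vanish. -/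
noncomputable def toeplitzDet (m L : ℕ) (F : PowerSeries K) : K :=
  (Matrix.of fun i j : Fin m =>
    PowerSeries.coeff (L + (j : ℕ)) (PowerSeries.X ^ (i : ℕ) * F)).det

theorem map_toeplitzDet {K' : Type*} [CommRing K'] (f : K →+* K') (m L : ℕ) (F : PowerSeries K) :
    f (toeplitzDet m L F) = toeplitzDet m L (PowerSeries.map f F) := by
  rw [toeplitzDet, RingHom.map_det, toeplitzDet]
  congr 1
  ext1 i j
  rw [RingHom.mapMatrix_apply, Matrix.map_apply, Matrix.of_apply, Matrix.of_apply,
    ← PowerSeries.coeff_map, map_mul, map_pow, PowerSeries.map_X]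

/-- Row operations on a Toeplitz determinant: the rows `z^i` are replaced by polynomials. -/
theorem det_coeff_polynomial_mul (m L : ℕ) (F : PowerSeries K) (u : Fin m → Polynomial K)
    (hu : ∀ i, (u i).natDegree < m) :
    (Matrix.of fun i j : Fin m =>
        PowerSeries.coeff (L + (j : ℕ)) ((u i : PowerSeries K) * F)).det =
      (Matrix.of fun i j : Fin m => (u i).coeff j).det * toeplitzDet m L F := by
  rw [toeplitzDet, ← Matrix.det_mul]
  congr 1
  ext1 i j
  rw [Matrix.mul_apply]
  have h : (u i : PowerSeries K) = ∑ a : Fin m,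
      PowerSeries.C ((u i).coeff a) * PowerSeries.X ^ (a : ℕ) := by
    conv_lhs => rw [(u i).as_sum_range' m (hu i), ← Fin.sum_univ_eq_sum_range fun a =>
      Polynomial.monomial a ((u i).coeff a)]
    rw [← Polynomial.coeToPowerSeries.ringHom_apply, map_sum]
    refine Finset.sum_congr rfl fun a _ => ?_
    rw [Polynomial.coeToPowerSeries.ringHom_apply, ← Polynomial.C_mul_X_pow_eq_monomial]
    simp
  simp only [Matrix.of_apply]
  rw [h, Finset.sum_mul, map_sum]
  refine Finset.sum_congr rfl fun a _ => ?_
  rw [mul_assoc, PowerSeries.coeff_C_mul]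

/-- A Toeplitz matrix with `L = 0` is unitriangular. -/
theorem toeplitzDet_zero_of_constantCoeff (m : ℕ) {F : PowerSeries K}
    (hF : PowerSeries.constantCoeff F = 1) : toeplitzDet m 0 F = 1 := by
  rw [toeplitzDet, Matrix.det_of_isUpperTriangular]
  · refine Finset.prod_eq_one fun i _ => ?_
    rw [Matrix.of_apply, zero_add, PowerSeries.coeff_X_pow_mul', if_pos le_rfl, Nat.sub_self,
      PowerSeries.coeff_zero_eq_constantCoeff_apply, hF]
  · intro i j hij
    have : (j : ℕ) < i := hij
    rw [Matrix.of_apply, zero_add, PowerSeries.coeff_X_pow_mul', if_neg (not_le.2 this)]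

theorem toeplitzDet_rescale {K : Type*} [Field K] {t : K} (ht : t ≠ 0) (m L : ℕ)
    (F : PowerSeries K) :
    toeplitzDet m L (PowerSeries.rescale t F) = t ^ (m * L) * toeplitzDet m L F := by
  have h : Matrix.diagonal (fun i : Fin m => t ^ (i : ℕ)) * (Matrix.of fun i j : Fin m =>
      PowerSeries.coeff (L + (j : ℕ)) (PowerSeries.X ^ (i : ℕ) * PowerSeries.rescale t F)) =
      (Matrix.of fun i j : Fin m => PowerSeries.coeff (L + (j : ℕ))
        (PowerSeries.X ^ (i : ℕ) * F)) * Matrix.diagonal fun j : Fin m => t ^ (L + (j : ℕ)) := by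
    ext1 i j
    have hX : PowerSeries.rescale t (PowerSeries.X ^ (i : ℕ) * F) =
        PowerSeries.C (t ^ (i : ℕ)) * (PowerSeries.X ^ (i : ℕ) * PowerSeries.rescale t F) := by
      rw [map_mul, map_pow, PowerSeries.rescale_X, mul_pow, ← map_pow, mul_assoc]
    rw [Matrix.diagonal_mul, Matrix.mul_diagonal, Matrix.of_apply, Matrix.of_apply,
      ← PowerSeries.coeff_C_mul, ← hX, PowerSeries.coeff_rescale, mul_comm]
  have h1 := congrArg Matrix.det h
  rw [Matrix.det_mul, Matrix.det_mul, Matrix.det_diagonal, Matrix.det_diagonal] at h1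
  simp only [pow_add, Finset.prod_mul_distrib, Finset.prod_const, Finset.card_univ,
    Fintype.card_fin, ← pow_mul] at h1
  have h2 : ∏ i : Fin m, t ^ (i : ℕ) ≠ 0 := Finset.prod_ne_zero_iff.2 fun i _ => pow_ne_zero _ ht
  refine mul_left_cancel₀ h2 (h1.trans ?_)
  rw [toeplitzDet, mul_comm m L]
  ring

/-- The determinant of the sections is the Vandermonde determinant times a Toeplitz determinant: the
polynomials `∏_{p ≠ k} (1 - x_p z)` turn the rows `z^i` of the Toeplitz matrix into the rows `1 / (1
- x_k z)`, and for `L = 0` and the symbol `∏_p 1 / (1 - x_p z)` the same row operation produces the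
Vandermonde matrix. -/
theorem det_aeval_binomialSection (d m L : ℕ) {R : Type*} [CommRing R] [Algebra ℂ R]
    (x : Fin m → R) :
    (Matrix.of fun k j : Fin m => Polynomial.aeval (x k) (binomialSection d (L + j))).det =
      (Matrix.vandermonde x).det *
        toeplitzDet m L (geomSeries 1 ^ (d + 1) * ∏ p, geomSeries (x p)) := by
  set u : Fin m → Polynomial R := fun k =>
    ∏ p ∈ Finset.univ.erase k, (1 - Polynomial.C (x p) * Polynomial.X) with hu
  have hdeg : ∀ k, (u k).natDegree < m := by
    intro k
    refine (Polynomial.natDegree_prod_le _ _).trans_lt ((Finset.sum_le_card_nsmul _ _ 1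
      fun p _ => ?_).trans_lt ?_)
    · refine (Polynomial.natDegree_sub_le _ _).trans ?_
      rw [Polynomial.natDegree_one]
      exact max_le zero_le_one ((Polynomial.natDegree_C_mul_le _ _).trans Polynomial.natDegree_X_le)
    · rw [Finset.card_erase_of_mem (Finset.mem_univ k), Finset.card_univ, Fintype.card_fin,
        smul_eq_mul, mul_one]
      have := Fin.pos k
      omega
  have huF : ∀ k, (u k : PowerSeries R) * ∏ p, geomSeries (x p) = geomSeries (x k) := by
    intro k
    have : (u k : PowerSeries R) = ∏ p ∈ Finset.univ.erase k,
        (1 - PowerSeries.C (x p) * PowerSeries.X) := by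
      rw [hu, ← Polynomial.coeToPowerSeries.ringHom_apply, map_prod]
      simp
    rw [this, ← Finset.mul_prod_erase _ _ (Finset.mem_univ k), mul_left_comm,
      ← Finset.prod_mul_distrib, Finset.prod_eq_one fun p _ => one_sub_mul_geomSeries (x p),
      mul_one]
  have h1 := det_coeff_polynomial_mul m 0 (∏ p, geomSeries (x p)) u hdeg
  have h2 := det_coeff_polynomial_mul m L (geomSeries 1 ^ (d + 1) * ∏ p, geomSeries (x p)) u hdeg
  rw [toeplitzDet_zero_of_constantCoeff, mul_one] at h1
  · rw [← h1] at h2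
    simp only [huF, zero_add, coeff_geomSeries, mul_left_comm] at h2
    have hv : Matrix.vandermonde x = Matrix.of fun k j : Fin m => x k ^ (j : ℕ) := rfl
    rw [hv, ← h2]
    congr 1
    ext1 k j
    rw [Matrix.of_apply, Matrix.of_apply, PowerSeries.coeff_mul,
      Finset.Nat.sum_antidiagonal_eq_sum_range_succ_mk, binomialSection, map_sum,
      ← Finset.sum_range_reflect]
    refine Finset.sum_congr rfl fun h hh => ?_
    have : h < L + j + 1 := Finset.mem_range.1 hh
    rw [coeff_geomSeries, Polynomial.aeval_monomial, coeff_geomSeries_one_pow,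
      show L + (j : ℕ) + 1 - 1 - h = L + j - h by omega, Nat.sub_sub_self (by omega)]
    simp
  · rw [map_prod]
    exact Finset.prod_eq_one fun p _ => by
      rw [← PowerSeries.coeff_zero_eq_constantCoeff_apply, coeff_geomSeries, pow_zero]

end

/-! ### The moment as a Toeplitz determinant -/

/-- The mean value property of polynomials, over the `K`-th roots of unity. -/
theorem IsPrimitiveRoot.sum_eval_pow_eq {K : ℕ} {ζ : ℂ} (hζ : IsPrimitiveRoot ζ K)
    {p : Polynomial ℂ} (hp : p.natDegree < K) :
    ∑ i ∈ Finset.range K, p.eval (ζ ^ i) = K * p.eval 0 := by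
  simp only [Polynomial.eval_eq_sum_range' hp]
  rw [Finset.sum_comm, Finset.mul_sum]
  refine Finset.sum_congr rfl fun j hj => ?_
  have hj' := Finset.mem_range.1 hj
  rw [← Finset.mul_sum]
  rcases Nat.eq_zero_or_pos j with rfl | h0
  · simp [mul_comm]
  · have h1 : ∑ i ∈ Finset.range K, (ζ ^ i) ^ j = 0 := by
      have hne : ζ ^ j ≠ 1 := hζ.pow_ne_one_of_pos_of_lt h0.ne' hj'
      have h2 := mul_geom_sum (ζ ^ j) K
      rw [← pow_mul, mul_comm j, pow_mul, hζ.pow_eq_one, one_pow, sub_self] at h2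
      simp only [← pow_mul, mul_comm _ j] at h2 ⊢
      exact (mul_eq_zero.1 h2).resolve_left (sub_ne_zero.2 hne)
    rw [h1, zero_pow h0.ne']
    ring

section

variable {ℓ M : ℕ} (h : ℓ ≤ M)

theorem integral_comp_smul_topLeftBlock {ω : ℂ} (hω : ‖ω‖ = 1)
    (f : Matrix (Fin ℓ) (Fin ℓ) ℂ → ℂ) :
    ∫ U, f (ω • topLeftBlock h U) ∂(cue M) = ∫ U, f (topLeftBlock h U) ∂(cue M) := by
  have hω' : ω * conj ω = 1 := by
    rw [Complex.mul_conj, Complex.normSq_eq_norm_sq, hω]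
    norm_num
  let V : Matrix.unitaryGroup (Fin M) ℂ := ⟨ω • 1, Matrix.mem_unitaryGroup_iff.2 (by
    rw [star_smul, star_one, smul_mul_smul_comm, mul_one]
    change (ω * conj ω) • _ = _
    rw [hω', one_smul])⟩
  have h1 : ∀ U, topLeftBlock h (V * U) = ω • topLeftBlock h U := by
    intro U
    ext i j
    simp [topLeftBlock, V]
  have : (cue M).IsMulLeftInvariant := by unfold cue; infer_instance
  simp only [← h1]
  exact integral_mul_left_eq_self (fun U => f (topLeftBlock h U)) V

/-- The distribution of `T` is invariant under rotations `T ↦ ω T`, so the integral of a polynomial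
in `T` is its value at `T = 0`. It suffices to average over finitely many rotations. -/
theorem integral_det_topLeftBlock_sub_pow (q : ℝ) (hq : q ≠ 0) (m : ℕ) :
    ∫ U, (topLeftBlock h U - (q : ℂ) • 1).det ^ m ∂(cue M) = (-(q : ℂ)) ^ (ℓ * m) := by
  have hq' : -(q : ℂ) ≠ 0 := by simpa using hq
  have hdet : ∀ T : Matrix (Fin ℓ) (Fin ℓ) ℂ, (T - (q : ℂ) • 1).det ^ m =
      (-(q : ℂ)) ^ (ℓ * m) * (detOneAddPoly ((-(q : ℂ))⁻¹ • T) ^ m).eval 1 := by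
    intro T
    have : T - (q : ℂ) • 1 = -(q : ℂ) • (1 + (1 : ℂ) • ((-(q : ℂ))⁻¹ • T)) := by
      rw [one_smul, smul_add, smul_smul, mul_inv_cancel₀ hq', one_smul, neg_smul]
      abel
    rw [this, Matrix.det_smul, Fintype.card_fin, mul_pow, ← pow_mul, Polynomial.eval_pow,
      eval_detOneAddPoly]
  have hK : ∀ T : Matrix (Fin ℓ) (Fin ℓ) ℂ,
      (detOneAddPoly T ^ m).natDegree < m * ℓ + 1 := fun T =>
    Nat.lt_succ_of_le (Polynomial.natDegree_pow_le.trans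
      (Nat.mul_le_mul_left m (natDegree_detOneAddPoly_le T)))
  obtain ⟨ζ, hζ⟩ : ∃ ζ : ℂ, IsPrimitiveRoot ζ (m * ℓ + 1) :=
    ⟨_, Complex.isPrimitiveRoot_exp _ (Nat.succ_ne_zero _)⟩
  have hcont : ∀ z : ℂ, Continuous fun U : Matrix.unitaryGroup (Fin M) ℂ =>
      (detOneAddPoly ((-(q : ℂ))⁻¹ • topLeftBlock h U) ^ m).eval z := by
    intro z
    simp only [Polynomial.eval_pow, eval_detOneAddPoly]
    have h1 := continuous_topLeftBlock h
    have h2 : Continuous fun U => z • ((-(q : ℂ))⁻¹ • topLeftBlock h U) :=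
      (h1.const_smul ((-(q : ℂ))⁻¹)).const_smul z
    exact (continuous_const.add h2).matrix_det.pow m
  have hrot : ∀ i : ℕ, ∫ U, (detOneAddPoly ((-(q : ℂ))⁻¹ • topLeftBlock h U) ^ m).eval (ζ ^ i)
        ∂(cue M) =
      ∫ U, (detOneAddPoly ((-(q : ℂ))⁻¹ • topLeftBlock h U) ^ m).eval 1 ∂(cue M) := by
    intro i
    rw [← integral_comp_smul_topLeftBlock h (ω := ζ ^ i)
      (by rw [norm_pow, hζ.norm'_eq_one (Nat.succ_ne_zero _), one_pow])
      fun T => (detOneAddPoly ((-(q : ℂ))⁻¹ • T) ^ m).eval 1]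
    simp only [Polynomial.eval_pow, eval_detOneAddPoly, one_smul, smul_comm (ζ ^ i)]
  have hsum := integral_finsetSum (μ := cue M) (Finset.range (m * ℓ + 1)) fun i _ =>
    integrable_cue_of_continuous (hcont (ζ ^ i))
  simp only [hrot, fun U => hζ.sum_eval_pow_eq (hK ((-(q : ℂ))⁻¹ • topLeftBlock h U))] at hsum
  simp only [Polynomial.eval_pow, eval_detOneAddPoly, zero_smul, add_zero, Matrix.det_one, one_pow,
    mul_one, integral_const, Finset.sum_const, Finset.card_range, nsmul_eq_mul,
    probReal_univ] at hsum
  simp only [hdet]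
  rw [integral_const_mul]
  simp only [Polynomial.eval_pow, eval_detOneAddPoly]
  have hne : ((m * ℓ + 1 : ℕ) : ℂ) ≠ 0 := Nat.cast_ne_zero.2 (Nat.succ_ne_zero _)
  rw [one_smul] at hsum
  rw [← mul_left_cancel₀ hne (hsum.symm.trans (mul_one _).symm).symm, mul_one]

theorem cueMomentPoly_eq_smul_toeplitzDet {d m : ℕ} (hM : M + m = ℓ + d + 1)
    (q : ℝ) (hq0 : 0 < q) (hq1 : q < 1) :
    ∃ α : ℂ, cueMomentPoly h q m = α • toeplitzDet m ℓ (geomSeries 1 ^ (d + 1) *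
      ∏ p : Fin m, geomSeries (MvPolynomial.X p : MvPolynomial (Fin m) ℂ)) := by
  obtain ⟨α, hα⟩ := det_vandermonde_mul_cueMomentPoly h hM q hq0 hq1
  refine ⟨α, mul_left_cancel₀ (a := (Matrix.vandermonde
    (MvPolynomial.X : Fin m → MvPolynomial (Fin m) ℂ)).det) ?_ ?_⟩
  · exact Matrix.det_vandermonde_ne_zero_iff.2 MvPolynomial.X_injective
  · rw [hα, det_aeval_binomialSection, mul_smul_comm]

/-- The absolute moment as a ratio of Toeplitz determinants: the constant of proportionality in
`cueMomentPoly_eq_smul_toeplitzDet` is found at `x = 0`, and the moment occurs at `x_k = q⁻²`. -/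
theorem toeplitzDet_mul_integral_norm_det_pow {d m : ℕ} (hM : M + m = ℓ + d + 1)
    (q : ℝ) (hq0 : 0 < q) (hq1 : q < 1) :
    toeplitzDet m ℓ (geomSeries (1 : ℂ) ^ (d + 1)) *
        ((∫ U, ‖(topLeftBlock h U - (q : ℂ) • 1).det‖ ^ (2 * m) ∂(cue M) : ℝ) : ℂ) =
      toeplitzDet m ℓ (geomSeries ((q ^ 2 : ℝ) : ℂ) ^ (d + 1) * geomSeries 1 ^ m) := by
  obtain ⟨α, hα⟩ := cueMomentPoly_eq_smul_toeplitzDet h hM q hq0 hq1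
  have hq : (q : ℂ) ≠ 0 := by exact_mod_cast hq0.ne'
  have heval : ∀ y : ℂ, MvPolynomial.eval (fun _ => y) (cueMomentPoly h q m) =
      α * toeplitzDet m ℓ (geomSeries 1 ^ (d + 1) * geomSeries y ^ m) := by
    intro y
    rw [hα, MvPolynomial.smul_eval, map_toeplitzDet, map_mul, map_pow, map_geomSeries, map_prod]
    simp only [map_geomSeries, MvPolynomial.eval_X, map_one, Finset.prod_const, Finset.card_univ,
      Fintype.card_fin]
  have h0 := heval 0
  have h1 := heval ((q ^ 2 : ℝ) : ℂ)⁻¹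
  rw [eval_cueMomentPoly] at h0 h1
  -- at the origin the integrand is antiholomorphic
  simp only [zero_smul, add_zero, Matrix.det_one, Finset.prod_const_one, one_mul, geomSeries_zero,
    one_pow, mul_one] at h0
  rw [integral_conj, integral_det_topLeftBlock_sub_pow h q hq0.ne' m] at h0
  -- at `x_k = q⁻²` it is a multiple of the squared modulus
  have hsq : ∀ U, (∏ _k : Fin m, (1 + ((q ^ 2 : ℝ) : ℂ)⁻¹ • (-(q : ℂ) • topLeftBlock h U)).det) *
      conj ((topLeftBlock h U - (q : ℂ) • 1).det ^ m) =
      (-(q : ℂ)⁻¹) ^ (ℓ * m) *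
        ((‖(topLeftBlock h U - (q : ℂ) • 1).det‖ ^ (2 * m) : ℝ) : ℂ) := by
    intro U
    have : 1 + ((q ^ 2 : ℝ) : ℂ)⁻¹ • (-(q : ℂ) • topLeftBlock h U) =
        -(q : ℂ)⁻¹ • (topLeftBlock h U - (q : ℂ) • 1) := by
      have e1 : ((q ^ 2 : ℝ) : ℂ)⁻¹ * -(q : ℂ) = -(q : ℂ)⁻¹ := by
        push_cast
        field_simp
      rw [smul_smul, e1, smul_sub, smul_smul, neg_mul, inv_mul_cancel₀ hq, neg_one_smul,
        sub_neg_eq_add, add_comm]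
    rw [Finset.prod_const, Finset.card_univ, Fintype.card_fin, this, Matrix.det_smul,
      Fintype.card_fin, mul_pow, ← pow_mul, mul_assoc, Complex.mul_conj,
      Complex.normSq_eq_norm_sq, norm_pow, ← pow_mul, mul_comm m 2]
  simp only [hsq] at h1
  rw [integral_const_mul, integral_complex_ofReal] at h1
  have hr := toeplitzDet_rescale (t := ((q ^ 2 : ℝ) : ℂ)) (by simpa using hq) m ℓ
    (geomSeries 1 ^ (d + 1) * geomSeries ((q ^ 2 : ℝ) : ℂ)⁻¹ ^ m)
  rw [map_mul, map_pow, map_pow, rescale_geomSeries, rescale_geomSeries, mul_one,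
    mul_inv_cancel₀ (by simpa using hq)] at hr
  rw [map_pow, map_neg, Complex.conj_ofReal] at h0
  have huv : (-(q : ℂ)) ^ (ℓ * m) * (-(q : ℂ)⁻¹) ^ (ℓ * m) = 1 := by
    rw [← mul_pow, neg_mul_neg, mul_inv_cancel₀ hq, one_pow]
  have hu2 : ((q ^ 2 : ℝ) : ℂ) ^ (m * ℓ) = (-(q : ℂ)) ^ (ℓ * m) * (-(q : ℂ)) ^ (ℓ * m) := by
    rw [← mul_pow, neg_mul_neg, mul_comm m ℓ]
    push_cast
    ring
  rw [hr, hu2]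
  generalize (((∫ U, ‖(topLeftBlock h U - (q : ℂ) • 1).det‖ ^ (2 * m) ∂(cue M) : ℝ)) : ℂ) = W at *
  generalize (-(q : ℂ)) ^ (ℓ * m) = u at *
  generalize (-(q : ℂ)⁻¹) ^ (ℓ * m) = v at *
  generalize toeplitzDet m ℓ (geomSeries (1 : ℂ) ^ (d + 1)) = A at *
  generalize toeplitzDet m ℓ (geomSeries (1 : ℂ) ^ (d + 1) *
    geomSeries ((q ^ 2 : ℝ) : ℂ)⁻¹ ^ m) = B at *
  linear_combination u * A * h1 - A * W * huv - u * B * h0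

end

/-! ### Evaluation of the normalizing Toeplitz determinant -/

/-- The falling factorials are monic polynomials, so this is a Vandermonde determinant. -/
theorem det_descFactorial (m L : ℕ) :
    (Matrix.of fun i j : Fin m => ((L + (j : ℕ)).descFactorial i : ℂ)).det =
      ∏ j : Fin m, ((j : ℕ).factorial : ℂ) := by
  have h1 := Matrix.det_eval_matrixOfPolynomials_eq_det_vandermonde
    (fun j : Fin m => ((L + (j : ℕ) : ℕ) : ℂ)) (fun i => descPochhammer ℂ i)
    (fun i => descPochhammer_natDegree ℂ i) fun i => monic_descPochhammer ℂ i
  simp only [descPochhammer_eval_eq_descFactorial] at h1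
  rw [← Matrix.det_transpose]
  refine h1.symm.trans ?_
  push_cast
  simp only [add_comm (L : ℂ)]
  rw [Matrix.det_vandermonde_add]
  rcases m with _ | m
  · simp
  · rw [Matrix.det_vandermonde_id_eq_superFactorial, ← Nat.prod_range_factorial_succ,
      Fin.prod_univ_eq_prod_range (fun i => (i.factorial : ℂ)), Finset.prod_range_succ',
      Nat.factorial_zero, Nat.cast_one, mul_one, Nat.cast_prod]

theorem choose_mul_factorial_mul_factorial_eq (a N i : ℕ) :
    (a + N).choose (a + i) * (a + i).factorial * N.factorial =
      (a + N).factorial * N.descFactorial i := by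
  rcases le_or_gt i N with h | h
  · rw [← Nat.factorial_mul_descFactorial h, ← mul_assoc,
      ← Nat.choose_mul_factorial_mul_factorial (show a + i ≤ a + N by omega),
      Nat.add_sub_add_left]
  · rw [Nat.choose_eq_zero_of_lt (by omega), Nat.descFactorial_eq_zero_iff_lt.2 h]
    ring

theorem det_choose_mul_prod_factorial (m L a : ℕ) :
    (Matrix.of fun i j : Fin m => ((a + (L + (j : ℕ))).choose (a + i) : ℂ)).det *
        ((∏ i : Fin m, ((a + (i : ℕ)).factorial : ℂ)) *
          ∏ j : Fin m, ((L + (j : ℕ)).factorial : ℂ)) =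
      (∏ j : Fin m, ((a + (L + (j : ℕ))).factorial : ℂ)) *
        ∏ j : Fin m, ((j : ℕ).factorial : ℂ) := by
  rw [← det_descFactorial m L, ← Matrix.det_diagonal, ← Matrix.det_diagonal, ← Matrix.det_diagonal,
    mul_left_comm, ← Matrix.det_mul, ← Matrix.det_mul, mul_comm (Matrix.det _), ← Matrix.det_mul]
  congr 1
  ext1 i j
  rw [Matrix.mul_diagonal, Matrix.diagonal_mul, Matrix.mul_diagonal]
  simp only [Matrix.of_apply]
  have := choose_mul_factorial_mul_factorial_eq a (L + j) i
  have h2 : ((a + i : ℕ).factorial : ℂ) * ((a + (L + (j : ℕ))).choose (a + i) *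
      (L + (j : ℕ)).factorial) = (L + (j : ℕ)).descFactorial i * (a + (L + (j : ℕ))).factorial := by
    norm_cast
    linarith
  exact h2

theorem Finset.prod_Icc_one_sub_one {K : Type*} [CommMonoid K] (f : ℕ → K) (m : ℕ) :
    ∏ j ∈ Finset.Icc 1 m, f (j - 1) = ∏ j ∈ Finset.range m, f j := by
  induction m with
  | zero => simp
  | succ m ih => rw [Finset.prod_Icc_succ_top (by omega), Finset.prod_range_succ, ih,
      Nat.add_sub_cancel]

/-- Replacing the rows `z^i` by `z^i (1 - z)^(m - 1 - i)` makes all entries binomial coefficients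
`(a + ℓ + j).choose (a + i)` with `a = n - m`. -/
theorem toeplitzDet_geomSeries_one_pow {m n : ℕ} (hmn : m ≤ n) (ℓ : ℕ) :
    toeplitzDet m ℓ (geomSeries (1 : ℂ) ^ n) = ((dualityConst ℓ n m : ℝ) : ℂ) := by
  obtain ⟨a, rfl⟩ := Nat.exists_eq_add_of_le' hmn
  set u : Fin m → Polynomial ℂ := fun i =>
    Polynomial.X ^ (i : ℕ) * (1 - Polynomial.X) ^ (m - 1 - (i : ℕ)) with hu
  have hnat : (1 - Polynomial.X : Polynomial ℂ).natDegree ≤ 1 := by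
    refine (Polynomial.natDegree_sub_le _ _).trans ?_
    simp
  have hdeg : ∀ i, (u i).natDegree < m := by
    intro i
    refine (Polynomial.natDegree_mul_le).trans_lt ?_
    rw [Polynomial.natDegree_X_pow]
    have := (Polynomial.natDegree_pow_le (p := (1 - Polynomial.X : Polynomial ℂ))
      (n := m - 1 - (i : ℕ))).trans (Nat.mul_le_mul_left _ hnat)
    omega
  have h1 := det_coeff_polynomial_mul m ℓ (geomSeries (1 : ℂ) ^ (a + m)) u hdeg
  have hE : (Matrix.of fun i j : Fin m => (u i).coeff j).det = 1 := by
    rw [Matrix.det_of_isUpperTriangular]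
    · refine Finset.prod_eq_one fun i _ => ?_
      simp [hu, Polynomial.coeff_X_pow_mul', Polynomial.coeff_zero_eq_eval_zero]
    · intro i j hij
      simp [hu, Polynomial.coeff_X_pow_mul', not_le.2 (show j < i from hij)]
  have hone : (1 - PowerSeries.X) * geomSeries (1 : ℂ) = 1 := by
    simpa using one_sub_mul_geomSeries (1 : ℂ)
  have hF : ∀ i : Fin m, (u i : PowerSeries ℂ) * geomSeries (1 : ℂ) ^ (a + m) =
      PowerSeries.X ^ (i : ℕ) * geomSeries (1 : ℂ) ^ (a + i + 1) := by
    intro i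
    have h2 : a + m = (m - 1 - (i : ℕ)) + (a + i + 1) := by omega
    rw [h2, pow_add, hu]
    simp only [Polynomial.coe_mul, Polynomial.coe_pow, Polynomial.coe_X, Polynomial.coe_sub,
      Polynomial.coe_one]
    rw [mul_assoc, ← mul_assoc ((1 - PowerSeries.X) ^ _), ← mul_pow, hone, one_pow, one_mul]
  have hC : ∀ i j : Fin m, PowerSeries.coeff (ℓ + (j : ℕ))
      (PowerSeries.X ^ (i : ℕ) * geomSeries (1 : ℂ) ^ (a + i + 1)) =
      ((a + (ℓ + (j : ℕ))).choose (a + i) : ℂ) := by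
    intro i j
    rw [PowerSeries.coeff_X_pow_mul']
    split_ifs with h
    · rw [coeff_geomSeries_one_pow, add_assoc, Nat.add_sub_cancel' h]
    · rw [Nat.choose_eq_zero_of_lt (by omega), Nat.cast_zero]
  simp only [hF, hC, hE, one_mul] at h1
  have h2 := det_choose_mul_prod_factorial m ℓ a
  rw [h1] at h2
  have hf : ∀ k : ℕ, (k.factorial : ℂ) ≠ 0 := fun k => Nat.cast_ne_zero.2 k.factorial_ne_zero
  rw [dualityConst, Finset.prod_Icc_one_sub_one (fun j =>
    (((ℓ + (a + m - m) + j).factorial : ℝ) * (j.factorial : ℝ)) /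
      (((a + m - m + j).factorial : ℝ) * ((ℓ + j).factorial : ℝ))), Finset.prod_div_distrib,
    Finset.prod_mul_distrib, Finset.prod_mul_distrib, Nat.add_sub_cancel]
  push_cast
  rw [eq_div_iff (mul_ne_zero (Finset.prod_ne_zero_iff.2 fun _ _ => hf _)
    (Finset.prod_ne_zero_iff.2 fun _ _ => hf _))]
  simp only [Fin.prod_univ_eq_prod_range fun i => ((a + i).factorial : ℂ),
    Fin.prod_univ_eq_prod_range fun i => ((ℓ + i).factorial : ℂ),
    Fin.prod_univ_eq_prod_range fun i => ((a + (ℓ + i)).factorial : ℂ),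
    Fin.prod_univ_eq_prod_range fun i => (i.factorial : ℂ)] at h2
  rw [h2]
  simp only [add_comm ℓ a, add_assoc]

end moment

/-! ### Summation of determinants over chains -/

/-- The weakly increasing sequences `x_0 ≤ … ≤ x_{p-1}` with `x_j ≤ b_j`. -/
def boundedChains (p : ℕ) (b : ℕ → ℕ) : Finset (Fin p → ℕ) :=
  (Fintype.piFinset fun j : Fin p => Finset.range (b j + 1)).filter Monotone

theorem mem_boundedChains {p : ℕ} {b : ℕ → ℕ} {x : Fin p → ℕ} :
    x ∈ boundedChains p b ↔ (∀ j, x j ≤ b j) ∧ Monotone x := by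
  simp [boundedChains]

theorem sum_boundedChains_succ {K : Type*} [AddCommMonoid K] (p : ℕ) (b : ℕ → ℕ)
    (f : (Fin (p + 1) → ℕ) → K) :
    ∑ x ∈ boundedChains (p + 1) b, f x =
      ∑ x ∈ boundedChains p b, ∑ z ∈ (Finset.range (b p + 1)).filter (fun z => ∀ i, x i ≤ z),
        f (Fin.snoc x z) := by
  rw [Finset.sum_sigma']
  refine Finset.sum_bij' (fun x _ => ⟨Fin.init x, x (Fin.last p)⟩)
    (fun y _ => Fin.snoc y.1 y.2) ?_ ?_ ?_ ?_ ?_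
  · intro x hx
    rw [mem_boundedChains] at hx
    rw [Finset.mem_sigma, mem_boundedChains, Finset.mem_filter, Finset.mem_range,
      Nat.lt_succ_iff]
    exact ⟨⟨fun j => hx.1 j.castSucc, fun i j hij => hx.2 (Fin.castSucc_le_castSucc_iff.2 hij)⟩,
      hx.1 (Fin.last p), fun i => hx.2 (Fin.le_last _)⟩
  · rintro ⟨x, z⟩ hx
    rw [Finset.mem_sigma, mem_boundedChains, Finset.mem_filter, Finset.mem_range,
      Nat.lt_succ_iff] at hx
    obtain ⟨⟨h1, h2⟩, h3, h4⟩ := hx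
    rw [mem_boundedChains]
    constructor
    · intro j
      refine Fin.lastCases ?_ (fun j => ?_) j
      · simpa using h3
      · simpa using h1 j
    · intro i j
      refine Fin.lastCases ?_ (fun j => ?_) j
      · refine Fin.lastCases ?_ (fun i => ?_) i
        · simp
        · simpa using fun _ => h4 i
      · refine Fin.lastCases ?_ (fun i => ?_) i
        · intro h
          exact absurd h (not_le.2 (Fin.castSucc_lt_last j))
        · simpa using fun h => h2 h
  · intro x _
    exact Fin.snoc_init_self x
  · rintro ⟨x, z⟩ _
    simp
  · intro x _
    rw [Fin.snoc_init_self]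

/-- A determinant is summed over chains one coordinate at a time, the last one first. The sum over
`x_{j+1}` runs from `x_j` to `b_{j+1}`; by hypothesis its lower end contributes a multiple of column
`j`, which does not change the determinant. -/
theorem sum_boundedChains_det {K : Type*} [CommRing K] {m : ℕ} (b : ℕ → ℕ) (w lam : ℕ → ℕ → K)
    (c : ℕ → ℕ → Fin m → K) (C : ℕ → Fin m → K)
    (h0 : ∑ z ∈ Finset.range (b 0 + 1), w 0 z • c 0 z = C 0)
    (hs : ∀ j a, j + 1 < m → a ≤ b j →
      ∑ z ∈ (Finset.range (b (j + 1) + 1)).filter (fun z => a ≤ z), w (j + 1) z • c (j + 1) z =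
        C (j + 1) - lam j a • c j a) :
    ∑ x ∈ boundedChains m b, (∏ j : Fin m, w j (x j)) *
        (Matrix.of fun i j : Fin m => c j (x j) i).det =
      (Matrix.of fun i j : Fin m => C j i).det := by
  have key : ∀ p ≤ m, ∑ x ∈ boundedChains p b, (∏ j : Fin p, w j (x j)) *
      (Matrix.of fun i j : Fin m => if h : (j : ℕ) < p then c j (x ⟨j, h⟩) i else C j i).det =
      (Matrix.of fun i j : Fin m => C j i).det := by
    intro p
    induction p with
    | zero =>
      intro _
      have : boundedChains 0 b = {Fin.elim0} := by
        ext x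
        simp [mem_boundedChains, Subsingleton.elim x Fin.elim0, Subsingleton.monotone]
      rw [this, Finset.sum_singleton]
      simp
    | succ p ih =>
      intro hp
      rw [← ih (by omega), sum_boundedChains_succ]
      refine Finset.sum_congr rfl fun x hx => ?_
      set A : Matrix (Fin m) (Fin m) K :=
        Matrix.of fun i j => if h : (j : ℕ) < p then c j (x ⟨j, h⟩) i else C j i with hA
      have hM : ∀ z, (Matrix.of fun i j : Fin m => if h : (j : ℕ) < p + 1 then
          c j ((Fin.snoc x z : Fin (p + 1) → ℕ) ⟨j, h⟩) i else C j i) =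
          A.updateCol ⟨p, hp⟩ (c p z) := by
        intro z
        ext1 i j
        rw [Matrix.updateCol_apply, Matrix.of_apply]
        rcases lt_trichotomy (j : ℕ) p with h | h | h
        · rw [if_neg (fun h' => h.ne (congrArg Fin.val h')), dif_pos (by omega), hA,
            Matrix.of_apply, dif_pos h]
          congr 2
          exact Fin.snoc_castSucc (α := fun _ => ℕ) z x ⟨j, h⟩
        · have h' : j = ⟨p, hp⟩ := Fin.ext h
          subst h'
          rw [if_pos rfl, dif_pos (by simp)]
          congr 2
          exact Fin.snoc_last (α := fun _ => ℕ) z x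
        · rw [if_neg (fun h' => h.ne' (congrArg Fin.val h')), dif_neg (by omega), hA,
            Matrix.of_apply, dif_neg (by omega)]
      have hw : ∀ z, ∏ j : Fin (p + 1), w j ((Fin.snoc x z : Fin (p + 1) → ℕ) j) =
          (∏ j : Fin p, w j (x j)) * w p z := by
        intro z
        rw [Fin.prod_univ_castSucc]
        simp
      have hlin : ∀ s : Finset ℕ, ∑ z ∈ s, w p z * (A.updateCol ⟨p, hp⟩ (c p z)).det =
          (A.updateCol ⟨p, hp⟩ (∑ z ∈ s, w p z • c p z)).det := by
        intro s
        induction s using Finset.induction_on with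
        | empty =>
          rw [Finset.sum_empty, Finset.sum_empty]
          exact (Matrix.det_eq_zero_of_column_eq_zero ⟨p, hp⟩ fun i => by simp).symm
        | insert z s hz ih =>
          rw [Finset.sum_insert hz, Finset.sum_insert hz, Matrix.det_updateCol_add,
            Matrix.det_updateCol_smul, ih]
      have hC : A.updateCol ⟨p, hp⟩ (C p) = A := by
        ext1 i j
        rw [Matrix.updateCol_apply]
        split_ifs with h
        · subst h
          rw [hA, Matrix.of_apply, dif_neg (lt_irrefl _)]
        · rfl
      simp only [hM, hw, mul_assoc, ← Finset.mul_sum]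
      rw [hlin]
      congr 1
      rcases p with _ | p
      · have : (Finset.range (b 0 + 1)).filter (fun z => ∀ i : Fin 0, x i ≤ z) =
            Finset.range (b 0 + 1) := Finset.filter_true_of_mem fun _ _ i => i.elim0
        rw [this, h0, hC]
      · rw [mem_boundedChains] at hx
        have : (Finset.range (b (p + 1) + 1)).filter (fun z => ∀ i, x i ≤ z) =
            (Finset.range (b (p + 1) + 1)).filter (fun z => x (Fin.last p) ≤ z) :=
          Finset.filter_congr fun z _ =>
            ⟨fun h => h _, fun h i => (hx.2 (Fin.le_last i)).trans h⟩
        rw [this, hs p _ hp (hx.1 (Fin.last p)), sub_eq_add_neg, ← neg_smul,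
          Matrix.det_updateCol_add, Matrix.det_updateCol_smul, hC]
        have hz : (A.updateCol ⟨p + 1, hp⟩ (c p (x (Fin.last p)))).det = 0 := by
          have hne : (⟨p, by omega⟩ : Fin m) ≠ ⟨p + 1, hp⟩ := fun h => by
            have := congrArg Fin.val h
            simp at this
          refine Matrix.det_zero_of_column_eq hne fun i => ?_
          rw [Matrix.updateCol_ne hne, Matrix.updateCol_self, hA, Matrix.of_apply,
            dif_pos (Nat.lt_succ_self p)]
          rfl
        rw [hz, mul_zero, add_zero]
  rw [← key m le_rfl]
  refine Finset.sum_congr rfl fun x _ => ?_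
  refine congrArg _ (congrArg Matrix.det ?_)
  ext1 i j
  simp

/-! ### Transition determinants of last passage percolation -/

theorem coeff_succ_one_sub_mul {K : Type*} [CommRing K] (a : K) (F : PowerSeries K) (k : ℕ) :
    PowerSeries.coeff (k + 1) ((1 - PowerSeries.C a * PowerSeries.X) * F) =
      PowerSeries.coeff (k + 1) F - a * PowerSeries.coeff k F := by
  rw [sub_mul, one_mul, map_sub, mul_assoc, PowerSeries.coeff_C_mul, PowerSeries.coeff_succ_X_mul]

theorem sum_coeff_one_sub_mul {K : Type*} [CommRing K] (F : PowerSeries K) (L : ℕ) :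
    ∑ k ∈ Finset.range (L + 1),
        PowerSeries.coeff k ((1 - PowerSeries.C 1 * PowerSeries.X) * F) =
      PowerSeries.coeff L F := by
  induction L with
  | zero => simp
  | succ L ih => rw [Finset.sum_range_succ, ih, coeff_succ_one_sub_mul, one_mul, add_sub_cancel]

/-- Column `j` of the transition determinant, as a function of the value `x` of the coordinate `j`:
the coefficients `[z^(x + j - i)] (1 - z)^(-(m - 1 - j)) (1 - t z)^(-n)`. -/
noncomputable def lppColumn {K : Type*} [CommRing K] (m : ℕ) (t : K) (n j x : ℕ) : Fin m → K :=
  fun i => PowerSeries.coeff (x + j)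
    (PowerSeries.X ^ (i : ℕ) * (geomSeries 1 ^ (m - 1 - j) * geomSeries t ^ n))

/-- The sequence `0, y_0, y_1, …`. -/
def delaySeq (y : ℕ → ℕ) : ℕ → ℕ
  | 0 => 0
  | j + 1 => y j

section

variable {K : Type*} [CommRing K] (m : ℕ) (t : K)

theorem lppColumn_succ_left (n x : ℕ) {j : ℕ} (hj : j + 1 < m) :
    lppColumn m t n (j + 1) x = lppColumn m t n j (x + 1) - lppColumn m t n j x := by
  ext i
  have h : PowerSeries.X ^ (i : ℕ) * (geomSeries (1 : K) ^ (m - 1 - (j + 1)) * geomSeries t ^ n) =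
      (1 - PowerSeries.C 1 * PowerSeries.X) *
        (PowerSeries.X ^ (i : ℕ) * (geomSeries (1 : K) ^ (m - 1 - j) * geomSeries t ^ n)) := by
    rw [show m - 1 - j = m - 1 - (j + 1) + 1 by omega, pow_succ]
    linear_combination (-(PowerSeries.X ^ (i : ℕ) * (geomSeries (1 : K) ^ (m - 1 - (j + 1)) *
      geomSeries t ^ n))) * one_sub_mul_geomSeries (1 : K)
  rw [Pi.sub_apply, lppColumn, h, ← add_assoc, coeff_succ_one_sub_mul, one_mul, lppColumn,
    lppColumn, add_right_comm]

theorem lppColumn_succ_right (n x j : ℕ) :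
    lppColumn m t n j (x + 1) =
      lppColumn m t (n + 1) j (x + 1) - t • lppColumn m t (n + 1) j x := by
  ext i
  have h : PowerSeries.X ^ (i : ℕ) * (geomSeries (1 : K) ^ (m - 1 - j) * geomSeries t ^ n) =
      (1 - PowerSeries.C t * PowerSeries.X) *
        (PowerSeries.X ^ (i : ℕ) *
          (geomSeries (1 : K) ^ (m - 1 - j) * geomSeries t ^ (n + 1))) := by
    rw [pow_succ]
    linear_combination (-(PowerSeries.X ^ (i : ℕ) * (geomSeries (1 : K) ^ (m - 1 - j) *
      geomSeries t ^ n))) * one_sub_mul_geomSeries t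
  rw [Pi.sub_apply, Pi.smul_apply, smul_eq_mul, lppColumn, h, add_right_comm,
    coeff_succ_one_sub_mul, lppColumn, lppColumn, add_right_comm]

theorem lppColumn_zero_zero (n : ℕ) : lppColumn m t n 0 0 = lppColumn m t (n + 1) 0 0 := by
  ext i
  have h : ∀ n, PowerSeries.constantCoeff (geomSeries (1 : K) ^ (m - 1 - 0) * geomSeries t ^ n) =
      1 := by
    intro n
    have h1 : ∀ a : K, PowerSeries.constantCoeff (geomSeries a) = 1 := fun a => by
      rw [← PowerSeries.coeff_zero_eq_constantCoeff_apply, coeff_geomSeries, pow_zero]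
    simp [h1]
  rw [lppColumn, lppColumn, add_zero, PowerSeries.coeff_zero_eq_constantCoeff_apply,
    PowerSeries.coeff_zero_eq_constantCoeff_apply, map_mul, h,
    map_mul PowerSeries.constantCoeff (PowerSeries.X ^ (i : ℕ)), h]

theorem sum_lppColumn_zero (n Y : ℕ) :
    ∑ z ∈ Finset.range (Y + 1), t ^ (Y - z) • lppColumn m t n 0 z = lppColumn m t (n + 1) 0 Y := by
  induction Y with
  | zero => simp [lppColumn_zero_zero m t n]
  | succ Y ih =>
    have h : ∀ z ∈ Finset.range (Y + 1), t ^ (Y + 1 - z) • lppColumn m t n 0 z =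
        t • (t ^ (Y - z) • lppColumn m t n 0 z) := by
      intro z hz
      have := Finset.mem_range.1 hz
      rw [smul_smul, ← pow_succ', show Y - z + 1 = Y + 1 - z by omega]
    rw [Finset.sum_range_succ, Finset.sum_congr rfl h, ← Finset.smul_sum, ih, Nat.sub_self,
      pow_zero, one_smul, lppColumn_succ_right]
    abel

theorem sum_filter_lppColumn {n j a Y : ℕ} (hj : j + 1 < m) (ha : a ≤ Y + 1) :
    ∑ z ∈ (Finset.range (Y + 1)).filter (fun z => a ≤ z), lppColumn m t n (j + 1) z =
      lppColumn m t n j (Y + 1) - lppColumn m t n j a := by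
  simp only [lppColumn_succ_left m t _ _ hj]
  have : (Finset.range (Y + 1)).filter (fun z => a ≤ z) = Finset.Ico a (Y + 1) := by
    ext z
    simp [and_comm]
  rw [this]
  exact Finset.sum_Ico_sub _ ha

/-- The sum over one coordinate in the transition of a row. The values `z ≤ Y'` all carry the weight
`t^(Y - Y')` and telescope in the column index, the values above `Y'` are summed as in
`sum_lppColumn_zero`. -/
theorem sum_filter_pow_smul_lppColumn {n j a Y' Y : ℕ} (hj : j + 1 < m) (ha : a ≤ Y')
    (hY : Y' ≤ Y) :
    ∑ z ∈ (Finset.range (Y + 1)).filter (fun z => a ≤ z),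
        t ^ (Y - max z Y') • lppColumn m t n (j + 1) z =
      lppColumn m t (n + 1) (j + 1) Y + (t ^ (Y - Y') * (1 - t)) • lppColumn m t (n + 1) j Y' -
        t ^ (Y - Y') • lppColumn m t n j a := by
  induction Y, hY using Nat.le_induction with
  | base =>
    have h : ∀ z ∈ (Finset.range (Y' + 1)).filter (fun z => a ≤ z),
        t ^ (Y' - max z Y') • lppColumn m t n (j + 1) z = lppColumn m t n (j + 1) z := by
      intro z _
      rw [Nat.sub_eq_zero_of_le (le_max_right _ _), pow_zero, one_smul]
    rw [Finset.sum_congr rfl h, sum_filter_lppColumn m t hj (by omega), Nat.sub_self, pow_zero,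
      one_mul, one_smul, lppColumn_succ_right, lppColumn_succ_left m t _ _ hj, sub_smul, one_smul]
    abel
  | succ Y hY ih =>
    have h : ∀ z ∈ (Finset.range (Y + 1)).filter (fun z => a ≤ z),
        t ^ (Y + 1 - max z Y') • lppColumn m t n (j + 1) z =
          t • (t ^ (Y - max z Y') • lppColumn m t n (j + 1) z) := by
      intro z hz
      have := Finset.mem_range.1 (Finset.mem_filter.1 hz).1
      have h2 : max z Y' ≤ Y := max_le (by omega) hY
      rw [smul_smul, ← pow_succ', show Y - max z Y' + 1 = Y + 1 - max z Y' by omega]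
    rw [Finset.range_add_one, Finset.filter_insert, if_pos (by omega), Finset.sum_insert (by simp),
      Finset.sum_congr rfl h, ← Finset.smul_sum, ih, max_eq_left (by omega), Nat.sub_self, pow_zero,
      one_smul, lppColumn_succ_right, show Y + 1 - Y' = Y - Y' + 1 by omega, pow_succ']
    simp only [smul_sub, smul_add, smul_smul, mul_assoc]
    abel

/-- The transition determinant `det [z^(y_j + j - i)] (1 - z)^(-(m - 1 - j)) (1 - t z)^(-n)`. For
weakly increasing `y` and independent geometric weights with parameter `t`, the last passage times
of row `n` are equal to `y` with probability `(1 - t)^(n m)` times this determinant. -/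
noncomputable def lppDet (n : ℕ) (y : Fin m → ℕ) : K :=
  (Matrix.of fun i j : Fin m => lppColumn m t n j (y j) i).det

/-- One step of the Markov chain of rows: if row `n` has the values `x`, then row `n + 1` has the
values `y` exactly if its weights are `y_j - max (x_j, y_{j-1})`. -/
theorem sum_boundedChains_lppDet (n : ℕ) {y : ℕ → ℕ} (hy : Monotone y) :
    ∑ x ∈ boundedChains m y, (∏ j : Fin m, t ^ (y j - max (x j) (delaySeq y j))) *
        lppDet m t n x = lppDet m t (n + 1) fun j => y j := by
  -- these columns differ from those of `lppDet (n + 1)` by multiples of the preceding columns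
  set C : ℕ → Fin m → K := fun j => match j with
    | 0 => lppColumn m t (n + 1) 0 (y 0)
    | j + 1 => lppColumn m t (n + 1) (j + 1) (y (j + 1)) +
        (t ^ (y (j + 1) - y j) * (1 - t)) • lppColumn m t (n + 1) j (y j) with hC
  refine (sum_boundedChains_det y (fun j z => t ^ (y j - max z (delaySeq y j)))
    (fun j _ => t ^ (y (j + 1) - y j)) (lppColumn m t n) C ?_ ?_).trans ?_
  · simp only [delaySeq, Nat.max_zero, sum_lppColumn_zero, hC]
  · intro j a hj ha
    exact sum_filter_pow_smul_lppColumn m t hj ha (hy (Nat.le_succ j))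
  · rcases m with _ | m
    · simp [lppDet]
    · refine (Matrix.det_eq_of_forall_col_eq_smul_add_pred
        (fun j : Fin m => -(t ^ (y (j + 1) - y j) * (1 - t))) ?_ ?_).symm
      · intro i
        simp [hC]
      · intro i j
        simp [hC]

/-- Summing over all rows with entries at most `ℓ` gives a Toeplitz determinant, after column
operations that remove the factors `(1 - z)^j`. -/
theorem sum_boundedChains_lppDet_const (n ℓ : ℕ) :
    ∑ x ∈ boundedChains m fun _ => ℓ, lppDet m t n x =
      toeplitzDet m ℓ (geomSeries t ^ n * geomSeries 1 ^ m) := by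
  set C : ℕ → Fin m → K := fun j i => PowerSeries.coeff (ℓ + j)
    (PowerSeries.X ^ (i : ℕ) * (geomSeries 1 ^ (m - j) * geomSeries t ^ n)) with hC
  have h1 := sum_boundedChains_det (fun _ => ℓ) (fun _ _ => (1 : K)) (fun _ _ => 1)
    (lppColumn m t n) C ?_ ?_
  · simp only [Finset.prod_const_one, one_mul] at h1
    refine h1.trans ?_
    -- the unitriangular matrix of multiplication of column `j` by `(1 - z)^j`
    set E : Matrix (Fin m) (Fin m) K := Matrix.of fun b j =>
      if (b : ℕ) ≤ j then ((1 - Polynomial.X : Polynomial K) ^ (j : ℕ)).coeff (j - b) else 0 with hE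
    have hE1 : E.det = 1 := by
      rw [Matrix.det_of_isUpperTriangular]
      · refine Finset.prod_eq_one fun i _ => ?_
        simp [hE, Polynomial.coeff_zero_eq_eval_zero]
      · intro i j hij
        simp [hE, not_le.2 (show j < i from hij)]
    have hT : toeplitzDet m ℓ (geomSeries t ^ n * geomSeries 1 ^ m) * E.det =
        toeplitzDet m ℓ (geomSeries t ^ n * geomSeries 1 ^ m) := by rw [hE1, mul_one]
    rw [← hT, toeplitzDet, ← Matrix.det_mul]
    congr 1
    ext1 i j
    rw [Matrix.mul_apply]
    set H : PowerSeries K := PowerSeries.X ^ (i : ℕ) * (geomSeries t ^ n * geomSeries 1 ^ m) with hH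
    have hF : PowerSeries.X ^ (i : ℕ) * (geomSeries (1 : K) ^ (m - j) * geomSeries t ^ n) =
        (1 - PowerSeries.X) ^ (j : ℕ) * H := by
      have hone : (1 - PowerSeries.X) ^ (j : ℕ) * geomSeries (1 : K) ^ (j : ℕ) = 1 := by
        have := one_sub_mul_geomSeries (1 : K)
        rw [map_one, one_mul] at this
        rw [← mul_pow, this, one_pow]
      have hpow : geomSeries (1 : K) ^ m =
          geomSeries (1 : K) ^ (m - (j : ℕ)) * geomSeries (1 : K) ^ (j : ℕ) := by
        rw [← pow_add, Nat.sub_add_cancel j.2.le]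
      rw [hH, hpow]
      linear_combination (-(PowerSeries.X ^ (i : ℕ) * geomSeries (1 : K) ^ (m - j) *
        geomSeries t ^ n)) * hone
    have hpoly : (1 - PowerSeries.X : PowerSeries K) ^ (j : ℕ) =
        (((1 - Polynomial.X : Polynomial K) ^ (j : ℕ) : Polynomial K) : PowerSeries K) := by
      simp
    rw [Matrix.of_apply, hC]
    beta_reduce
    rw [hF, hpoly, PowerSeries.coeff_mul, Finset.Nat.sum_antidiagonal_eq_sum_range_succ_mk]
    simp only [Polynomial.coeff_coe, Matrix.of_apply, hE]
    have hdeg : ((1 - Polynomial.X : Polynomial K) ^ (j : ℕ)).natDegree ≤ j := by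
      refine Polynomial.natDegree_pow_le.trans ?_
      refine (Nat.mul_le_mul_left _ (Polynomial.natDegree_sub_le _ _)).trans ?_
      rw [Polynomial.natDegree_one, Nat.zero_max]
      exact (Nat.mul_le_mul_left _ Polynomial.natDegree_X_le).trans (mul_one _).le
    rw [Fin.sum_univ_eq_sum_range fun b => PowerSeries.coeff (ℓ + b) H *
        if b ≤ (j : ℕ) then ((1 - Polynomial.X : Polynomial K) ^ (j : ℕ)).coeff (j - b) else 0]
    refine (Finset.sum_subset (s₁ := Finset.range (j + 1)) (Finset.range_mono (by omega))
      fun b _ hb => ?_).symm.trans (Eq.trans ?_ (Finset.sum_subset (s₁ := Finset.range (j + 1))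
      (Finset.range_mono (by omega)) fun b _ hb => ?_))
    · rw [Finset.mem_range] at hb
      rw [Polynomial.coeff_eq_zero_of_natDegree_lt (by omega), zero_mul]
    · rw [← Finset.sum_range_reflect]
      refine Finset.sum_congr rfl fun b hb => ?_
      have hb' := Finset.mem_range.1 hb
      rw [if_pos (by omega), show (j : ℕ) + 1 - 1 - b = j - b by omega,
        show ℓ + (j : ℕ) - (j - b) = ℓ + b by omega, mul_comm]
    · rw [Finset.mem_range] at hb
      rw [if_neg (by omega), mul_zero]
  · ext i
    obtain ⟨m, rfl⟩ := Nat.exists_eq_succ_of_ne_zero (Fin.pos i).ne'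
    have hF : PowerSeries.X ^ (i : ℕ) * (geomSeries (1 : K) ^ (m + 1 - 1 - 0) * geomSeries t ^ n) =
        (1 - PowerSeries.C 1 * PowerSeries.X) *
          (PowerSeries.X ^ (i : ℕ) * (geomSeries (1 : K) ^ (m + 1) * geomSeries t ^ n)) := by
      rw [Nat.sub_zero, Nat.add_sub_cancel, pow_succ]
      linear_combination (-(PowerSeries.X ^ (i : ℕ) * (geomSeries (1 : K) ^ m *
        geomSeries t ^ n))) * one_sub_mul_geomSeries (1 : K)
    simp only [one_smul, Finset.sum_apply, lppColumn, add_zero, hC, Nat.sub_zero]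
    rw [← Nat.sub_zero (m + 1 - 1), hF]
    exact sum_coeff_one_sub_mul _ ℓ
  · intro j a hj ha
    simp only [one_smul, sum_filter_lppColumn m t hj (ha.trans (Nat.le_succ _))]
    congr 1
    ext i
    simp only [lppColumn, hC]
    rw [show m - 1 - j = m - (j + 1) by omega, show ℓ + 1 + j = ℓ + (j + 1) by omega]

theorem lppDet_zero {y : Fin m → ℕ} (hy : Monotone y) :
    lppDet m t 0 y = if ∀ j, y j = 0 then 1 else 0 := by
  split_ifs with h
  · rw [lppDet, Matrix.det_of_isUpperTriangular]
    · refine Finset.prod_eq_one fun i _ => ?_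
      have h1 : PowerSeries.constantCoeff (geomSeries (1 : K)) = 1 := by
        rw [← PowerSeries.coeff_zero_eq_constantCoeff_apply, coeff_geomSeries, pow_zero]
      simp [lppColumn, h, PowerSeries.coeff_X_pow_mul', h1]
    · intro i j hij
      simp [lppColumn, h, PowerSeries.coeff_X_pow_mul', not_le.2 (show j < i from hij)]
  -- if some entry is positive then so is the last one, and the last column vanishes
  · push Not at h
    obtain ⟨j, hj⟩ := h
    have hm := Fin.pos j
    have h1 : y j ≤ y ⟨m - 1, by omega⟩ := hy (Fin.le_def.2 (by simp; omega))
    rw [lppDet]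
    refine Matrix.det_eq_zero_of_column_eq_zero ⟨m - 1, by omega⟩ fun i => ?_
    have h2 := i.2
    simp only [lppColumn, Matrix.of_apply, Nat.sub_self, pow_zero, mul_one]
    rw [PowerSeries.coeff_X_pow, if_neg (by omega)]

end

/-! ### The recursion for last passage times -/

/-- The last passage times of the array `v`, computed by their recursion. The indices are shifted
by one: row and column `0` are a boundary of zeros, and `lppArray v (i + 1) (j + 1)` is the last
passage time to the cell `(i, j)`. -/
def lppArray (v : ℕ → ℕ → ℕ) : ℕ → ℕ → ℕ
  | 0, _ => 0
  | _ + 1, 0 => 0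
  | i + 1, j + 1 => max (lppArray v i (j + 1)) (lppArray v (i + 1) j) + v i j

section

variable (v : ℕ → ℕ → ℕ)

theorem lppArray_zero_left (j : ℕ) : lppArray v 0 j = 0 := by simp [lppArray]

theorem lppArray_zero_right (i : ℕ) : lppArray v i 0 = 0 := by cases i <;> simp [lppArray]

theorem lppArray_succ_succ (i j : ℕ) : lppArray v (i + 1) (j + 1) =
    max (lppArray v i (j + 1)) (lppArray v (i + 1) j) + v i j := by rw [lppArray]

theorem lppArray_mono_right (i : ℕ) : Monotone (lppArray v i) := by
  refine monotone_nat_of_le_succ fun j => ?_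
  rcases i with _ | i
  · rw [lppArray_zero_left, lppArray_zero_left]
  · rw [lppArray_succ_succ]
    exact (le_max_right _ _).trans (Nat.le_add_right _ _)

theorem lppArray_le_succ_left (i j : ℕ) : lppArray v i j ≤ lppArray v (i + 1) j := by
  rcases j with _ | j
  · rw [lppArray_zero_right, lppArray_zero_right]
  · rw [lppArray_succ_succ]
    exact (le_max_left _ _).trans (Nat.le_add_right _ _)

variable {v}

theorem lppArray_congr {v' : ℕ → ℕ → ℕ} {n m : ℕ} (h : ∀ i < n, ∀ j < m, v i j = v' i j) :
    ∀ i ≤ n, ∀ j ≤ m, lppArray v i j = lppArray v' i j := by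
  intro i
  induction i with
  | zero => exact fun _ j _ => by rw [lppArray_zero_left, lppArray_zero_left]
  | succ i ihi =>
    intro hi j
    induction j with
    | zero => exact fun _ => by rw [lppArray_zero_right, lppArray_zero_right]
    | succ j ihj =>
      intro hj
      rw [lppArray_succ_succ, lppArray_succ_succ, ihi (by omega) _ hj, ihj (by omega),
        h i (by omega) j (by omega)]

end

theorem lppArray_natPred (w : ℕ+ × ℕ+ → ℕ) (s : ℕ+ × ℕ+) :
    lppArray (fun i j => w (i.succPNat, j.succPNat)) s.1 s.2 =
      max (lppArray (fun i j => w (i.succPNat, j.succPNat)) s.1.natPred s.2)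
        (lppArray (fun i j => w (i.succPNat, j.succPNat)) s.1 s.2.natPred) + w s := by
  have h := lppArray_succ_succ (fun i j => w (i.succPNat, j.succPNat)) s.1.natPred s.2.natPred
  simpa only [PNat.natPred_add_one, PNat.succPNat_natPred] using h

/-- No up-right path collects more than the recursively computed last passage time. -/
theorem sum_le_lppArray (w : ℕ+ × ℕ+ → ℕ) (π : List (ℕ+ × ℕ+)) (s : ℕ+ × ℕ+)
    (hc : π.IsChain UpRightStep) (hl : π.getLast? = some s) :
    (π.map w).sum ≤ lppArray (fun i j => w (i.succPNat, j.succPNat)) s.1 s.2 := by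
  induction π using List.reverseRecOn generalizing s with
  | nil => simp at hl
  | append_singleton π a ih =>
    have ha : a = s := by simpa using hl
    subst ha
    rw [List.map_append, List.sum_append, List.map_singleton, List.sum_singleton, lppArray_natPred]
    refine Nat.add_le_add_right ?_ _
    rcases hπ : π.getLast? with _ | b
    · rw [List.getLast?_eq_none_iff.1 hπ]
      simp
    · obtain ⟨h1, -, h2⟩ := List.isChain_append.1 hc
      have hstep := h2 b hπ a (by simp)
      refine (ih b h1 hπ).trans ?_
      rcases hstep with rfl | rfl
      · exact (le_of_eq (by simp [PNat.natPred])).trans (le_max_left _ _)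
      · exact (le_of_eq (by simp [PNat.natPred])).trans (le_max_right _ _)

/-- An optimal path to `s` extends an optimal path to one of its predecessors. The induction is over
the sum `k` of the coordinates. -/
theorem exists_sum_eq_lppArray (w : ℕ+ × ℕ+ → ℕ) : ∀ k : ℕ, ∀ s : ℕ+ × ℕ+, (s.1 + s.2 : ℕ) = k →
    ∃ π ∈ upRightPaths s.1 s.2,
      (π.map w).sum = lppArray (fun i j => w (i.succPNat, j.succPNat)) s.1 s.2 := by
  have key : ∀ {b s : ℕ+ × ℕ+} {π : List (ℕ+ × ℕ+)}, π ∈ upRightPaths b.1 b.2 →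
      UpRightStep b s → π ++ [s] ∈ upRightPaths s.1 s.2 := by
    rintro b s π ⟨h1, h2, h3⟩ h4
    refine ⟨List.isChain_append.2 ⟨h1, by simp, ?_⟩, by simp [h2], by simp⟩
    intro x hx y hy
    simp_all
  have hpred : ∀ a : ℕ+, (a + 1).natPred = a := fun a => by simp [PNat.natPred]
  intro k
  induction k with
  | zero =>
    intro s hs
    have := s.1.pos
    omega
  | succ k ih =>
    rintro ⟨i, j⟩ hs
    have hL : ∀ (b : ℕ+ × ℕ+), (b.1 + b.2 : ℕ) = k → UpRightStep b (i, j) →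
        ∃ π ∈ upRightPaths i j, (π.map w).sum =
          lppArray (fun i j => w (i.succPNat, j.succPNat)) b.1 b.2 + w (i, j) := by
      intro b hb hstep
      obtain ⟨π, hπ, hsum⟩ := ih b hb
      refine ⟨π ++ [(i, j)], key hπ hstep, ?_⟩
      rw [List.map_append, List.sum_append, hsum]
      simp
    rw [lppArray_natPred]
    by_cases hi : i = 1
    · subst hi
      have h0 : lppArray (fun i j => w (i.succPNat, j.succPNat)) (1 : ℕ+).natPred j = 0 :=
        lppArray_zero_left _ _
      rw [h0, max_eq_right (Nat.zero_le _)]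
      by_cases hj : j = 1
      · subst hj
        refine ⟨[(1, 1)], by simp [upRightPaths], ?_⟩
        have h1 : lppArray (fun i j => w (i.succPNat, j.succPNat)) (1 : ℕ+) (1 : ℕ+).natPred = 0 :=
          lppArray_zero_right _ _
        rw [h1]
        simp
      · obtain ⟨b, rfl⟩ := PNat.exists_eq_succ_of_ne_one hj
        rw [hpred]
        exact hL (1, b) (by simpa [← add_assoc] using hs) (Or.inr rfl)
    · obtain ⟨a, rfl⟩ := PNat.exists_eq_succ_of_ne_one hi
      rw [hpred]
      by_cases hj : j = 1
      · subst hj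
        have h1 : lppArray (fun i j => w (i.succPNat, j.succPNat)) (a + 1 : ℕ+)
            (1 : ℕ+).natPred = 0 := lppArray_zero_right _ _
        rw [h1, max_eq_left (Nat.zero_le _)]
        exact hL (a, 1) (by simpa using hs) (Or.inl rfl)
      · obtain ⟨b, rfl⟩ := PNat.exists_eq_succ_of_ne_one hj
        rw [hpred]
        have ha := hL (a, b + 1) (by simp only [PNat.add_coe, PNat.one_coe] at hs ⊢; omega)
          (Or.inl rfl)
        have hb := hL (a + 1, b) (by simp only [PNat.add_coe, PNat.one_coe] at hs ⊢; omega)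
          (Or.inr rfl)
        rcases max_choice (lppArray (fun i j => w (i.succPNat, j.succPNat)) a (b + 1 : ℕ+))
          (lppArray (fun i j => w (i.succPNat, j.succPNat)) (a + 1 : ℕ+) b) with h | h
        · rw [h]
          exact ha
        · rw [h]
          exact hb

theorem lastPassageTime_eq_lppArray (w : ℕ+ × ℕ+ → ℕ) (n m : ℕ+) :
    lastPassageTime w n m = lppArray (fun i j => w (i.succPNat, j.succPNat)) n m := by
  obtain ⟨⟨π, hπ, hsum⟩, hub⟩ := isGreatest_lastPassageTime w n m
  refine le_antisymm ?_ ?_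
  · rw [← hsum]
    exact sum_le_lppArray w π (n, m) hπ.1 hπ.2.2
  · obtain ⟨π, hπ, hsum⟩ := exists_sum_eq_lppArray w _ (n, m) rfl
    rw [← hsum]
    exact hub ⟨π, hπ, rfl⟩

/-! ### The law of the last passage times -/

theorem exists_monotone_extension {m : ℕ} {x : Fin m → ℕ} (hx : Monotone x) :
    ∃ y : ℕ → ℕ, Monotone y ∧ ∀ j : Fin m, y j = x j := by
  refine ⟨fun k => (Finset.univ.filter fun i : Fin m => (i : ℕ) ≤ k).sup x, ?_, ?_⟩
  · intro a b hab
    exact Finset.sup_mono fun i hi => by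
      simp only [Finset.mem_filter, Finset.mem_univ, true_and] at hi ⊢
      exact hi.trans hab
  · intro j
    refine le_antisymm (Finset.sup_le fun i hi => hx ?_) (Finset.le_sup (f := x) (by simp))
    simpa using hi

/-- The last passage times in row `n + 1` are the prescribed values `y` exactly if those in row `n`
form a chain `x` below `y` and the weights of the new row make up for the differences. -/
theorem lppArray_succ_eq_iff (v : ℕ → ℕ → ℕ) (n m : ℕ) {y : ℕ → ℕ} (hy : Monotone y) :
    (∀ j : Fin m, lppArray v (n + 1) (j + 1) = y j) ↔
      ∃ x ∈ boundedChains m y, (∀ j : Fin m, lppArray v n (j + 1) = x j) ∧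
        ∀ j : Fin m, v n j = y j - max (x j) (delaySeq y j) := by
  constructor
  · intro h
    refine ⟨fun j => lppArray v n (j + 1), mem_boundedChains.2 ⟨fun j => ?_, fun i j hij => ?_⟩,
      fun _ => rfl, fun j => ?_⟩
    · exact (lppArray_le_succ_left v n _).trans (h j).le
    · exact lppArray_mono_right v n (Nat.succ_le_succ hij)
    · have hd : lppArray v (n + 1) j = delaySeq y j := by
        obtain ⟨_ | j, hj⟩ := j
        · exact lppArray_zero_right v _
        · exact h ⟨j, by omega⟩
      have := h j
      rw [lppArray_succ_succ, hd] at this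
      dsimp only
      omega
  · rintro ⟨x, hx, h1, h2⟩ ⟨j, hj⟩
    obtain ⟨hxy, -⟩ := mem_boundedChains.1 hx
    have hd : ∀ j, delaySeq y j ≤ y j := by
      rintro (_ | j)
      · exact Nat.zero_le _
      · exact hy (Nat.le_succ j)
    have step : ∀ j (hj : j < m), lppArray v (n + 1) j = delaySeq y j →
        lppArray v (n + 1) (j + 1) = y j := by
      intro j hj h
      have e1 := h1 ⟨j, hj⟩
      have e2 := h2 ⟨j, hj⟩
      have e3 := hxy ⟨j, hj⟩
      have e4 := hd j
      dsimp only at e1 e2 e3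
      rw [lppArray_succ_succ, h, e1, e2]
      omega
    induction j with
    | zero => exact step 0 hj (lppArray_zero_right v _)
    | succ j ih => exact step (j + 1) hj (ih (by omega))

section

variable {Ω : Type*} {η : ℕ × ℕ → Ω → ℕ}

/-- The weights in a rectangle, continued by zero. -/
def zeroExtend (S : Finset (ℕ × ℕ)) (u : S → ℕ) : ℕ → ℕ → ℕ :=
  fun i j => if h : (i, j) ∈ S then u ⟨(i, j), h⟩ else 0

theorem lppArray_zeroExtend (x : Ω) (n m : ℕ) {j : ℕ} (hj : j ≤ m) :
    lppArray (zeroExtend (Finset.range n ×ˢ Finset.range m) fun s => η s x) n j =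
      lppArray (fun i j => η (i, j) x) n j := by
  refine lppArray_congr (m := m) (fun i hi k hk => ?_) n le_rfl j hj
  rw [zeroExtend, dif_pos (Finset.mk_mem_product (Finset.mem_range.2 hi) (Finset.mem_range.2 hk))]

theorem setOf_lppArray_eq_preimage (n m : ℕ) (x : Fin m → ℕ) :
    {p | ∀ j : Fin m, lppArray (fun i j => η (i, j) p) n (j + 1) = x j} =
      (fun p (s : (Finset.range n ×ˢ Finset.range m : Finset (ℕ × ℕ))) => η s p) ⁻¹'
        {u | ∀ j : Fin m, lppArray (zeroExtend _ u) n (j + 1) = x j} := by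
  ext p
  refine forall_congr' fun j => ?_
  rw [lppArray_zeroExtend p n m (by omega)]

variable [MeasurableSpace Ω]

theorem measurableSet_lppArray_eq (hm : ∀ s, Measurable (η s)) (n m : ℕ) (x : Fin m → ℕ) :
    MeasurableSet {p | ∀ j : Fin m, lppArray (fun i j => η (i, j) p) n (j + 1) = x j} := by
  rw [setOf_lppArray_eq_preimage]
  exact (measurable_pi_lambda (fun p (s : (Finset.range n ×ˢ Finset.range m : Finset (ℕ × ℕ))) =>
    η s p) fun s => hm s) MeasurableSet.of_discrete

theorem measurableSet_row_eq (hm : ∀ s, Measurable (η s)) (n m : ℕ) (z : Fin m → ℕ) :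
    MeasurableSet {p | ∀ j : Fin m, η (n, j) p = z j} :=
  (measurable_pi_lambda (fun p (j : Fin m) => η (n, j) p) fun j => hm (n, j))
    (MeasurableSet.of_discrete (s := {u : Fin m → ℕ | ∀ j : Fin m, u j = z j}))

variable {P : Measure Ω}

/-- Row `n` of the weights is independent of the last passage times that use only the rows before.
-/
theorem measureReal_lppArray_eq_inter (hm : ∀ s, Measurable (η s)) (hi : iIndepFun η P) (n m : ℕ)
    (x z : Fin m → ℕ) :
    P.real ({p | ∀ j : Fin m, lppArray (fun i j => η (i, j) p) n (j + 1) = x j} ∩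
        {p | ∀ j : Fin m, η (n, j) p = z j}) =
      P.real {p | ∀ j : Fin m, lppArray (fun i j => η (i, j) p) n (j + 1) = x j} *
        P.real {p | ∀ j : Fin m, η (n, j) p = z j} := by
  have hST : Disjoint (Finset.range n ×ˢ Finset.range m) ({n} ×ˢ Finset.range m) :=
    Finset.disjoint_product.2 (Or.inl (by simp))
  have hind := hi.indepFun_finset _ _ hST hm
  have hz : {p | ∀ j : Fin m, η (n, j) p = z j} =
      (fun p (s : ({n} ×ˢ Finset.range m : Finset (ℕ × ℕ))) => η s p) ⁻¹'
        {u | ∀ j : Fin m, u ⟨(n, j), by simp⟩ = z j} := rfl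
  rw [setOf_lppArray_eq_preimage, hz, measureReal_def, hind.measure_inter_preimage_eq_mul _ _
    MeasurableSet.of_discrete MeasurableSet.of_discrete, ENNReal.toReal_mul]
  rfl

theorem measureReal_row_eq (hi : iIndepFun η P) {t : ℝ}
    (hlaw : ∀ s k, P.real {p | η s p = k} = (1 - t) * t ^ k) (n m : ℕ) (z : Fin m → ℕ) :
    P.real {p | ∀ j : Fin m, η (n, j) p = z j} = (1 - t) ^ m * ∏ j, t ^ z j := by
  have hinj : Function.Injective fun j : Fin m => (n, (j : ℕ)) := fun a b h =>
    Fin.ext (congrArg Prod.snd h)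
  have h := (hi.precomp hinj).measure_inter_preimage_eq_mul Finset.univ
    (sets := fun j => {z j}) fun _ _ => MeasurableSet.of_discrete
  have hz : {p | ∀ j : Fin m, η (n, j) p = z j} =
      ⋂ (j : Fin m) (_ : j ∈ Finset.univ), (fun p => η (n, (j : ℕ)) p) ⁻¹' {z j} := by
    ext p
    simp
  rw [hz, measureReal_def, h, ENNReal.toReal_prod]
  refine (Finset.prod_congr rfl fun (j : Fin m) _ => hlaw (n, (j : ℕ)) (z j)).trans ?_
  rw [Finset.prod_mul_distrib, Finset.prod_const, Finset.card_univ, Fintype.card_fin]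

variable [IsProbabilityMeasure P]

/-- The law of a row of last passage times is given by the transition determinant. -/
theorem measureReal_lppArray_eq (hm : ∀ s, Measurable (η s)) (hi : iIndepFun η P) {t : ℝ}
    (hlaw : ∀ s k, P.real {p | η s p = k} = (1 - t) * t ^ k) (n m : ℕ) {x : Fin m → ℕ}
    (hx : Monotone x) :
    P.real {p | ∀ j : Fin m, lppArray (fun i j => η (i, j) p) n (j + 1) = x j} =
      (1 - t) ^ (n * m) * lppDet m t n x := by
  obtain ⟨y, hy, hyx⟩ := exists_monotone_extension hx
  obtain rfl : (fun j : Fin m => y j) = x := funext hyx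
  clear hyx hx
  induction n generalizing y with
  | zero =>
    rw [lppDet_zero m t (fun _ _ h => hy h), zero_mul, pow_zero, one_mul]
    simp only [lppArray_zero_left, eq_comm (a := 0)]
    split_ifs with h <;> simp [h]
  | succ n ih =>
    have hU : {p | ∀ j : Fin m, lppArray (fun i j => η (i, j) p) (n + 1) (j + 1) = y j} =
        ⋃ x ∈ boundedChains m y,
          ({p | ∀ j : Fin m, lppArray (fun i j => η (i, j) p) n (j + 1) = x j} ∩
            {p | ∀ j : Fin m, η (n, j) p = y j - max (x j) (delaySeq y j)}) := by
      ext p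
      simp only [Set.mem_iUnion, exists_prop]
      exact lppArray_succ_eq_iff (fun i j => η (i, j) p) n m hy
    rw [hU, measureReal_biUnion_finset]
    · rw [← sum_boundedChains_lppDet m t n hy, Finset.mul_sum]
      refine Finset.sum_congr rfl fun x hx => ?_
      obtain ⟨y', hy', hyx⟩ := exists_monotone_extension (mem_boundedChains.1 hx).2
      obtain rfl : (fun j : Fin m => y' j) = x := funext hyx
      rw [measureReal_lppArray_eq_inter hm hi n m (fun j => y' j)
        (fun j => y j - max (y' j) (delaySeq y j)), ih y' hy', measureReal_row_eq hi hlaw]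
      ring
    · intro a _ b _ hab
      refine Set.disjoint_left.2 fun p hp hp' => hab (funext fun j => ?_)
      exact (hp.1 j).symm.trans (hp'.1 j)
    · intro x _
      exact (measurableSet_lppArray_eq hm n m x).inter
        (measurableSet_row_eq hm n m fun j => y j - max (x j) (delaySeq y j))

theorem measureReal_lppArray_le (hm : ∀ s, Measurable (η s)) (hi : iIndepFun η P) {t : ℝ}
    (hlaw : ∀ s k, P.real {p | η s p = k} = (1 - t) * t ^ k) (n m : ℕ) (ℓ : ℕ) :
    P.real {p | lppArray (fun i j => η (i, j) p) n m ≤ ℓ} =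
      (1 - t) ^ (n * m) * toeplitzDet m ℓ (geomSeries t ^ n * geomSeries 1 ^ m) := by
  have hU : {p | lppArray (fun i j => η (i, j) p) n m ≤ ℓ} = ⋃ x ∈ boundedChains m fun _ => ℓ,
      {p | ∀ j : Fin m, lppArray (fun i j => η (i, j) p) n (j + 1) = x j} := by
    ext p
    simp only [Set.mem_iUnion, exists_prop, Set.mem_ofPred_eq]
    constructor
    · intro h
      refine ⟨fun j => lppArray (fun i j => η (i, j) p) n (j + 1),
        mem_boundedChains.2 ⟨fun j => (lppArray_mono_right _ n ?_).trans h, fun i j hij => ?_⟩,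
        fun _ => rfl⟩
      · exact j.2
      · exact lppArray_mono_right _ n (Nat.succ_le_succ hij)
    · rintro ⟨x, hx, h⟩
      rcases m with _ | m
      · rw [lppArray_zero_right]
        exact Nat.zero_le _
      · exact (h (Fin.last m)).trans_le ((mem_boundedChains.1 hx).1 _)
  rw [hU, measureReal_biUnion_finset]
  · rw [← sum_boundedChains_lppDet_const, Finset.mul_sum]
    exact Finset.sum_congr rfl fun x hx =>
      measureReal_lppArray_eq hm hi hlaw n m (mem_boundedChains.1 hx).2
  · intro a _ b _ hab
    refine Set.disjoint_left.2 fun p hp hp' => hab (funext fun j => ?_)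
    exact (hp j).symm.trans (hp' j)
  · exact fun x _ => measurableSet_lppArray_eq hm n m x

end

theorem IsGeometricEnvironment.measureReal_lastPassageTime_le {Ω : Type*} [MeasurableSpace Ω]
    {P : Measure Ω} [IsProbabilityMeasure P] {q : ℝ} {ω : ℕ+ × ℕ+ → Ω → ℕ}
    (hω : IsGeometricEnvironment P q ω) (n m : ℕ+) (ℓ : ℕ) :
    P.real {x | lastPassageTime (fun s => ω s x) n m ≤ ℓ} = (1 - q ^ 2) ^ ((n : ℕ) * (m : ℕ)) *
      toeplitzDet m ℓ (geomSeries (q ^ 2) ^ (n : ℕ) * geomSeries 1 ^ (m : ℕ)) := by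
  have hinj : Function.Injective fun s : ℕ × ℕ => (s.1.succPNat, s.2.succPNat) := by
    rintro ⟨a, b⟩ ⟨c, d⟩ h
    simpa using h
  rw [← measureReal_lppArray_le (η := fun s => ω (s.1.succPNat, s.2.succPNat))
    (fun s => hω.measurable _) (hω.indep.precomp hinj)
    (fun s k => by rw [hω.law, ← pow_mul]) n m ℓ]
  simp only [lastPassageTime_eq_lppArray]

/-! ### Products of factorials and the Barnes function -/

/-- Only the values at positive integers are products of factorials: `barnesG 0 = 0`. -/
theorem barnesG_succ (k : ℕ) : barnesG (k + 1) = ∏ i ∈ Finset.range k, (i.factorial : ℝ) := by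
  induction k with
  | zero => simp [barnesG]
  | succ k ih => rw [barnesG, Real.Gamma_nat_eq_factorial, ih, Finset.prod_range_succ, mul_comm]

theorem barnesG_add_add_one (a m : ℕ) : barnesG (a + m + 1) =
    barnesG (a + 1) * ∏ j ∈ Finset.range m, ((a + j).factorial : ℝ) := by
  rw [barnesG_succ, barnesG_succ, Finset.prod_range_add]

theorem barnesG_succ_ne_zero (k : ℕ) : barnesG (k + 1) ≠ 0 := by
  rw [barnesG_succ]
  exact Finset.prod_ne_zero_iff.2 fun i _ => Nat.cast_ne_zero.2 i.factorial_ne_zero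

theorem dualityConst_eq_barnesG {n m : ℕ} (hmn : m ≤ n) (ℓ : ℕ) : dualityConst ℓ n m =
    (barnesG (ℓ + 1) * barnesG (m + 1) * barnesG (ℓ + n + 1) * barnesG (n - m + 1)) /
      (barnesG (ℓ + m + 1) * barnesG (ℓ + (n - m) + 1) * barnesG (n + 1)) := by
  obtain ⟨d, rfl⟩ := Nat.exists_eq_add_of_le hmn
  have hd : m + d - m = d := by omega
  have h1 := barnesG_succ_ne_zero ℓ
  have h2 := barnesG_succ_ne_zero d
  have h3 := barnesG_succ_ne_zero (ℓ + d)
  have h4 : ∀ a, ∏ j ∈ Finset.range m, ((a + j).factorial : ℝ) ≠ 0 := fun a =>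
    Finset.prod_ne_zero_iff.2 fun i _ => Nat.cast_ne_zero.2 (Nat.factorial_ne_zero _)
  have h5 := h4 d
  have h6 := h4 ℓ
  rw [dualityConst, hd, Finset.prod_Icc_one_sub_one (fun j =>
    (((ℓ + d + j).factorial : ℝ) * (j.factorial : ℝ)) /
      (((d + j).factorial : ℝ) * ((ℓ + j).factorial : ℝ))), Finset.prod_div_distrib,
    Finset.prod_mul_distrib, Finset.prod_mul_distrib, ← barnesG_succ m,
    show ℓ + (m + d) = ℓ + d + m by omega, barnesG_add_add_one (ℓ + d), barnesG_add_add_one ℓ m,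
    add_comm m d, barnesG_add_add_one d]
  field_simp

/-! ### The duality -/

/-- The average over the truncated unitary ensemble, as a real Toeplitz determinant. -/
theorem dualityConst_mul_integral_norm_det_pow {n m : ℕ} (hm : 1 ≤ m) (hmn : m ≤ n) (ℓ : ℕ)
    {q : ℝ} (hq0 : 0 < q) (hq1 : q < 1) :
    dualityConst ℓ n m * ∫ U, ‖(topLeftBlock (Nat.le_add_right ℓ (n - m)) U
        - (q : ℂ) • (1 : Matrix (Fin ℓ) (Fin ℓ) ℂ)).det‖ ^ (2 * m) ∂cue (ℓ + (n - m)) =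
      toeplitzDet m ℓ (geomSeries (q ^ 2) ^ n * geomSeries 1 ^ m) := by
  obtain ⟨d, rfl⟩ : ∃ d, n = d + 1 := ⟨n - 1, by omega⟩
  have h := toeplitzDet_mul_integral_norm_det_pow (Nat.le_add_right ℓ (d + 1 - m))
    (d := d) (m := m) (by omega) q hq0 hq1
  rw [toeplitzDet_geomSeries_one_pow hmn] at h
  apply Complex.ofReal_injective
  rw [Complex.ofReal_mul, h]
  refine Eq.trans ?_ (map_toeplitzDet Complex.ofRealHom _ _ _).symm
  rw [map_mul, map_pow, map_pow, map_geomSeries, map_geomSeries, map_one]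
  rfl

theorem theorem2p1 {Ω : Type*} [MeasurableSpace Ω] (P : Measure Ω) [IsProbabilityMeasure P]
    (q : ℝ) (hq0 : 0 < q) (hq1 : q < 1)
    (ω : ℕ+ × ℕ+ → Ω → ℕ) (hω : IsGeometricEnvironment P q ω)
    (n m : ℕ+) (hmn : m ≤ n) (ℓ : ℕ) :
    P.real {x | lastPassageTime (fun s => ω s x) n m ≤ ℓ} =
        dualityConst ℓ n m * (1 - q ^ 2) ^ ((n : ℕ) * (m : ℕ)) *
          ∫ U, ‖(topLeftBlock (Nat.le_add_right ℓ ((n : ℕ) - (m : ℕ))) U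
              - (q : ℂ) • (1 : Matrix (Fin ℓ) (Fin ℓ) ℂ)).det‖ ^ (2 * (m : ℕ))
            ∂(cue (ℓ + ((n : ℕ) - (m : ℕ)))) ∧
      dualityConst ℓ n m =
        (barnesG (ℓ + 1) * barnesG ((m : ℕ) + 1) * barnesG (ℓ + (n : ℕ) + 1) *
            barnesG ((n : ℕ) - (m : ℕ) + 1)) /
          (barnesG (ℓ + (m : ℕ) + 1) * barnesG (ℓ + ((n : ℕ) - (m : ℕ)) + 1) *
            barnesG ((n : ℕ) + 1)) := by
  have hmn' : (m : ℕ) ≤ n := PNat.coe_le_coe _ _ |>.2 hmn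
  refine ⟨?_, dualityConst_eq_barnesG hmn' ℓ⟩
  rw [hω.measureReal_lastPassageTime_le,
    ← dualityConst_mul_integral_norm_det_pow m.pos hmn' ℓ hq0 hq1]
  ring
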